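/- Setting. Let $\Omega\subset\mathbb R^d$ be a bounded open set whose boundary is of class $C^{3,\alpha}$ for some $\alpha\in(0,1)$. Let $\mu$ be a finite measure on $\Omega$, equivalent to Lebesgue measure on $\Omega$, such that the logarithm of its density is bounded; $L^2=L^2(\Omega,\mu)$ with inner product $\langle\cdot,\cdot\rangle$. Let $\mathcal H^p$ be the space of $f\in L^2$ whose weak derivatives $D_\alpha f$, $|\alpha|\le p$, exist and lie in $L^2$, with norm $\sum_{|\alpha|\le p}\|D_\alpha f\|_{L^2}$; let $\mathcal H^1_0$ be the closure of $C_c^\infty(\Omega)$ in $\mathcal H^1$ and $\mathcal H^2_{(0)}=\mathcal H^2\cap\mathcal H^1_0$, with the $\mathcal H^2$ norm. Let $\mathcal A:\mathcal H^2\to L^2$ be a linear operator for which there is $k>0$ such that for all $f_1,f_2\in\mathcal H^2$ $$|\mathcal Af_1(x)-\mathcal Af_2(x)|\le k\sum_{|\alpha|\le 2}|D_\alpha f_1(x)-D_\alpha f_2(x)|\quad\text{for a.e. }x\in\Omega .$$ Let $\eta\in C^3_b(\mathbb R^d)$ satisfy $\eta>0$ in $\Omega$, $\eta=0$ on $\partial\Omega$,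 and $\nabla\eta(x)\cdot\mathbf n_x\ne0$ for $x\in\partial\Omega$, where $\mathbf n_x$ is the outward unit normal. Let $\sigma\in C^4_b(\mathbb R)$ be non-constant. Let $(c,w,b)$ be a random vector in $\mathbb R\times\mathbb R^d\times\mathbb R$ such that $c$ is bounded, $\mathbb E[c]=0$, the law of $(w,b)$ charges every non-empty open subset of $\mathbb R^{d+1}$, $\mathbb E|w_k|^4<\infty$ for each $k$, and $\mathbb E|b|<\infty$. Define $$U(x,y)=\mathbb E\Big[\nabla_{c,w,b}\,\mathcal A\big[\eta\, c\,\sigma(w\cdot{}\,\cdot\,+b)\big](x)\cdot\nabla_{c,w,b}\big(\eta(y)\,c\,\sigma(w\cdot y+b)\big)\Big],$$ where for each $y$ the function $U(\cdot,y)$ is an element of $L^2$ (the gradient of $(c,w,b)\mapsto\mathcal A[\eta c\sigma(w\cdot{}\,\cdot\,+b)]$ and the expectation are those of $L^2$-valued functions), and $$\mathcal Uf(y)=\int_\Omega f(x)\,U(x,y)\,d\mu(x),\qquad \mathcal Sf=\mathcal A\,\mathcal Uf,\qquad f\in L^2 .$$ Statement. (i) If $h\in L^2$ satisfies $\mathcal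 Sh=0$, then $\langle h,\mathcal Af\rangle=0$ for every $f\in\mathcal H^2_{(0)}$. (ii) Let $g\in L^2$ and suppose that the equation $\mathcal Au=g$ has a solution $u\in\mathcal H^2_{(0)}$. Let $(Q_t)_{t\ge0}$ be a solution in $\mathcal H^2_{(0)}$ of $\frac{dQ_t}{dt}=-\mathcal U[\mathcal AQ_t-g]$, $Q_0=0$. Then for every $t\ge0$ and every $h\in L^2$ with $\mathcal Sh=0$ one has $\langle h,\mathcal AQ_t-g\rangle=0$; that is, the residual $\mathcal AQ_t-g$ has zero projection on the kernel of $\mathcal S$. -/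

import Mathlib

open MeasureTheory Filter Topology
open scoped NNReal ENNReal InnerProductSpace

noncomputable section

namespace DGM

/-- Euclidean space `ℝ^d`. -/
abbrev Euc (d : ℕ) : Type := EuclideanSpace ℝ (Fin d)

/-- The Hilbert space `L²(μ)` of real functions on `ℝ^d`. -/
abbrev L2 {d : ℕ} (μ : Measure (Euc d)) : Type := Lp ℝ 2 μ

/-- Parameters `θ = (c, w, b)` of one hidden unit. -/
abbrev Param (d : ℕ) : Type := ℝ × Euc d × ℝ

/-! ### Assumptions on the domain, the measure and the functions `η`, `σ` -/

/-- `f ∈ C^k_b`: `k` times continuously differentiable, with bounded derivatives of order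
`0, …, k`. -/
def CkBounded {E : Type*} [NormedAddCommGroup E] [NormedSpace ℝ E] (k : ℕ) (f : E → ℝ) : Prop :=
  ContDiff ℝ k f ∧ ∀ m ≤ k, ∃ C : ℝ, ∀ x, ‖iteratedFDeriv ℝ m f x‖ ≤ C

/-- `∂Ω` is of class `C^{k,a}`: near each boundary point, in suitable orthonormal coordinates
(with `e` the last basis vector), `Ω` is the region above the graph of a `C^{k,a}` function. -/
def HasHolderBoundary {d : ℕ} (k : ℕ) (a : ℝ≥0) (Ω : Set (Euc d)) : Prop :=
  ∀ x₀ ∈ frontier Ω, ∃ (e : Euc d) (r : ℝ) (γ : (ℝ ∙ e)ᗮ → ℝ),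
    ‖e‖ = 1 ∧ 0 < r ∧ ContDiff ℝ k γ ∧ (∃ C : ℝ≥0, HolderWith C a (iteratedFDeriv ℝ k γ)) ∧
    ∀ x ∈ Metric.ball x₀ r,
      (x ∈ Ω ↔ γ ((ℝ ∙ e)ᗮ.orthogonalProjectionOnto x) < ⟪x, e⟫_ℝ)

/-- `n` is the outward unit normal of `Ω` at the boundary point `x`: a unit vector orthogonal to
the boundary at `x`, that points out of `Ω`. -/
structure IsOutwardUnitNormal {d : ℕ} (Ω : Set (Euc d)) (x n : Euc d) : Prop where
  norm_eq : ‖n‖ = 1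
  orthogonal : (fun y : Euc d => ⟪y - x, n⟫_ℝ) =o[𝓝[frontier Ω] x] (fun y : Euc d => y - x)
  outward : ∀ᶠ t in 𝓝[>] (0 : ℝ), x - t • n ∈ Ω ∧ x + t • n ∉ closure Ω

/-- The auxiliary function: `η ∈ C³_b(ℝ^d)`, `η > 0` in `Ω`, `η = 0` on `∂Ω`, with nonvanishing
normal derivative on `∂Ω`. -/
structure IsAuxiliary {d : ℕ} (Ω : Set (Euc d)) (η : Euc d → ℝ) : Prop where
  smooth : CkBounded 3 η
  pos : ∀ x ∈ Ω, 0 < η x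
  zero : ∀ x ∈ frontier Ω, η x = 0
  normal : ∀ x ∈ frontier Ω, ∀ n, IsOutwardUnitNormal Ω x n → fderiv ℝ η x n ≠ 0

/-- `μ` is a finite measure on `Ω`, equivalent to Lebesgue measure on `Ω`, whose density has a
bounded logarithm. -/
structure IsSamplingMeasure {d : ℕ} (Ω : Set (Euc d)) (μ : Measure (Euc d)) : Prop where
  finite : IsFiniteMeasure μ
  ac : μ ≪ volume.restrict Ω
  ac' : volume.restrict Ω ≪ μ
  log_bounded : ∃ C : ℝ, ∀ᵐ x ∂(volume.restrict Ω),
    |Real.log (μ.rnDeriv (volume.restrict Ω) x).toReal| ≤ C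

/-- Assumptions on the law `ν` of the initial parameters `(c, w, b)`. -/
structure IsInitialLaw {d : ℕ} (ν : Measure (Param d)) : Prop where
  prob : IsProbabilityMeasure ν
  c_bounded : ∃ K : ℝ, ∀ᵐ θ ∂ν, |θ.1| < K
  c_mean : ∫ θ, θ.1 ∂ν = 0
  full_support : ∀ D : Set (Euc d × ℝ), IsOpen D → D.Nonempty → 0 < ν {θ | θ.2 ∈ D}
  w_moment : ∀ k, Integrable (fun θ : Param d => |θ.2.1 k| ^ 4) ν
  b_moment : Integrable (fun θ : Param d => |θ.2.2|) ν

/-! ### Sobolev spaces -/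

open Classical in
/-- The class of `f` in `L²(μ)` (and `0` if `f` is not square integrable). -/
def toL2 {d : ℕ} (μ : Measure (Euc d)) (f : Euc d → ℝ) : L2 μ :=
  if h : MemLp f 2 μ then h.toLp f else 0

/-- The classical partial derivative `∂_{I₁} ⋯ ∂_{I_m} φ`. A partial derivative of order `m` is
indexed by the tuple of its directions. -/
def pderiv {d m : ℕ} (I : Fin m → Fin d) (φ : Euc d → ℝ) (x : Euc d) : ℝ :=
  iteratedFDeriv ℝ m φ x (fun k => EuclideanSpace.single (I k) (1 : ℝ))

section Sobolev

variable {d : ℕ} (Ω : TopologicalSpace.Opens (Euc d)) (μ : Measure (Euc d))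

/-- `g` is the weak derivative `D_I f` in `Ω`. -/
def HasWeakDeriv {m : ℕ} (I : Fin m → Fin d) (f g : Euc d → ℝ) : Prop :=
  ∀ φ : TestFunction Ω ℝ ⊤,
    ∫ x in (Ω : Set (Euc d)), f x * pderiv I φ x
      = (-1) ^ m * ∫ x in (Ω : Set (Euc d)), g x * φ x

/-- `f ∈ ℋ^p`: all weak derivatives of order at most `p` exist and lie in `L²`. -/
def MemSobolev (p : ℕ) (f : L2 μ) : Prop :=
  ∀ m ≤ p, ∀ I : Fin m → Fin d, ∃ g : L2 μ, HasWeakDeriv Ω I f g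

open Classical in
/-- The weak derivative `D_I f ∈ L²(μ)` (and `0` if there is none). -/
def weakDeriv {m : ℕ} (I : Fin m → Fin d) (f : L2 μ) : L2 μ :=
  if h : ∃ g : L2 μ, HasWeakDeriv Ω I f g then h.choose else 0

/-- The norm of `ℋ^p`: the sum of the `L²` norms of the weak derivatives of order at most `p`. -/
def sobolevNorm (p : ℕ) (f : L2 μ) : ℝ :=
  ∑ m ∈ Finset.range (p + 1), ∑ I : Fin m → Fin d, ‖weakDeriv Ω μ I f‖

/-- `f ∈ ℋ¹₀`: `f` is in the closure of `C_c^∞(Ω)` in `ℋ¹`. -/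
def MemH10 (f : L2 μ) : Prop :=
  MemSobolev Ω μ 1 f ∧
    ∀ ε > 0, ∃ φ : TestFunction Ω ℝ ⊤, sobolevNorm Ω μ 1 (f - toL2 μ φ) < ε

/-- `f ∈ ℋ²_(0) = ℋ² ∩ ℋ¹₀`. -/
def MemH20 (f : L2 μ) : Prop :=
  MemSobolev Ω μ 2 f ∧ MemH10 Ω μ f

/-- `A` is a linear operator `ℋ² → L²(μ)` that satisfies the pointwise Lipschitz condition
`|A f₁(x) - A f₂(x)| ≤ k ∑_{|α| ≤ 2} |D_α f₁(x) - D_α f₂(x)|`. -/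
structure IsPDEOperator (A : L2 μ →ₗ.[ℝ] L2 μ) : Prop where
  mem_domain : ∀ f : L2 μ, f ∈ A.domain ↔ MemSobolev Ω μ 2 f
  lipschitz : ∃ k : ℝ, 0 < k ∧ ∀ f₁ f₂ : A.domain, ∀ᵐ x ∂μ,
    |A f₁ x - A f₂ x| ≤ k * ∑ m ∈ Finset.range 3, ∑ I : Fin m → Fin d,
      |weakDeriv Ω μ I (f₁ : L2 μ) x - weakDeriv Ω μ I (f₂ : L2 μ) x|

end Sobolev

/-! ### The neural tangent kernel `U` and the operators `𝒰`, `𝒮 = A 𝒰` -/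

/-- The value at `x` of one hidden unit, `η(x) c σ(w ⬝ x + b)`. -/
def hiddenUnit {d : ℕ} (η : Euc d → ℝ) (σ : ℝ → ℝ) (θ : Param d) (x : Euc d) : ℝ :=
  η x * (θ.1 * σ (⟪θ.2.1, x⟫_ℝ + θ.2.2))

/-- The coordinate directions `c`, `w₁, …, w_d`, `b` of parameter space. -/
def paramDir {d : ℕ} : Unit ⊕ Fin d ⊕ Unit → Param d
  | .inl _ => (1, 0, 0)
  | .inr (.inl k) => (0, EuclideanSpace.single k (1 : ℝ), 0)
  | .inr (.inr _) => (0, 0, 1)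

section Operators

variable {d : ℕ} {μ : Measure (Euc d)} (A : L2 μ →ₗ.[ℝ] L2 μ) (η : Euc d → ℝ) (σ : ℝ → ℝ)
  (ν : Measure (Param d))

open Classical in
/-- `A f ∈ L²(μ)` (and `0` if `f` is not in the domain of `A`). -/
def applyOp (f : L2 μ) : L2 μ :=
  if h : f ∈ A.domain then A ⟨f, h⟩ else 0

/-- The function `x ↦ U(x, y)` in `L²(μ)`, where
`U(x, y) = 𝔼 [∇_{c,w,b} A[η c σ(w ⬝ · + b)](x) ⬝ ∇_{c,w,b} (η(y) c σ(w ⬝ y + b))]`.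
As `A f` is an element of `L²(μ)`, the gradient of `θ ↦ A[η c σ(w ⬝ · + b)]` and the expectation
are those of an `L²(μ)`-valued function. -/
def kernelU (y : Euc d) : L2 μ :=
  ∫ θ, ∑ j : Unit ⊕ Fin d ⊕ Unit,
    (fderiv ℝ (fun θ' => hiddenUnit η σ θ' y) θ (paramDir j)) •
      (fderiv ℝ (fun θ' => applyOp A (toL2 μ (hiddenUnit η σ θ'))) θ (paramDir j)) ∂ν

/-- `𝒰 f (y) = ∫_Ω f(x) U(x, y) dμ(x)`, as an element of `L²(μ)`. -/
def opU (f : L2 μ) : L2 μ :=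
  toL2 μ (fun y => ∫ x, f x * kernelU A η σ ν y x ∂μ)

/-- `𝒮 f = A (𝒰 f)`. -/
def opS (f : L2 μ) : L2 μ :=
  applyOp A (opU A η σ ν f)

/-- `Q` solves `dQ_t/dt = -𝒰[A Q_t - g]`, `Q_0 = 0`, for `t ≥ 0` in `ℋ²_(0)`, the derivative being
taken in the norm of `ℋ²`. -/
structure IsLimitSolution (Ω : TopologicalSpace.Opens (Euc d)) (g : L2 μ) (Q : ℝ → L2 μ) :
    Prop where
  mem : ∀ t, 0 ≤ t → MemH20 Ω μ (Q t)
  init : Q 0 = 0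
  ode : ∀ t, 0 ≤ t → Tendsto
    (fun s => sobolevNorm Ω μ 2
      ((s - t)⁻¹ • (Q s - Q t) + opU A η σ ν (applyOp A (Q t) - g)))
    (𝓝[Set.Ici 0 \ {t}] t) (𝓝 0)

end Operators

end DGM

end

/-! Positivity. Let `𝒮 h = 0` and let `a_j(θ)` be the pairing of `h` with `A` applied to the
derivative of the hidden unit in the `j`-th parameter direction. The kernel is built symmetrically,
so `𝒰 h` is the average over `θ` of `∑_j a_j(θ)` times that derivative, and `0 = ⟪h, 𝒮 h⟫ = 𝔼 ∑_j
a_j²`. Hence all `a_j` vanish almost surely. The direction `c` gives `⟪h, A[η σ(w ⬝ x + b)]⟫ = 0`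
for almost every `(w, b)`, and by continuity and full support for every `(w, b)`
(`inner_ridge_eq_zero_of_opS_eq_zero`).

Universality. The pointwise Lipschitz condition makes `A` bounded on `ℋ²`, so `l = ⟪h, A ·⟫` is a
continuous functional there, and it annihilates every `η σ(w ⬝ x + b)`. Convolving in `b` replaces
`σ` by a smooth, bounded, non-constant `τ`, none of whose derivatives vanishes identically.
Differentiating in the length of `w` at `0` gives the functions `η (w ⬝ x)ⁿ`. Weierstrass
approximation in `C²` then gives every `C²` profile, in particular sines and cosines, and Fourier
inversion gives `l(η f) = 0` for all `f ∈ C_c^∞(ℝ^d)` (`functional_mul_eq_zero`).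

Density. It remains to reach every `u ∈ ℋ² ∩ ℋ¹₀` from functions `η f`. Bounded sequences in `ℋ²`
that converge in `L²` converge weakly in `ℋ²` (`tendsto_functional_of_bounded`), so it suffices to
find `η f_n` bounded in `ℋ²` with limit `u` in `L²`. Put `q = u / η`. Hardy's inequality with
weights in powers of `η` (`IsDefining.exists_hardy`) shows that `q`, `∇q` and `η D²q` are in `L²`
(`IsSobZero.isWeightedSob`). It is applied to test functions, to the derivatives of `u` tangential
to the level sets of `η`, and to `η² ∂ᵢ(u / η)`. After a partition of unity, `q` is mollified with
kernels displaced so that they look into `Ω`, where `η` is not much smaller. The weight `η` may then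
be moved under the convolution, which bounds `η (q * φ_n)` in `ℋ²`
(`IsWeightedSob.exists_norm_jet_le`).

This proves (i). Part (ii) follows because both `A Q_t` and `g = A u` are images of elements of
`ℋ²_(0)`. -/

noncomputable section

namespace DGM

/-! ### Comparison of `μ` with Lebesgue measure on `Ω`. -/

/-- `μ` is a finite measure that is comparable with Lebesgue measure on `Ω`. -/
structure IsComparable {d : ℕ} (Ω : Set (Euc d)) (μ : Measure (Euc d)) : Prop where
  finite : IsFiniteMeasure μ
  volume_le : ∃ C : ℝ≥0, volume.restrict Ω ≤ C • μ
  le_volume : ∃ C : ℝ≥0, μ ≤ C • volume.restrict Ω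

/-- A bounded logarithm keeps the density between `exp (-C)` and `exp C`. Since `Real.log 0 = 0`,
that bound alone would allow the density to vanish or be infinite; mutual absolute continuity and
finiteness exclude this almost everywhere. -/
theorem IsSamplingMeasure.isComparable {d : ℕ} {Ω : Set (Euc d)} {μ : Measure (Euc d)}
    (h : IsSamplingMeasure Ω μ) : IsComparable Ω μ := by
  have := h.finite
  obtain ⟨C, hC⟩ := h.log_bounded
  set lam := volume.restrict Ω with hlam
  have hd : lam.withDensity (μ.rnDeriv lam) = μ := Measure.withDensity_rnDeriv_eq μ lam h.ac
  have hpos : ∀ᵐ x ∂lam, 0 < μ.rnDeriv lam x := h.ac'.ae_le (Measure.rnDeriv_pos h.ac)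
  have hlt := Measure.rnDeriv_lt_top μ lam
  have hb : ∀ᵐ x ∂lam, ENNReal.ofReal (Real.exp (-C)) ≤ μ.rnDeriv lam x ∧
      μ.rnDeriv lam x ≤ ENNReal.ofReal (Real.exp C) := by
    filter_upwards [hC, hpos, hlt] with x h1 h2 h3
    have h4 : 0 < (μ.rnDeriv lam x).toReal := ENNReal.toReal_pos h2.ne' h3.ne
    rw [abs_le, Real.le_log_iff_exp_le h4, Real.log_le_iff_le_exp h4] at h1
    exact ⟨ENNReal.ofReal_le_of_le_toReal h1.1,
      (ENNReal.le_ofReal_iff_toReal_le h3.ne (Real.exp_pos _).le).2 h1.2⟩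
  refine ⟨h.finite, ⟨(Real.exp C).toNNReal, ?_⟩, ⟨(Real.exp C).toNNReal, ?_⟩⟩
  · refine Measure.le_iff.2 fun s hs => ?_
    have h1 : ENNReal.ofReal (Real.exp (-C)) * lam s ≤ μ s := by
      conv_rhs => rw [← hd, withDensity_apply _ hs]
      rw [← setLIntegral_const]
      exact lintegral_mono_ae (ae_restrict_of_ae (hb.mono fun x hx => hx.1))
    have h2 : ENNReal.ofReal (Real.exp C) * ENNReal.ofReal (Real.exp (-C)) = 1 := by
      rw [← ENNReal.ofReal_mul (Real.exp_pos _).le, ← Real.exp_add]; simp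
    calc lam s = ENNReal.ofReal (Real.exp C) * (ENNReal.ofReal (Real.exp (-C)) * lam s) := by
          rw [← mul_assoc, h2, one_mul]
      _ ≤ ENNReal.ofReal (Real.exp C) * μ s := by gcongr
      _ = _ := by rfl
  · refine Measure.le_iff.2 fun s hs => ?_
    conv_lhs => rw [← hd, withDensity_apply _ hs]
    refine (lintegral_mono_ae (ae_restrict_of_ae (hb.mono fun x hx => hx.2))).trans ?_
    rw [setLIntegral_const]; rfl

section Comparable

variable {d : ℕ} {Ω : Set (Euc d)} {μ : Measure (Euc d)}

theorem IsComparable.ac (h : IsComparable Ω μ) : μ ≪ volume.restrict Ω := by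
  obtain ⟨C, hC⟩ := h.le_volume
  exact (Measure.absolutelyContinuous_of_le hC).trans Measure.smul_absolutelyContinuous

theorem IsComparable.ac' (h : IsComparable Ω μ) : volume.restrict Ω ≪ μ := by
  obtain ⟨C, hC⟩ := h.volume_le
  exact (Measure.absolutelyContinuous_of_le hC).trans Measure.smul_absolutelyContinuous

theorem IsComparable.ae_mem (h : IsComparable Ω μ) (hΩ : MeasurableSet Ω) : ∀ᵐ x ∂μ, x ∈ Ω :=
  h.ac.ae_le (ae_restrict_mem hΩ)

theorem IsComparable.memLp_volume (h : IsComparable Ω μ) {p : ℝ≥0∞} {f : Euc d → ℝ}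
    (hf : MemLp f p μ) : MemLp f p (volume.restrict Ω) := by
  obtain ⟨C, hC⟩ := h.volume_le
  exact hf.of_measure_le_smul (c := C) ENNReal.coe_ne_top hC

theorem IsComparable.memLp_of_volume (h : IsComparable Ω μ) {p : ℝ≥0∞} {f : Euc d → ℝ}
    (hf : MemLp f p (volume.restrict Ω)) : MemLp f p μ := by
  obtain ⟨C, hC⟩ := h.le_volume
  exact hf.of_measure_le_smul (c := C) ENNReal.coe_ne_top hC

theorem IsComparable.exists_eLpNorm_le (h : IsComparable Ω μ) :
    ∃ C : ℝ≥0, ∀ f : Euc d → ℝ, eLpNorm f 2 (volume.restrict Ω) ≤ C * eLpNorm f 2 μ ∧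
      eLpNorm f 2 μ ≤ C * eLpNorm f 2 (volume.restrict Ω) := by
  obtain ⟨C, hC⟩ := h.volume_le
  obtain ⟨C', hC'⟩ := h.le_volume
  have key : ∀ (K : ℝ≥0) (m₁ m₂ : Measure (Euc d)), m₁ ≤ K • m₂ → ∀ f : Euc d → ℝ,
      eLpNorm f 2 m₁ ≤ ((K : ℝ≥0) ^ (1 / 2 : ℝ) : ℝ≥0) * eLpNorm f 2 m₂ := by
    intro K m₁ m₂ hK f
    refine (eLpNorm_mono_measure f hK).trans ?_
    rw [show (K • m₂) = (K : ℝ≥0∞) • m₂ from rfl,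
      eLpNorm_smul_measure_of_ne_top (by norm_num)]
    simp only [smul_eq_mul]
    rw [ENNReal.coe_rpow_of_nonneg _ (by norm_num)]
    norm_num
  refine ⟨max (C ^ (1 / 2 : ℝ)) (C' ^ (1 / 2 : ℝ)), fun f => ⟨(key _ _ _ hC f).trans ?_,
    (key _ _ _ hC' f).trans ?_⟩⟩
  · gcongr; exact le_max_left _ _
  · gcongr; exact le_max_right _ _

theorem IsComparable.volume_lt_top (h : IsComparable Ω μ) : volume Ω < ∞ := by
  have := h.finite
  obtain ⟨C, hC⟩ := h.volume_le
  have := hC Set.univ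
  rw [Measure.restrict_apply_univ] at this
  exact this.trans_lt (ENNReal.mul_lt_top ENNReal.coe_lt_top (measure_lt_top μ _))

/-- Integration on `Ω` against a function of `L²(Ω)`, as a functional on `L²(μ)`. -/
def volumePairing (h : IsComparable Ω μ) (ψ : Euc d → ℝ) (hψ : MemLp ψ 2 (volume.restrict Ω)) :
    L2 μ →L[ℝ] ℝ :=
  LinearMap.mkContinuousOfExistsBound
    { toFun := fun f => ∫ x in Ω, f x * ψ x
      map_add' := fun f g => by
        rw [← integral_add]
        · refine integral_congr_ae ?_
          filter_upwards [h.ac'.ae_le (Lp.coeFn_add f g)] with x hx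
          rw [hx, Pi.add_apply]; ring
        · exact (h.memLp_volume (Lp.memLp f)).integrable_mul hψ
        · exact (h.memLp_volume (Lp.memLp g)).integrable_mul hψ
      map_smul' := fun c f => by
        rw [RingHom.id_apply, smul_eq_mul, ← integral_const_mul]
        refine integral_congr_ae ?_
        filter_upwards [h.ac'.ae_le (Lp.coeFn_smul c f)] with x hx
        rw [hx, Pi.smul_apply, smul_eq_mul]; ring }
    (by
      obtain ⟨C, hC⟩ := h.exists_eLpNorm_le
      refine ⟨C * (eLpNorm ψ 2 (volume.restrict Ω)).toReal, fun f => ?_⟩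
      have hf := h.memLp_volume (Lp.memLp f)
      have h1 : ∫ x in Ω, f x * ψ x = ⟪hψ.toLp ψ, hf.toLp f⟫_ℝ := by
        rw [L2.inner_def]
        refine integral_congr_ae ?_
        filter_upwards [hψ.coeFn_toLp, hf.coeFn_toLp] with x h1 h2
        rw [h1, h2]; rfl
      change ‖∫ x in Ω, f x * ψ x‖ ≤ _
      rw [h1]
      refine (norm_inner_le_norm _ _).trans ?_
      rw [Lp.norm_toLp, Lp.norm_toLp, mul_comm, mul_right_comm]
      gcongr
      rw [Lp.norm_def, ← ENNReal.coe_toReal, ← ENNReal.toReal_mul]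
      exact ENNReal.toReal_mono (ENNReal.mul_ne_top ENNReal.coe_ne_top (Lp.eLpNorm_ne_top f))
        (hC f).1)

theorem volumePairing_apply (h : IsComparable Ω μ) (ψ : Euc d → ℝ)
    (hψ : MemLp ψ 2 (volume.restrict Ω)) (f : L2 μ) :
    volumePairing h ψ hψ f = ∫ x in Ω, f x * ψ x := rfl

theorem toL2_of_memLp {f : Euc d → ℝ} (hf : MemLp f 2 μ) : toL2 μ f = hf.toLp f := dif_pos hf

theorem coeFn_toL2 {f : Euc d → ℝ} (hf : MemLp f 2 μ) : toL2 μ f =ᵐ[μ] f := by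
  rw [toL2_of_memLp hf]; exact hf.coeFn_toLp

theorem toL2_congr {f g : Euc d → ℝ} (h : f =ᵐ[μ] g) : toL2 μ f = toL2 μ g := by
  by_cases hf : MemLp f 2 μ
  · rw [toL2_of_memLp hf, toL2_of_memLp (hf.ae_eq h)]
    exact (MemLp.toLp_eq_toLp_iff _ _).2 h
  · rw [toL2, toL2, dif_neg hf, dif_neg fun hg => hf (hg.ae_eq h.symm)]

theorem toL2_coeFn (f : L2 μ) : toL2 μ f = f := by
  rw [toL2_of_memLp (Lp.memLp f), Lp.toLp_coeFn]

end Comparable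

/-! ### Weak derivatives and their uniqueness. -/

section WeakDerivBasic

variable {d : ℕ} {Ω : TopologicalSpace.Opens (Euc d)} {μ : Measure (Euc d)}

theorem continuous_pderiv {m : ℕ} (I : Fin m → Fin d) {φ : Euc d → ℝ} (hφ : ContDiff ℝ m φ) :
    Continuous (pderiv I φ) := by
  have := hφ.continuous_iteratedFDeriv (m := m) le_rfl
  exact (ContinuousMultilinearMap.apply ℝ (fun _ : Fin m => Euc d) ℝ _).continuous.comp this

theorem hasCompactSupport_pderiv {m : ℕ} (I : Fin m → Fin d) {φ : Euc d → ℝ}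
    (hφ : HasCompactSupport φ) : HasCompactSupport (pderiv I φ) := by
  have := hφ.iteratedFDeriv (𝕜 := ℝ) m
  exact this.comp_left (g := fun T : ContinuousMultilinearMap ℝ (fun _ : Fin m => Euc d) ℝ =>
    T fun k => EuclideanSpace.single (I k) (1 : ℝ)) rfl

theorem memLp_testFunction (φ : TestFunction Ω ℝ ⊤) (s : Set (Euc d)) :
    MemLp φ 2 (volume.restrict s) :=
  (φ.continuous.memLp_of_hasCompactSupport φ.hasCompactSupport).restrict s

theorem memLp_pderiv_testFunction {m : ℕ} (I : Fin m → Fin d) (φ : TestFunction Ω ℝ ⊤)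
    (s : Set (Euc d)) : MemLp (pderiv I φ) 2 (volume.restrict s) :=
  ((continuous_pderiv I (φ.contDiff.of_le (by exact_mod_cast le_top))).memLp_of_hasCompactSupport
    (hasCompactSupport_pderiv I φ.hasCompactSupport)).restrict s

theorem HasWeakDeriv.congr (h : IsComparable (Ω : Set (Euc d)) μ) {m : ℕ} {I : Fin m → Fin d}
    {f f' g g' : Euc d → ℝ}
    (hf : f =ᵐ[μ] f') (hg : g =ᵐ[μ] g') (H : HasWeakDeriv Ω I f g) : HasWeakDeriv Ω I f' g' := by
  intro φ
  have h1 : ∫ x in (Ω : Set (Euc d)), f' x * pderiv I φ x =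
      ∫ x in (Ω : Set (Euc d)), f x * pderiv I φ x := by
    refine integral_congr_ae ?_
    filter_upwards [h.ac'.ae_le hf] with x hx
    rw [hx]
  have h2 : ∫ x in (Ω : Set (Euc d)), g' x * φ x = ∫ x in (Ω : Set (Euc d)), g x * φ x := by
    refine integral_congr_ae ?_
    filter_upwards [h.ac'.ae_le hg] with x hx
    rw [hx]
  rw [h1, h2, H φ]

/-- Fundamental lemma of the calculus of variations. Finite volume of `Ω` makes the difference of
two `L²` functions integrable. -/
theorem ae_eq_of_integral_testFunction (h : IsComparable (Ω : Set (Euc d)) μ) {f g : L2 μ}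
    (H : ∀ φ : TestFunction Ω ℝ ⊤, ∫ x in (Ω : Set (Euc d)), f x * φ x =
      ∫ x in (Ω : Set (Euc d)), g x * φ x) : f = g := by
  have : Fact ((1 : ℝ≥0∞) ≤ 2) := ⟨by norm_num⟩
  have hvol := h.volume_lt_top
  have : IsFiniteMeasure (volume.restrict (Ω : Set (Euc d))) := ⟨by simpa using hvol⟩
  have hf := h.memLp_volume (Lp.memLp f)
  have hg := h.memLp_volume (Lp.memLp g)
  have hfg : IntegrableOn (fun x => f x - g x) (Ω : Set (Euc d)) :=
    (hf.sub hg).integrable (by norm_num)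
  have key := IsOpen.ae_eq_zero_of_integral_contDiff_smul_eq_zero (μ := volume) Ω.isOpen
    hfg.locallyIntegrableOn (fun φ hφ hφc hφs => by
      let ψ : TestFunction Ω ℝ ⊤ := ⟨φ, hφ, hφc, hφs⟩
      have := H ψ
      have e1 : ∫ x, φ x • (f x - g x) = ∫ x in (Ω : Set (Euc d)), φ x • (f x - g x) := by
        refine (setIntegral_eq_integral_of_forall_compl_eq_zero fun x hx => ?_).symm
        rw [image_eq_zero_of_notMem_tsupport fun hx' => hx (hφs hx'), zero_smul]
      rw [e1]
      have e2 : ∀ x, φ x • (f x - g x) = f x * ψ x - g x * ψ x := fun x => by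
        change φ x * (f x - g x) = f x * φ x - g x * φ x; ring
      simp_rw [e2]
      rw [integral_sub, this, sub_self]
      · exact hf.integrable_mul (memLp_testFunction ψ _)
      · exact hg.integrable_mul (memLp_testFunction ψ _))
  have hae : ∀ᵐ x ∂(volume.restrict (Ω : Set (Euc d))), f x = g x := by
    rw [ae_restrict_iff' Ω.isOpen.measurableSet]
    filter_upwards [key] with x hx hxΩ
    exact sub_eq_zero.1 (hx hxΩ)
  exact Lp.ext (h.ac.ae_le hae)

theorem HasWeakDeriv.unique (h : IsComparable (Ω : Set (Euc d)) μ) {m : ℕ} {I : Fin m → Fin d}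
    {f : Euc d → ℝ} {g g' : L2 μ}
    (H : HasWeakDeriv Ω I f g) (H' : HasWeakDeriv Ω I f g') : g = g' := by
  refine ae_eq_of_integral_testFunction h fun φ => ?_
  have := (H φ).symm.trans (H' φ)
  exact mul_left_cancel₀ (pow_ne_zero _ (by norm_num)) this

theorem hasWeakDeriv_weakDeriv {m : ℕ} {I : Fin m → Fin d} {f : L2 μ}
    (H : ∃ g : L2 μ, HasWeakDeriv Ω I f g) : HasWeakDeriv Ω I f (weakDeriv Ω μ I f) := by
  rw [weakDeriv, dif_pos H]; exact H.choose_spec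

theorem weakDeriv_eq (h : IsComparable (Ω : Set (Euc d)) μ) {m : ℕ} {I : Fin m → Fin d}
    {f g : L2 μ} (H : HasWeakDeriv Ω I f g) : weakDeriv Ω μ I f = g :=
  (hasWeakDeriv_weakDeriv ⟨g, H⟩).unique h H

theorem pderiv_zero_order (I : Fin 0 → Fin d) (φ : Euc d → ℝ) : pderiv I φ = φ := by
  funext x; simp [pderiv]

theorem hasWeakDeriv_zero_order (I : Fin 0 → Fin d) (f : Euc d → ℝ) : HasWeakDeriv Ω I f f := by
  intro φ; simp [pderiv_zero_order]

end WeakDerivBasic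

/-! ### The space `ℋ²` as a closed subspace of a Hilbert space. -/

/-- Multi-indices of order at most two, as tuples of directions. -/
abbrev MIdx (d : ℕ) : Type := Σ m : Fin 3, (Fin m → Fin d)

/-- The multi-index of order zero. -/
def MIdx.zero (d : ℕ) : MIdx d := ⟨0, Fin.elim0⟩

/-- The Hilbert space in which `ℋ²` is the set of families `(D_I f)_I`. -/
abbrev SobE {d : ℕ} (μ : Measure (Euc d)) : Type := PiLp 2 (fun _ : MIdx d => L2 μ)

section SobH

variable {d : ℕ} (Ω : TopologicalSpace.Opens (Euc d)) (μ : Measure (Euc d))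

theorem HasWeakDeriv.add (h : IsComparable (Ω : Set (Euc d)) μ) {m : ℕ} {I : Fin m → Fin d}
    {f g f' g' : L2 μ} (H : HasWeakDeriv Ω I f g) (H' : HasWeakDeriv Ω I f' g') :
    HasWeakDeriv Ω I (f + f' : L2 μ) (g + g' : L2 μ) := by
  intro φ
  have h1 := map_add (volumePairing h _ (memLp_pderiv_testFunction I φ Ω)) f f'
  have h2 := map_add (volumePairing h _ (memLp_testFunction φ Ω)) g g'
  simp only [volumePairing_apply] at h1 h2
  rw [h1, h2, H φ, H' φ]; ring

theorem HasWeakDeriv.smul (h : IsComparable (Ω : Set (Euc d)) μ) {m : ℕ} {I : Fin m → Fin d}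
    (c : ℝ) {f g : L2 μ} (H : HasWeakDeriv Ω I f g) :
    HasWeakDeriv Ω I (c • f : L2 μ) (c • g : L2 μ) := by
  intro φ
  have h1 := map_smul (volumePairing h _ (memLp_pderiv_testFunction I φ Ω)) c f
  have h2 := map_smul (volumePairing h _ (memLp_testFunction φ Ω)) c g
  simp only [volumePairing_apply, smul_eq_mul] at h1 h2
  rw [h1, h2, H φ]; ring

theorem HasWeakDeriv.zero (h : IsComparable (Ω : Set (Euc d)) μ) {m : ℕ} (I : Fin m → Fin d) :
    HasWeakDeriv Ω I (0 : L2 μ) (0 : L2 μ) := by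
  intro φ
  have h1 := map_zero (volumePairing h _ (memLp_pderiv_testFunction I φ Ω))
  have h2 := map_zero (volumePairing h _ (memLp_testFunction φ Ω))
  simp only [volumePairing_apply] at h1 h2
  rw [h1, h2, mul_zero]

/-- The space `ℋ²`, as the subspace of the families `(D_I f)_I` in `SobE μ`. -/
def sobH (h : IsComparable (Ω : Set (Euc d)) μ) : Submodule ℝ (SobE μ) where
  carrier := {F | ∀ I : MIdx d, HasWeakDeriv Ω I.2 (F (MIdx.zero d)) (F I)}
  add_mem' := fun hF hG I => (hF I).add Ω μ h (hG I)
  zero_mem' := fun I => HasWeakDeriv.zero Ω μ h I.2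
  smul_mem' := fun c _ hF I => (hF I).smul Ω μ h c

variable {Ω μ}

/-- The coordinate projections of `SobE μ`. -/
def SobE.proj (I : MIdx d) : SobE μ →L[ℝ] L2 μ := PiLp.proj 2 (fun _ : MIdx d => L2 μ) I

@[simp] theorem SobE.proj_apply (I : MIdx d) (F : SobE μ) : SobE.proj I F = F I := rfl

/-- For a fixed multi-index and a fixed test function, the defining identity is an equation between
continuous functionals. Closedness makes the orthogonal projection onto `ℋ²` available. -/
theorem isClosed_sobH (h : IsComparable (Ω : Set (Euc d)) μ) :
    IsClosed (sobH Ω μ h : Set (SobE μ)) := by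
  have : (sobH Ω μ h : Set (SobE μ)) = ⋂ I : MIdx d, ⋂ φ : TestFunction Ω ℝ ⊤,
      {F | volumePairing h _ (memLp_pderiv_testFunction I.2 φ Ω) (SobE.proj (MIdx.zero d) F) =
        (-1) ^ (I.1 : ℕ) * volumePairing h _ (memLp_testFunction φ Ω) (SobE.proj I F)} := by
    ext F
    simp only [Set.mem_iInter, Set.mem_ofPred_eq]
    rfl
  rw [this]
  refine isClosed_iInter fun I => isClosed_iInter fun φ => isClosed_eq ?_ ?_
  · fun_prop
  · fun_prop

/-- By uniqueness of weak derivatives the entry of order zero determines all others. Identities in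
`ℋ²` are reduced to identities in `L²` in this way. -/
theorem sobH_ext (h : IsComparable (Ω : Set (Euc d)) μ) {F G : SobE μ} (hF : F ∈ sobH Ω μ h)
    (hG : G ∈ sobH Ω μ h) (h0 : F (MIdx.zero d) = G (MIdx.zero d)) : F = G := by
  ext1 I
  have h1 := hF I
  rw [h0] at h1
  exact h1.unique h (hG I)

theorem memSobolev_of_mem_sobH (h : IsComparable (Ω : Set (Euc d)) μ) {F : SobE μ}
    (hF : F ∈ sobH Ω μ h) : MemSobolev Ω μ 2 (F (MIdx.zero d)) :=
  fun m hm I => ⟨F ⟨⟨m, Nat.lt_succ_of_le hm⟩, I⟩, hF ⟨⟨m, Nat.lt_succ_of_le hm⟩, I⟩⟩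

theorem exists_mem_sobH (h : IsComparable (Ω : Set (Euc d)) μ) {f : L2 μ}
    (hf : MemSobolev Ω μ 2 f) : ∃ F ∈ sobH Ω μ h, F (MIdx.zero d) = f := by
  let F : SobE μ := WithLp.toLp 2 fun I : MIdx d => weakDeriv Ω μ I.2 f
  have h0 : F (MIdx.zero d) = f := weakDeriv_eq h (hasWeakDeriv_zero_order _ _)
  refine ⟨F, fun I => ?_, h0⟩
  rw [h0]
  exact hasWeakDeriv_weakDeriv (hf I.1 (Nat.le_of_lt_succ I.1.2) I.2)

theorem norm_toLp_le_sum (F : SobE μ) : ‖F‖ ≤ ∑ I, ‖F I‖ := by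
  classical
  rw [PiLp.norm_eq_of_L2]
  refine Real.sqrt_le_iff.2 ⟨by positivity, ?_⟩
  exact Finset.sum_sq_le_sq_sum_of_nonneg fun i _ => norm_nonneg _

/-- The Lipschitz condition against `f₂ = 0` reads `|A f(x)| ≤ k ∑ |D_I f(x)|`; then `L²` norms are
taken. The number of multi-indices enters because each entry is bounded by `‖F‖`. -/
theorem IsPDEOperator.exists_norm_le (h : IsComparable (Ω : Set (Euc d)) μ)
    {A : L2 μ →ₗ.[ℝ] L2 μ} (hA : IsPDEOperator Ω μ A) :
    ∃ k : ℝ, 0 ≤ k ∧ ∀ F ∈ sobH Ω μ h, ‖applyOp A (F (MIdx.zero d))‖ ≤ k * ‖F‖ := by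
  obtain ⟨k, hk, hlip⟩ := hA.lipschitz
  refine ⟨k * Fintype.card (MIdx d), by positivity, fun F hF => ?_⟩
  have hdom := (hA.mem_domain _).2 (memSobolev_of_mem_sobH h hF)
  rw [applyOp, dif_pos hdom]
  have hwd : ∀ I : MIdx d, weakDeriv Ω μ I.2 (F (MIdx.zero d)) = F I :=
    fun I => weakDeriv_eq h (hF I)
  have hw0 : ∀ I : MIdx d, weakDeriv Ω μ I.2 (0 : L2 μ) = 0 :=
    fun I => weakDeriv_eq h (HasWeakDeriv.zero Ω μ h I.2)
  have hae : ∀ᵐ x ∂μ, ‖A ⟨_, hdom⟩ x‖ ≤ ‖k * ∑ I : MIdx d, |F I x|‖ := by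
    filter_upwards [hlip ⟨_, hdom⟩ 0, Lp.coeFn_zero ℝ 2 μ] with x hx h0
    rw [A.map_zero, h0, Finset.sum_range] at hx
    rw [Real.norm_eq_abs, Real.norm_eq_abs, abs_of_nonneg (a := k * _) (by positivity)]
    simp only [Pi.zero_apply, sub_zero] at hx
    rw [← Finset.univ_sigma_univ, Finset.sum_sigma]
    refine hx.trans_eq (congrArg _ (Finset.sum_congr rfl fun m _ => Finset.sum_congr rfl
      fun I _ => ?_))
    have e1 := hwd ⟨m, I⟩
    have e2 := hw0 ⟨m, I⟩
    dsimp only at e1 e2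
    rw [e1]
    rw [Submodule.coe_zero, e2, h0]
    simp
  have hm : ∀ I : MIdx d, MemLp (fun x => |F I x|) 2 μ := fun I => (Lp.memLp (F I)).abs
  have hbound : eLpNorm (fun x => k * ∑ I : MIdx d, |F I x|) 2 μ ≤
      ENNReal.ofReal k * ∑ I : MIdx d, eLpNorm (F I) 2 μ := by
    have e : (fun x => k * ∑ I : MIdx d, |F I x|) = k • ∑ I : MIdx d, fun x => |F I x| := by
      funext x; simp
    rw [e, eLpNorm_const_smul, Real.enorm_eq_ofReal hk.le]
    gcongr
    refine (eLpNorm_sum_le (fun I _ => (hm I).1) (by norm_num)).trans_eq ?_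
    refine Finset.sum_congr rfl fun I _ => ?_
    exact eLpNorm_norm (F I)
  have hsum : ‖A ⟨_, hdom⟩‖ ≤ k * ∑ I : MIdx d, ‖F I‖ := by
    rw [Lp.norm_def]
    refine (ENNReal.toReal_mono ?_ ((eLpNorm_mono_ae hae).trans hbound)).trans_eq ?_
    · exact ENNReal.mul_ne_top ENNReal.ofReal_ne_top
        (ENNReal.sum_ne_top.2 fun I _ => Lp.eLpNorm_ne_top _)
    · rw [ENNReal.toReal_mul, ENNReal.toReal_ofReal hk.le,
        ENNReal.toReal_sum fun I _ => Lp.eLpNorm_ne_top _]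
      rfl
  refine hsum.trans ?_
  rw [mul_assoc]
  gcongr
  refine (Finset.sum_le_sum fun I _ => PiLp.norm_apply_le F I).trans_eq ?_
  simp

/-- A linear operator on `ℋ²` extends to a bounded operator on `SobE μ`. -/
theorem IsPDEOperator.exists_continuousLinearMap (h : IsComparable (Ω : Set (Euc d)) μ)
    {A : L2 μ →ₗ.[ℝ] L2 μ} (hA : IsPDEOperator Ω μ A) :
    ∃ T : SobE μ →L[ℝ] L2 μ, ∀ F ∈ sobH Ω μ h, T F = applyOp A (F (MIdx.zero d)) := by
  obtain ⟨k, hk, hb⟩ := hA.exists_norm_le h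
  have happ : ∀ (F : SobE μ) (hF : F ∈ sobH Ω μ h), applyOp A (F (MIdx.zero d)) =
      A ⟨_, (hA.mem_domain _).2 (memSobolev_of_mem_sobH h hF)⟩ := fun F hF => dif_pos _
  let T₀ : sobH Ω μ h →ₗ[ℝ] L2 μ :=
    { toFun := fun F => applyOp A ((F : SobE μ) (MIdx.zero d))
      map_add' := fun F G => by
        rw [happ _ F.2, happ _ G.2, happ _ (F + G).2, ← A.map_add]
        rfl
      map_smul' := fun c F => by
        rw [happ _ F.2, happ _ (c • F).2, RingHom.id_apply, ← A.map_smul]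
        rfl }
  let T₁ : sobH Ω μ h →L[ℝ] L2 μ := T₀.mkContinuous k fun F => hb F F.2
  have : CompleteSpace (sobH Ω μ h) := (isClosed_sobH h).completeSpace_coe
  -- Precomposition with the orthogonal projection extends the operator from the closed subspace.
  refine ⟨T₁ ∘L (sobH Ω μ h).orthogonalProjectionOnto, fun F hF => ?_⟩
  have := Submodule.orthogonalProjectionOnto_mem_subspace_eq_self (K := sobH Ω μ h) ⟨F, hF⟩
  exact (congrArg T₁ this).trans rfl

/-- Bounded sequences in `ℋ²` that converge in `L²` converge weakly in `ℋ²`. -/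
theorem tendsto_functional_of_bounded (h : IsComparable (Ω : Set (Euc d)) μ)
    (l : SobE μ →L[ℝ] ℝ) {V : ℕ → SobE μ} (hV : ∀ n, V n ∈ sobH Ω μ h) {C : ℝ}
    (hC : ∀ n, ‖V n‖ ≤ C) {W : SobE μ} (hW : W ∈ sobH Ω μ h)
    (hlim : Tendsto (fun n => V n (MIdx.zero d)) atTop (𝓝 (W (MIdx.zero d)))) :
    Tendsto (fun n => l (V n)) atTop (𝓝 (l W)) := by
  have : CompleteSpace (sobH Ω μ h) := (isClosed_sobH h).completeSpace_coe
  let P : sobH Ω μ h →L[ℝ] L2 μ := (SobE.proj (MIdx.zero d)).comp (sobH Ω μ h).subtypeL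
  let Q := ContinuousLinearMap.adjoint P
  -- The order-zero map `P` is injective on `ℋ²`, so its adjoint has dense range. A functional in
  -- that range only sees the `L²` part, where convergence is given; boundedness of the sequence
  -- passes to the closure.
  have hker : (LinearMap.range Q.toLinearMap).topologicalClosure = ⊤ := by
    rw [Submodule.topologicalClosure_eq_top_iff, Submodule.eq_bot_iff]
    intro F hF
    have h0 : P F = 0 := by
      rw [← inner_self_eq_zero (𝕜 := ℝ), ← ContinuousLinearMap.adjoint_inner_left]
      exact (Submodule.mem_orthogonal _ _).1 hF _ ⟨P F, rfl⟩
    exact Subtype.ext (sobH_ext h F.2 (sobH Ω μ h).zero_mem h0)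
  let X : ℕ → sobH Ω μ h := fun n => ⟨V n - W, (sobH Ω μ h).sub_mem (hV n) hW⟩
  have hX : ∀ n, ‖X n‖ ≤ C + ‖W‖ := fun n =>
    (norm_sub_le (V n) W).trans (by gcongr; exact hC n)
  let l' : sobH Ω μ h →L[ℝ] ℝ := l.comp (sobH Ω μ h).subtypeL
  let z := (InnerProductSpace.toDual ℝ (sobH Ω μ h)).symm l'
  have hz : ∀ F, l' F = ⟪z, F⟫_ℝ := fun F => by
    rw [InnerProductSpace.toDual_symm_apply]
  have hlX : Tendsto (fun n => l' (X n)) atTop (𝓝 0) := by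
    rw [Metric.tendsto_atTop]
    intro ε hε
    have hz' : z ∈ closure (LinearMap.range Q.toLinearMap : Set (sobH Ω μ h)) := by
      have : z ∈ (LinearMap.range Q.toLinearMap).topologicalClosure := by
        rw [hker]; trivial
      exact this
    have hK : 0 < C + ‖W‖ + 1 := by
      have := (norm_nonneg _).trans (hX 0); linarith
    obtain ⟨y, ⟨g, rfl⟩, hy⟩ := Metric.mem_closure_iff.1 hz' (ε / 2 / (C + ‖W‖ + 1)) (by positivity)
    have hg : Tendsto (fun n => ⟪g, P (X n)⟫_ℝ) atTop (𝓝 0) := by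
      have h1 : Tendsto (fun n => P (X n)) atTop (𝓝 0) := by
        have := hlim.sub_const (W (MIdx.zero d))
        rw [sub_self] at this
        exact this
      have := (tendsto_const_nhds (x := g)).inner (𝕜 := ℝ) h1
      rwa [inner_zero_right] at this
    obtain ⟨N, hN⟩ := Metric.tendsto_atTop.1 hg (ε / 2) (by positivity)
    refine ⟨N, fun n hn => ?_⟩
    have h2 := hN n hn
    rw [dist_zero_right] at h2 ⊢
    rw [hz]
    have e : ⟪z, X n⟫_ℝ = ⟪z - Q g, X n⟫_ℝ + ⟪g, P (X n)⟫_ℝ := by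
      rw [inner_sub_left, ContinuousLinearMap.adjoint_inner_left]; ring
    rw [e]
    refine (norm_add_le _ _).trans_lt ?_
    have h3 : ‖⟪z - Q g, X n⟫_ℝ‖ ≤ ε / 2 := by
      refine (norm_inner_le_norm _ _).trans ?_
      rw [dist_eq_norm] at hy
      calc ‖z - Q g‖ * ‖X n‖ ≤ (ε / 2 / (C + ‖W‖ + 1)) * (C + ‖W‖ + 1) := by
            gcongr
            · exact hy.le
            · exact (hX n).trans (by linarith)
        _ = ε / 2 := by field_simp
    linarith
  have e : ∀ n, l (V n) = l' (X n) + l W := fun n => by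
    change l (V n) = l (V n - W) + l W
    rw [map_sub]; ring
  simp_rw [e]
  simpa using hlX.add_const (l W)

end SobH

/-! ### Bochner integrals of `L²`-valued functions and pointwise integrals. -/

section BochnerL2

variable {d : ℕ} {μ : Measure (Euc d)}

/-- A Bochner integral of `L²` functions is given by the pointwise integrals. -/
theorem coeFn_integral_toL2 [SigmaFinite μ] {X : Type*} [MeasurableSpace X] {m : Measure X}
    [SFinite m] {f : X → Euc d → ℝ}
    (hf : AEStronglyMeasurable (Function.uncurry f) (m.prod μ)) (hmem : ∀ t, MemLp (f t) 2 μ)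
    (hint : Integrable (fun t => toL2 μ (f t)) m) :
    ((∫ t, toL2 μ (f t) ∂m : L2 μ) : Euc d → ℝ) =ᵐ[μ] fun y => ∫ t, f t y ∂m := by
  -- The integral of `|f t|` over `s` is a pairing with the indicator of `s`, hence at most a
  -- constant times the `L²` norm of `f t`, which is integrable in `t`.
  have hprod : ∀ s, MeasurableSet s → μ s < ∞ →
      Integrable (Function.uncurry f) (m.prod (μ.restrict s)) := by
    intro s hs hμs
    have hfs : AEStronglyMeasurable (Function.uncurry f) (m.prod (μ.restrict s)) := by
      refine hf.mono_ac ?_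
      exact Measure.AbsolutelyContinuous.prod Measure.AbsolutelyContinuous.rfl
        Measure.absolutelyContinuous_restrict
    rw [integrable_prod_iff hfs]
    have : IsFiniteMeasure (μ.restrict s) := ⟨by simpa using hμs⟩
    refine ⟨ae_of_all _ fun t => ((hmem t).restrict s).integrable (by norm_num), ?_⟩
    refine (hint.norm.const_mul ‖indicatorConstLp 2 hs hμs.ne (1 : ℝ)‖).mono'
      hfs.norm.integral_prod_right' (ae_of_all _ fun t => ?_)
    have e : ∫ y in s, ‖f t y‖ ∂μ =
        ⟪indicatorConstLp 2 hs hμs.ne (1 : ℝ), |toL2 μ (f t)|⟫_ℝ := by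
      rw [L2.inner_indicatorConstLp_one]
      refine integral_congr_ae (ae_restrict_of_ae ?_)
      filter_upwards [Lp.coeFn_abs (toL2 μ (f t)), coeFn_toL2 (hmem t)] with x h1 h2
      rw [h1, h2]; rfl
    change ‖∫ y in s, ‖f t y‖ ∂μ‖ ≤ _
    rw [e]
    refine (norm_inner_le_norm _ _).trans_eq ?_
    rw [norm_abs_eq_norm]
  -- Both sides are integrated over sets of finite measure: the pairing with an indicator commutes
  -- with the Bochner integral, and Fubini exchanges the order.
  refine ae_eq_of_forall_setIntegral_eq_of_sigmaFinite (fun s _ hμs => ?_)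
    (fun s hs hμs => (hprod s hs hμs).integral_prod_right) fun s hs hμs => ?_
  · have : IsFiniteMeasure (μ.restrict s) := ⟨by simpa using hμs⟩
    exact ((Lp.memLp _).restrict s).integrable (by norm_num)
  · rw [← L2.inner_indicatorConstLp_one (𝕜 := ℝ) hs hμs.ne]
    have h1 : ⟪indicatorConstLp 2 hs hμs.ne (1 : ℝ), ∫ t, toL2 μ (f t) ∂m⟫_ℝ =
        ∫ t, ⟪indicatorConstLp 2 hs hμs.ne (1 : ℝ), toL2 μ (f t)⟫_ℝ ∂m :=
      (integral_inner hint _).symm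
    rw [h1, ← integral_integral_swap (hprod s hs hμs)]
    refine integral_congr_ae (ae_of_all _ fun t => ?_)
    dsimp only
    rw [L2.inner_indicatorConstLp_one]
    exact integral_congr_ae (ae_restrict_of_ae (coeFn_toL2 (hmem t)))

theorem toL2_integral [SigmaFinite μ] {X : Type*} [MeasurableSpace X] {m : Measure X}
    [SFinite m] {f : X → Euc d → ℝ}
    (hf : AEStronglyMeasurable (Function.uncurry f) (m.prod μ)) (hmem : ∀ t, MemLp (f t) 2 μ)
    (hint : Integrable (fun t => toL2 μ (f t)) m) :
    toL2 μ (fun y => ∫ t, f t y ∂m) = ∫ t, toL2 μ (f t) ∂m := by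
  rw [← toL2_congr (coeFn_integral_toL2 hf hmem hint), toL2_coeFn]

theorem toL2_add {f g : Euc d → ℝ} (hf : MemLp f 2 μ) (hg : MemLp g 2 μ) :
    toL2 μ (fun x => f x + g x) = toL2 μ f + toL2 μ g := by
  rw [toL2_of_memLp hf, toL2_of_memLp hg, ← MemLp.toLp_add]
  exact toL2_of_memLp (hf.add hg)

theorem toL2_sub {f g : Euc d → ℝ} (hf : MemLp f 2 μ) (hg : MemLp g 2 μ) :
    toL2 μ (fun x => f x - g x) = toL2 μ f - toL2 μ g := by
  rw [toL2_of_memLp hf, toL2_of_memLp hg, ← MemLp.toLp_sub]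
  exact toL2_of_memLp (hf.sub hg)

theorem toL2_const_mul {f : Euc d → ℝ} (c : ℝ) (hf : MemLp f 2 μ) :
    toL2 μ (fun x => c * f x) = c • toL2 μ f := by
  rw [toL2_of_memLp hf, ← MemLp.toLp_const_smul]
  exact toL2_of_memLp (hf.const_smul c)

theorem norm_toL2_le [IsFiniteMeasure μ] {f : Euc d → ℝ} (hf : MemLp f 2 μ) {B : ℝ} (hB : 0 ≤ B)
    (h : ∀ᵐ x ∂μ, |f x| ≤ B) :
    ‖toL2 μ f‖ ≤ (measureUnivNNReal μ : ℝ) ^ (1 / 2 : ℝ) * B := by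
  have := Lp.norm_le_of_ae_bound (f := toL2 μ f) hB (by
    filter_upwards [h, coeFn_toL2 hf] with x h1 h2
    rwa [h2])
  refine this.trans_eq ?_
  congr 1
  norm_num

end BochnerL2

/-! ### Classical partial derivatives, also with parameters. -/

section Partial

variable {d : ℕ}

/-- The partial derivative `∂_k f`. -/
def pd (k : Fin d) (f : Euc d → ℝ) (x : Euc d) : ℝ :=
  fderiv ℝ f x (EuclideanSpace.single k 1)

theorem contDiff_pd {n : ℕ} {f : Euc d → ℝ} (k : Fin d) (hf : ContDiff ℝ (n + 1 : ℕ) f) :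
    ContDiff ℝ n (pd k f) :=
  (hf.fderiv_right (m := n) (by norm_cast)).clm_apply contDiff_const

theorem continuous_pd {f : Euc d → ℝ} (k : Fin d) (hf : ContDiff ℝ 1 f) : Continuous (pd k f) :=
  (hf.continuous_fderiv one_ne_zero).clm_apply continuous_const

theorem hasCompactSupport_pd {f : Euc d → ℝ} (k : Fin d) (hf : HasCompactSupport f) :
    HasCompactSupport (pd k f) :=
  hf.fderiv_apply (𝕜 := ℝ) _

theorem tsupport_pd_subset {f : Euc d → ℝ} (k : Fin d) : tsupport (pd k f) ⊆ tsupport f :=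
  tsupport_fderiv_apply_subset ℝ _

theorem pderiv_one_order (I : Fin 1 → Fin d) (f : Euc d → ℝ) : pderiv I f = pd (I 0) f := by
  funext x; rw [pderiv, iteratedFDeriv_one_apply]; rfl

theorem pderiv_two_order (I : Fin 2 → Fin d) {f : Euc d → ℝ} (hf : ContDiff ℝ 2 f) :
    pderiv I f = pd (I 0) (pd (I 1) f) := by
  funext x
  rw [pderiv, iteratedFDeriv_two_apply, pd]
  unfold pd
  have : DifferentiableAt ℝ (fderiv ℝ f) x :=
    (hf.fderiv_right (m := 1) (by norm_num)).differentiable (by norm_num) x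
  rw [fderiv_clm_apply this (by fun_prop)]
  simp

theorem pd_comm {f : Euc d → ℝ} (hf : ContDiff ℝ 2 f) (i k : Fin d) :
    pd i (pd k f) = pd k (pd i f) := by
  funext x
  have : DifferentiableAt ℝ (fderiv ℝ f) x :=
    (hf.fderiv_right (m := 1) (by norm_num)).differentiable (by norm_num) x
  have hs : IsSymmSndFDerivAt ℝ f x := hf.contDiffAt.isSymmSndFDerivAt (by simp)
  unfold pd
  rw [fderiv_clm_apply this (by fun_prop), fderiv_clm_apply this (by fun_prop)]
  simpa using hs.eq _ _

theorem integral_mul_pd {f g : Euc d → ℝ} (hf : ContDiff ℝ 1 f) (hg : ContDiff ℝ 1 g)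
    (hg' : HasCompactSupport g) (k : Fin d) :
    ∫ x, f x * pd k g x = - ∫ x, pd k f x * g x := by
  have hc := hasCompactSupport_pd k hg'
  refine integral_mul_fderiv_eq_neg_fderiv_mul_of_integrable ?_ ?_ ?_
    (fun x _ => hf.differentiable one_ne_zero x) (fun x _ => hg.differentiable one_ne_zero x)
  · exact ((continuous_pd k hf).mul hg.continuous).integrable_of_hasCompactSupport hg'.mul_left
  · exact (hf.continuous.mul (continuous_pd k hg)).integrable_of_hasCompactSupport hc.mul_left
  · exact (hf.continuous.mul hg.continuous).integrable_of_hasCompactSupport hg'.mul_left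

theorem abs_pderiv_le {m : ℕ} (I : Fin m → Fin d) (f : Euc d → ℝ) (x : Euc d) :
    |pderiv I f x| ≤ ‖iteratedFDeriv ℝ m f x‖ := by
  refine ((iteratedFDeriv ℝ m f x).le_opNorm _).trans_eq ?_
  simp

variable {P : Type*} [NormedAddCommGroup P] [NormedSpace ℝ P]

/-- A derivative in `x` alone is the total derivative applied to `(0, e_k)`, so joint smoothness
drops by one order. -/
theorem contDiff_pd_param {n : ℕ} {F : P × Euc d → ℝ} (hF : ContDiff ℝ (n + 1 : ℕ) F)
    (k : Fin d) : ContDiff ℝ n (fun z : P × Euc d => pd k (fun x => F (z.1, x)) z.2) := by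
  have e : (fun z : P × Euc d => pd k (fun x => F (z.1, x)) z.2) =
      fun z => fderiv ℝ F z (0, EuclideanSpace.single k 1) := by
    funext z
    have h1 : HasFDerivAt F (fderiv ℝ F z) (z.1, z.2) :=
      (hF.differentiable (by norm_cast) z).hasFDerivAt
    have h2 := h1.comp z.2 (hasFDerivAt_prodMk_right z.1 z.2)
    rw [pd, show (fun x => F (z.1, x)) = F ∘ Prod.mk z.1 from rfl, h2.fderiv]
    simp
  rw [e]
  exact (hF.fderiv_right (m := n) (by norm_cast)).clm_apply contDiff_const

theorem contDiff_pderiv_param {n : ℕ} {F : P × Euc d → ℝ} (hF : ContDiff ℝ (n + 2 : ℕ) F)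
    (I : MIdx d) :
    ContDiff ℝ n (fun z : P × Euc d => pderiv I.2 (fun x => F (z.1, x)) z.2) := by
  have hFx : ∀ p : P, ContDiff ℝ 2 (fun x => F (p, x)) := fun p =>
    (hF.of_le (by norm_cast; omega)).comp (contDiff_prodMk_right p)
  obtain ⟨m, I⟩ := I
  fin_cases m
  · change ContDiff ℝ n (fun z : P × Euc d => pderiv (m := 0) I (fun x => F (z.1, x)) z.2)
    simp_rw [pderiv_zero_order]
    exact hF.of_le (by norm_cast; omega)
  · change ContDiff ℝ n (fun z : P × Euc d => pderiv (m := 1) I (fun x => F (z.1, x)) z.2)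
    simp_rw [pderiv_one_order]
    exact contDiff_pd_param (hF.of_le (by norm_cast; omega)) _
  · change ContDiff ℝ n (fun z : P × Euc d => pderiv (m := 2) I (fun x => F (z.1, x)) z.2)
    have e : ∀ z : P × Euc d, pderiv (m := 2) I (fun x => F (z.1, x)) z.2 =
        pd (I 0) (pd (I 1) fun x => F (z.1, x)) z.2 := fun z => by
      rw [pderiv_two_order I (hFx z.1)]
    simp_rw [e]
    exact contDiff_pd_param (F := fun z => pd (I 1) (fun x => F (z.1, x)) z.2)
      (contDiff_pd_param (n := n + 1) hF _) _

end Partial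

/-! ### Jets of smooth functions in `ℋ²` and their dependence on parameters. -/

section Jet

variable {d : ℕ} {Ω : TopologicalSpace.Opens (Euc d)} {μ : Measure (Euc d)}

theorem IsComparable.memLp_of_continuousOn (h : IsComparable (Ω : Set (Euc d)) μ)
    (hΩ : Bornology.IsBounded (Ω : Set (Euc d))) {f : Euc d → ℝ} (hf : Continuous f)
    (p : ℝ≥0∞) : MemLp f p μ := by
  have := h.finite
  obtain ⟨C, hC⟩ := hΩ.isCompact_closure.exists_bound_of_continuousOn hf.continuousOn
  refine MemLp.of_bound hf.aestronglyMeasurable C ?_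
  filter_upwards [h.ae_mem Ω.isOpen.measurableSet] with x hx
  exact hC x (subset_closure hx)

variable (μ) in
/-- The family of the derivatives of order at most two of a smooth function. -/
def jet (f : Euc d → ℝ) : SobE μ := WithLp.toLp 2 fun I : MIdx d => toL2 μ (pderiv I.2 f)

theorem jet_apply (f : Euc d → ℝ) (I : MIdx d) : jet μ f I = toL2 μ (pderiv I.2 f) := rfl

theorem jet_zero (f : Euc d → ℝ) : jet μ f (MIdx.zero d) = toL2 μ f := by
  rw [jet_apply, MIdx.zero]
  exact congrArg _ (pderiv_zero_order _ f)

theorem continuous_pderiv_midx {f : Euc d → ℝ} (hf : ContDiff ℝ 2 f) (I : MIdx d) :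
    Continuous (pderiv I.2 f) :=
  continuous_pderiv _ (hf.of_le (by exact_mod_cast Nat.le_of_lt_succ I.1.2))

/-- Integration by parts against a function supported in `Ω` has no boundary term, so classical
derivatives are weak derivatives. Two integrations reverse the order of the partial derivatives,
whence `pd_comm`. -/
theorem jet_mem (h : IsComparable (Ω : Set (Euc d)) μ)
    (hΩ : Bornology.IsBounded (Ω : Set (Euc d))) {f : Euc d → ℝ} (hf : ContDiff ℝ 2 f) :
    jet μ f ∈ sobH Ω μ h := by
  intro I
  have hm : ∀ J : MIdx d, toL2 μ (pderiv J.2 f) =ᵐ[μ] pderiv J.2 f := fun J =>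
    coeFn_toL2 (h.memLp_of_continuousOn hΩ (continuous_pderiv_midx hf J) 2)
  refine HasWeakDeriv.congr h (f := f) (g := pderiv I.2 f) ?_ (hm I).symm ?_
  · rw [jet_zero]; exact (coeFn_toL2 (h.memLp_of_continuousOn hΩ hf.continuous 2)).symm
  · intro φ
    have hφ2 : ContDiff ℝ 2 φ := φ.contDiff.of_le (by
      change ((2 : ℕ∞) : WithTop ℕ∞) ≤ ((⊤ : ℕ∞) : WithTop ℕ∞)
      exact_mod_cast le_top)
    have e : ∀ g : Euc d → ℝ, ∀ ψ : Euc d → ℝ, tsupport ψ ⊆ Ω →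
        ∫ x in (Ω : Set (Euc d)), g x * ψ x = ∫ x, g x * ψ x := fun g ψ hψ =>
      setIntegral_eq_integral_of_forall_compl_eq_zero fun x hx => by
        rw [image_eq_zero_of_notMem_tsupport fun hx' => hx (hψ hx'), mul_zero]
    obtain ⟨m, I⟩ := I
    fin_cases m
    · change ∫ x in (Ω : Set (Euc d)), f x * pderiv (m := 0) I φ x = (-1) ^ 0 *
        ∫ x in (Ω : Set (Euc d)), pderiv (m := 0) I f x * φ x
      simp [pderiv_zero_order]
    · change ∫ x in (Ω : Set (Euc d)), f x * pderiv (m := 1) I φ x = (-1) ^ 1 *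
        ∫ x in (Ω : Set (Euc d)), pderiv (m := 1) I f x * φ x
      rw [pderiv_one_order, pderiv_one_order, e _ _ φ.tsupport_subset,
        e _ _ ((tsupport_pd_subset _).trans φ.tsupport_subset),
        integral_mul_pd (hf.of_le (by norm_num)) (hφ2.of_le (by norm_num)) φ.hasCompactSupport]
      ring
    · change ∫ x in (Ω : Set (Euc d)), f x * pderiv (m := 2) I φ x = (-1) ^ 2 *
        ∫ x in (Ω : Set (Euc d)), pderiv (m := 2) I f x * φ x
      rw [pderiv_two_order I hφ2, pderiv_two_order I hf, e _ _ φ.tsupport_subset,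
        e _ _ ((tsupport_pd_subset _).trans ((tsupport_pd_subset _).trans φ.tsupport_subset)),
        integral_mul_pd (hf.of_le (by norm_num)) (contDiff_pd (n := 1) _ hφ2)
          (hasCompactSupport_pd _ φ.hasCompactSupport),
        integral_mul_pd (contDiff_pd (n := 1) _ hf) (hφ2.of_le (by norm_num))
          φ.hasCompactSupport, pd_comm hf]
      ring

/-- Two smooth functions that agree on `Ω` have the same jet. -/
theorem jet_congr (h : IsComparable (Ω : Set (Euc d)) μ)
    (hΩ : Bornology.IsBounded (Ω : Set (Euc d))) {F : SobE μ} (hF : F ∈ sobH Ω μ h)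
    {f : Euc d → ℝ} (hf : ContDiff ℝ 2 f) (h0 : F (MIdx.zero d) = toL2 μ f) : F = jet μ f :=
  sobH_ext h hF (jet_mem h hΩ hf) (h0.trans (jet_zero f).symm)

theorem jet_add (h : IsComparable (Ω : Set (Euc d)) μ)
    (hΩ : Bornology.IsBounded (Ω : Set (Euc d))) {f g : Euc d → ℝ} (hf : ContDiff ℝ 2 f)
    (hg : ContDiff ℝ 2 g) : jet μ (fun x => f x + g x) = jet μ f + jet μ g :=
  (jet_congr h hΩ ((sobH Ω μ h).add_mem (jet_mem h hΩ hf) (jet_mem h hΩ hg)) (hf.add hg) (by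
    change jet μ f (MIdx.zero d) + jet μ g (MIdx.zero d) = _
    rw [jet_zero, jet_zero, ← toL2_add (h.memLp_of_continuousOn hΩ hf.continuous 2)
      (h.memLp_of_continuousOn hΩ hg.continuous 2)])).symm

theorem jet_const_mul (h : IsComparable (Ω : Set (Euc d)) μ)
    (hΩ : Bornology.IsBounded (Ω : Set (Euc d))) (c : ℝ) {f : Euc d → ℝ} (hf : ContDiff ℝ 2 f) :
    jet μ (fun x => c * f x) = c • jet μ f :=
  (jet_congr h hΩ ((sobH Ω μ h).smul_mem c (jet_mem h hΩ hf)) (contDiff_const.mul hf) (by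
    change c • jet μ f (MIdx.zero d) = _
    rw [jet_zero, ← toL2_const_mul c (h.memLp_of_continuousOn hΩ hf.continuous 2)])).symm

theorem exists_norm_jet_le (h : IsComparable (Ω : Set (Euc d)) μ)
    (hΩ : Bornology.IsBounded (Ω : Set (Euc d))) :
    ∃ C : ℝ, 0 ≤ C ∧ ∀ (f : Euc d → ℝ) (B : ℝ), ContDiff ℝ 2 f → 0 ≤ B →
      (∀ x ∈ Ω, ∀ m ≤ 2, ‖iteratedFDeriv ℝ m f x‖ ≤ B) → ‖jet μ f‖ ≤ C * B := by
  have := h.finite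
  refine ⟨Fintype.card (MIdx d) * (measureUnivNNReal μ : ℝ) ^ (1 / 2 : ℝ), by positivity,
    fun f B hf hB hfB => (norm_toLp_le_sum _).trans ?_⟩
  have : ∀ I : MIdx d, ‖jet μ f I‖ ≤ (measureUnivNNReal μ : ℝ) ^ (1 / 2 : ℝ) * B := fun I => by
    refine norm_toL2_le (h.memLp_of_continuousOn hΩ (continuous_pderiv_midx hf I) 2) hB ?_
    filter_upwards [h.ae_mem Ω.isOpen.measurableSet] with x hx
    exact (abs_pderiv_le _ _ _).trans (hfB x hx _ (Nat.le_of_lt_succ I.1.2))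
  refine (Finset.sum_le_sum fun I _ => this I).trans_eq ?_
  rw [Finset.sum_const, Finset.card_univ, nsmul_eq_mul, mul_assoc]

section Param

/-- Compactness of the closure of `Ω` gives uniform convergence in `x`, and `μ` is finite. The
denominator `c + 1` covers the zero measure. -/
theorem continuous_toL2_param {P : Type*} [TopologicalSpace P] (h : IsComparable (Ω : Set (Euc d)) μ)
    (hΩ : Bornology.IsBounded (Ω : Set (Euc d))) {Φ : P × Euc d → ℝ} (hΦ : Continuous Φ) :
    Continuous fun θ => toL2 μ fun x => Φ (θ, x) := by
  have := h.finite
  rw [continuous_iff_continuousAt]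
  intro θ
  rw [ContinuousAt, tendsto_iff_norm_sub_tendsto_zero, Metric.tendsto_nhds]
  intro ε hε
  set c := (measureUnivNNReal μ : ℝ) ^ (1 / 2 : ℝ)
  have hc : 0 ≤ c := by positivity
  have hm : ∀ θ, MemLp (fun x => Φ (θ, x)) 2 μ := fun θ =>
    h.memLp_of_continuousOn hΩ (by fun_prop) 2
  have key : ∀ᶠ θ' in 𝓝 θ, ∀ x ∈ closure (Ω : Set (Euc d)),
      |Φ (θ', x) - Φ (θ, x)| < ε / (c + 1) := by
    refine hΩ.isCompact_closure.eventually_forall_of_forall_eventually fun x _ => ?_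
    have hcont : Continuous fun z : P × Euc d => |Φ (z.1, z.2) - Φ (θ, z.2)| := by fun_prop
    refine hcont.continuousAt.eventually_lt continuousAt_const ?_
    simp only [sub_self, abs_zero]; positivity
  filter_upwards [key] with θ' hθ'
  rw [dist_zero_right, norm_norm, ← toL2_sub (hm θ') (hm θ)]
  refine (norm_toL2_le ((hm θ').sub (hm θ)) (B := ε / (c + 1)) (by positivity) ?_).trans_lt ?_
  · filter_upwards [h.ae_mem Ω.isOpen.measurableSet] with x hx
    exact (hθ' x (subset_closure hx)).le
  · calc c * (ε / (c + 1)) < (c + 1) * (ε / (c + 1)) := by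
          have : 0 < ε / (c + 1) := by positivity
          nlinarith
      _ = ε := by field_simp

variable {P : Type*} [NormedAddCommGroup P] [NormedSpace ℝ P]

theorem continuous_jet_param (h : IsComparable (Ω : Set (Euc d)) μ)
    (hΩ : Bornology.IsBounded (Ω : Set (Euc d))) {F : P × Euc d → ℝ} (hF : ContDiff ℝ 2 F) :
    Continuous fun θ => jet μ fun x => F (θ, x) := by
  refine (PiLp.continuous_toLp 2 _).comp (continuous_pi fun I => ?_)
  exact continuous_toL2_param h hΩ (contDiff_pderiv_param (n := 0) hF I).continuous

/-- The mean value inequality in the parameter, for each fixed `x`; compactness makes the modulus of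
continuity of the derivative uniform in `x ∈ Ω`. -/
theorem exists_hasFDerivAt_toL2 [FiniteDimensional ℝ P] (h : IsComparable (Ω : Set (Euc d)) μ)
    (hΩ : Bornology.IsBounded (Ω : Set (Euc d))) {Φ : P × Euc d → ℝ} (hΦ : ContDiff ℝ 1 Φ)
    (θ : P) : ∃ L : P →L[ℝ] L2 μ, HasFDerivAt (fun θ => toL2 μ fun x => Φ (θ, x)) L θ ∧
      ∀ v, L v = toL2 μ fun x => fderiv ℝ Φ (θ, x) (v, 0) := by
  have := h.finite
  have hD : Continuous (fderiv ℝ Φ) := hΦ.continuous_fderiv one_ne_zero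
  have hm : ∀ θ, MemLp (fun x => Φ (θ, x)) 2 μ := fun θ =>
    h.memLp_of_continuousOn hΩ (by have := hΦ.continuous; fun_prop) 2
  have hm' : ∀ v : P, MemLp (fun x => fderiv ℝ Φ (θ, x) (v, 0)) 2 μ := fun v =>
    h.memLp_of_continuousOn hΩ (by fun_prop) 2
  let L₀ : P →ₗ[ℝ] L2 μ :=
    { toFun := fun v => toL2 μ fun x => fderiv ℝ Φ (θ, x) (v, 0)
      map_add' := fun v w => by
        rw [← toL2_add (hm' v) (hm' w)]
        congr 1; funext x
        rw [← map_add, Prod.mk_add_mk, add_zero]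
      map_smul' := fun c v => by
        rw [RingHom.id_apply, ← toL2_const_mul c (hm' v)]
        congr 1; funext x
        rw [← smul_eq_mul, ← map_smul, Prod.smul_mk, smul_zero] }
  refine ⟨LinearMap.toContinuousLinearMap L₀, ?_, fun v => rfl⟩
  set c := (measureUnivNNReal μ : ℝ) ^ (1 / 2 : ℝ)
  have hc : 0 ≤ c := by positivity
  rw [hasFDerivAt_iff_isLittleO, Asymptotics.isLittleO_iff]
  intro ε hε
  have key : ∀ᶠ θ' in 𝓝 θ, ∀ x ∈ closure (Ω : Set (Euc d)),
      ‖fderiv ℝ Φ (θ', x) - fderiv ℝ Φ (θ, x)‖ < ε / (c + 1) := by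
    refine hΩ.isCompact_closure.eventually_forall_of_forall_eventually fun x _ => ?_
    have hcont : Continuous fun z : P × Euc d =>
      ‖fderiv ℝ Φ (z.1, z.2) - fderiv ℝ Φ (θ, z.2)‖ := by fun_prop
    refine hcont.continuousAt.eventually_lt continuousAt_const ?_
    simp only [sub_self, norm_zero]; positivity
  obtain ⟨r, hr, hball⟩ := Metric.eventually_nhds_iff_ball.1 key
  filter_upwards [Metric.ball_mem_nhds θ hr] with θ' hθ'
  have e : toL2 μ (fun x => Φ (θ', x)) - toL2 μ (fun x => Φ (θ, x)) -
      (LinearMap.toContinuousLinearMap L₀) (θ' - θ) =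
      toL2 μ fun x => Φ (θ', x) - Φ (θ, x) - fderiv ℝ Φ (θ, x) (θ' - θ, 0) := by
    refine Eq.trans ?_ (toL2_sub ((hm θ').sub (hm θ)) (hm' _)).symm
    exact congrArg (· - L₀ (θ' - θ)) (toL2_sub (hm θ') (hm θ)).symm
  rw [e]
  refine (norm_toL2_le (((hm θ').sub (hm θ)).sub (hm' _)) (B := ε / (c + 1) * ‖θ' - θ‖)
    (by positivity) ?_).trans ?_
  · filter_upwards [h.ae_mem Ω.isOpen.measurableSet] with x hx
    have hd : ∀ p ∈ Metric.ball θ r, HasFDerivWithinAt (fun p => Φ (p, x))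
        ((fderiv ℝ Φ (p, x)).comp (ContinuousLinearMap.inl ℝ P (Euc d))) (Metric.ball θ r) p :=
      fun p _ => (((hΦ.differentiable one_ne_zero (p, x)).hasFDerivAt).comp p
        (hasFDerivAt_prodMk_left p x)).hasFDerivWithinAt
    have := (convex_ball θ r).norm_image_sub_le_of_norm_hasFDerivWithin_le'
      (φ := (fderiv ℝ Φ (θ, x)).comp (ContinuousLinearMap.inl ℝ P (Euc d)))
      (C := ε / (c + 1)) hd (fun p hp => by
        rw [← ContinuousLinearMap.sub_comp]
        refine (ContinuousLinearMap.opNorm_comp_le _ _).trans ?_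
        calc _ ≤ ε / (c + 1) * 1 := by
              gcongr
              · exact (hball p hp x (subset_closure hx)).le
              · exact ContinuousLinearMap.norm_inl_le_one ℝ P (Euc d)
          _ = _ := mul_one _) (Metric.mem_ball_self hr) hθ'
    simpa using this
  · rw [← mul_assoc]
    gcongr
    rw [mul_div_assoc', div_le_iff₀ (by positivity)]
    nlinarith

/-- A jet depends differentiably on parameters. -/
theorem exists_hasFDerivAt_jet [FiniteDimensional ℝ P] (h : IsComparable (Ω : Set (Euc d)) μ)
    (hΩ : Bornology.IsBounded (Ω : Set (Euc d))) {F : P × Euc d → ℝ} (hF : ContDiff ℝ 3 F)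
    (θ : P) : ∃ L : P →L[ℝ] SobE μ, HasFDerivAt (fun θ => jet μ fun x => F (θ, x)) L θ ∧
      ∀ v, L v = jet μ fun x => fderiv ℝ F (θ, x) (v, 0) := by
  have hF2 : ∀ θ, ContDiff ℝ 2 fun x => F (θ, x) := fun θ =>
    (hF.of_le (by norm_num)).comp (contDiff_prodMk_right θ)
  choose L hL hL' using fun I : MIdx d =>
    exists_hasFDerivAt_toL2 h hΩ (contDiff_pderiv_param (n := 1) hF I) θ
  let L₁ : P →L[ℝ] SobE μ :=
    (PiLp.continuousLinearEquiv 2 ℝ (fun _ : MIdx d => L2 μ)).symm.toContinuousLinearMap ∘L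
      ContinuousLinearMap.pi L
  have hL₁ : HasFDerivAt (fun θ => jet μ fun x => F (θ, x)) L₁ θ := by
    have h1 : HasFDerivAt (fun θ => fun I : MIdx d => toL2 μ (pderiv I.2 fun x => F (θ, x)))
        (ContinuousLinearMap.pi L) θ := hasFDerivAt_pi.2 hL
    exact (PiLp.continuousLinearEquiv 2 ℝ (fun _ : MIdx d => L2 μ)).symm.hasFDerivAt.comp θ h1
  refine ⟨L₁, hL₁, fun v => ?_⟩
  have : CompleteSpace (sobH Ω μ h) := (isClosed_sobH h).completeSpace_coe
  -- The map takes values in a closed subspace, so composition with the projection changes neither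
  -- it nor its derivative, which therefore lies in the subspace. Only the entry of order zero is
  -- then left to identify.
  have hmem : L₁ v ∈ sobH Ω μ h := by
    have h1 := (sobH Ω μ h).starProjection.hasFDerivAt.comp θ hL₁
    have e : ((sobH Ω μ h).starProjection ∘ fun θ => jet μ fun x => F (θ, x)) =
        fun θ => jet μ fun x => F (θ, x) := by
      funext θ
      exact Submodule.starProjection_eq_self_iff.2 (jet_mem h hΩ (hF2 θ))
    rw [e] at h1
    rw [hL₁.unique h1]
    exact Submodule.coe_mem _
  refine jet_congr h hΩ hmem ?_ ?_
  · exact ((hF.fderiv_right (m := 2) (by norm_num)).comp (contDiff_prodMk_right θ)).clm_apply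
      contDiff_const
  · change L (MIdx.zero d) v = _
    rw [hL']
    have e : (fun z : P × Euc d => pderiv (MIdx.zero d).2 (fun x => F (z.1, x)) z.2) = F := by
      funext z
      exact congrFun (pderiv_zero_order _ _) _
    rw [e]

end Param

end Jet

/-! ### Bounds for ridge functions in `ℋ²`. -/

section Ridge

variable {d : ℕ} {Ω : TopologicalSpace.Opens (Euc d)} {μ : Measure (Euc d)}

theorem norm_iteratedFDeriv_affine_le (w : Euc d) (b : ℝ) (x : Euc d) {i : ℕ} (h1 : 1 ≤ i)
    (h2 : i ≤ 2) : ‖iteratedFDeriv ℝ i (fun x => ⟪w, x⟫_ℝ + b) x‖ ≤ (1 + ‖w‖) ^ i := by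
  have hd : fderiv ℝ (fun x => ⟪w, x⟫_ℝ + b) = fun _ => innerSL ℝ w := by
    funext y
    exact ((innerSL ℝ w).hasFDerivAt.add_const b).fderiv
  interval_cases i
  · rw [norm_iteratedFDeriv_one, hd, innerSL_apply_norm]
    linarith
  · rw [← norm_iteratedFDeriv_fderiv, hd, norm_iteratedFDeriv_one, fderiv_const_apply, norm_zero]
    positivity

/-- Each derivative of the inner affine map costs one factor `1 + ‖w‖`. This quadratic growth,
occurring twice in `𝒰 h`, is what the fourth moment of `w` pays for. -/
theorem exists_norm_jet_ridge_le (h : IsComparable (Ω : Set (Euc d)) μ)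
    (hΩ : Bornology.IsBounded (Ω : Set (Euc d))) {ζ : Euc d → ℝ} (hζ : ContDiff ℝ 2 ζ) :
    ∃ C : ℝ, 0 ≤ C ∧ ∀ (τ : ℝ → ℝ) (w : Euc d) (b M : ℝ), ContDiff ℝ 2 τ → 0 ≤ M →
      (∀ x ∈ Ω, ∀ k ≤ 2, ‖iteratedFDeriv ℝ k τ (⟪w, x⟫_ℝ + b)‖ ≤ M) →
      ‖jet μ fun x => ζ x * τ (⟪w, x⟫_ℝ + b)‖ ≤ C * M * (1 + ‖w‖) ^ 2 := by
  obtain ⟨C, hC, hjet⟩ := exists_norm_jet_le h hΩ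
  have hZ : ∃ Z : ℝ, 0 ≤ Z ∧ ∀ x ∈ Ω, ∀ i ≤ 2, ‖iteratedFDeriv ℝ i ζ x‖ ≤ Z := by
    have : ∀ i : Fin 3, ∃ Z : ℝ, ∀ x ∈ closure (Ω : Set (Euc d)),
        ‖iteratedFDeriv ℝ (i : ℕ) ζ x‖ ≤ Z := fun i =>
      hΩ.isCompact_closure.exists_bound_of_continuousOn
        (hζ.continuous_iteratedFDeriv
          (by exact_mod_cast Nat.le_of_lt_succ i.2)).continuousOn
    choose Z hZ using this
    refine ⟨∑ i, |Z i|, by positivity, fun x hx i hi => ?_⟩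
    have h1 := hZ ⟨i, by omega⟩ x (subset_closure hx)
    have h2 := Finset.single_le_sum (f := fun i => |Z i|) (fun i _ => abs_nonneg _)
      (Finset.mem_univ (⟨i, by omega⟩ : Fin 3))
    exact h1.trans ((le_abs_self _).trans h2)
  obtain ⟨Z, hZ0, hZ⟩ := hZ
  -- The factor `8` is `2!` from the chain rule times `2 ^ 2` from the binomial coefficients of the
  -- product rule.
  refine ⟨C * (8 * Z), by positivity, fun τ w b M hτ hM hb => ?_⟩
  have hr : ContDiff ℝ 2 fun x : Euc d => ⟪w, x⟫_ℝ + b :=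
    (contDiff_const.inner ℝ contDiff_id).add contDiff_const
  have hτr : ContDiff ℝ 2 fun x : Euc d => τ (⟪w, x⟫_ℝ + b) := hτ.comp hr
  have h1w : 1 ≤ 1 + ‖w‖ := by linarith [norm_nonneg w]
  have hcomp : ∀ x ∈ Ω, ∀ m ≤ 2, ‖iteratedFDeriv ℝ m (fun x => τ (⟪w, x⟫_ℝ + b)) x‖ ≤
      2 * M * (1 + ‖w‖) ^ 2 := fun x hx m hm => by
    have := norm_iteratedFDeriv_comp_le (n := m) hτ hr (by exact_mod_cast hm) x (C := M)
      (D := 1 + ‖w‖) (fun i hi => hb x hx i (hi.trans hm))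
      (fun i h1 h2 => norm_iteratedFDeriv_affine_le w b x h1 (h2.trans hm))
    refine this.trans ?_
    gcongr
    · have : m.factorial ≤ Nat.factorial 2 := Nat.factorial_le hm
      exact_mod_cast this
  rw [mul_assoc, mul_assoc C]
  refine hjet _ _ (hζ.mul hτr) (by positivity) fun x hx m hm => ?_
  refine (norm_iteratedFDeriv_mul_le hζ hτr x (n := m) (by exact_mod_cast hm)).trans ?_
  calc _ ≤ ∑ i ∈ Finset.range (m + 1), (m.choose i : ℝ) * Z * (2 * M * (1 + ‖w‖) ^ 2) := by
        refine Finset.sum_le_sum fun i hi => ?_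
        have hi' : i ≤ m := Nat.lt_succ_iff.1 (Finset.mem_range.1 hi)
        gcongr
        · exact hZ x hx i (hi'.trans hm)
        · exact hcomp x hx _ ((Nat.sub_le _ _).trans hm)
    _ = 2 ^ m * (Z * (2 * M * (1 + ‖w‖) ^ 2)) := by
        have := Nat.sum_range_choose m
        rw [← Finset.sum_mul, ← Finset.sum_mul, ← Nat.cast_sum, this]
        push_cast; ring
    _ ≤ 2 ^ 2 * (Z * (2 * M * (1 + ‖w‖) ^ 2)) := by
        gcongr
        norm_num
    _ = 8 * Z * (M * (1 + ‖w‖) ^ 2) := by ring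

theorem jet_sum (h : IsComparable (Ω : Set (Euc d)) μ)
    (hΩ : Bornology.IsBounded (Ω : Set (Euc d))) {ι : Type*} (s : Finset ι) {f : ι → Euc d → ℝ}
    (hf : ∀ i, ContDiff ℝ 2 (f i)) : jet μ (fun x => ∑ i ∈ s, f i x) = ∑ i ∈ s, jet μ (f i) := by
  classical
  induction s using Finset.induction_on with
  | empty =>
    simp only [Finset.sum_empty]
    have := jet_const_mul h hΩ 0 (f := fun _ => 0) contDiff_const
    simpa using this
  | insert i s hi ih =>
    simp_rw [Finset.sum_insert hi]
    rw [jet_add h hΩ (hf i) (ContDiff.sum fun i _ => hf i), ih]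

/-- The orthogonal projection commutes with the integral and fixes the integrand. -/
theorem integral_mem_sobH (h : IsComparable (Ω : Set (Euc d)) μ) {X : Type*} [MeasurableSpace X]
    {m : Measure X} {V : X → SobE μ} (hV : ∀ t, V t ∈ sobH Ω μ h) (hint : Integrable V m) :
    ∫ t, V t ∂m ∈ sobH Ω μ h := by
  have : CompleteSpace (sobH Ω μ h) := (isClosed_sobH h).completeSpace_coe
  have h1 := (sobH Ω μ h).starProjection.integral_comp_comm hint
  simp_rw [fun t => Submodule.starProjection_eq_self_iff.2 (hV t)] at h1
  rw [h1]
  exact Submodule.coe_mem _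

theorem integral_sobE_apply {X : Type*} [MeasurableSpace X]
    {m : Measure X} {V : X → SobE μ} (hint : Integrable V m) (I : MIdx d) :
    (∫ t, V t ∂m) I = ∫ t, V t I ∂m :=
  ((SobE.proj I).integral_comp_comm hint).symm

end Ridge

/-! ### Parameter derivatives of a hidden unit and moments of the initial law. -/

section ParamDerivatives

variable {d : ℕ}

/-- Dependence on `c` of the derivative of a hidden unit in a coordinate direction. -/
def dirFactor : Unit ⊕ Fin d ⊕ Unit → ℝ → ℝ
  | .inl _, _ => 1
  | .inr _, c => c

/-- Spatial weight of the derivative of a hidden unit in a coordinate direction. -/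
def dirWeight (η : Euc d → ℝ) : Unit ⊕ Fin d ⊕ Unit → Euc d → ℝ
  | .inl _, x => η x
  | .inr (.inl k), x => η x * x k
  | .inr (.inr _), x => η x

/-- Activation of the derivative of a hidden unit in a coordinate direction. -/
def dirAct (σ : ℝ → ℝ) : Unit ⊕ Fin d ⊕ Unit → ℝ → ℝ
  | .inl _ => σ
  | .inr _ => deriv σ

/-- The derivative of a hidden unit in a coordinate direction of parameter space. -/
def dirUnit (η : Euc d → ℝ) (σ : ℝ → ℝ) (j : Unit ⊕ Fin d ⊕ Unit) (θ : Param d) (x : Euc d) : ℝ :=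
  dirFactor j θ.1 * (dirWeight η j x * dirAct σ j (⟪θ.2.1, x⟫_ℝ + θ.2.2))

/-- Every parameter derivative of a unit is again a ridge function with a spatial weight:
differentiation in `w_k` puts `x_k` into the weight, and differentiation in `w` or `b` turns `σ`
into its derivative. -/
theorem fderiv_hiddenUnit_param (η : Euc d → ℝ) {σ : ℝ → ℝ} (hσ : ContDiff ℝ 1 σ) (θ : Param d)
    (x : Euc d) (j : Unit ⊕ Fin d ⊕ Unit) :
    fderiv ℝ (fun θ' => hiddenUnit η σ θ' x) θ (paramDir j) = dirUnit η σ j θ x := by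
  let L : Param d →L[ℝ] ℝ := (innerSL ℝ x).comp ((ContinuousLinearMap.fst ℝ (Euc d) ℝ).comp
    (ContinuousLinearMap.snd ℝ ℝ (Euc d × ℝ))) + (ContinuousLinearMap.snd ℝ (Euc d) ℝ).comp
    (ContinuousLinearMap.snd ℝ ℝ (Euc d × ℝ))
  have hL : ∀ θ : Param d, L θ = ⟪θ.2.1, x⟫_ℝ + θ.2.2 := fun θ => by
    change ⟪x, θ.2.1⟫_ℝ + θ.2.2 = _
    rw [real_inner_comm]
  have h1 : HasFDerivAt (fun θ' : Param d => σ (L θ')) (deriv σ (L θ) • L) θ :=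
    (hσ.differentiable one_ne_zero (L θ)).hasDerivAt.comp_hasFDerivAt θ L.hasFDerivAt
  have h2 : HasFDerivAt (fun θ' : Param d => η x * (θ'.1 * σ (L θ')))
      (η x • (θ.1 • (deriv σ (L θ) • L) + σ (L θ) • ContinuousLinearMap.fst ℝ ℝ (Euc d × ℝ))) θ :=
    (hasFDerivAt_fst.mul h1).const_mul (η x)
  have e : (fun θ' => hiddenUnit η σ θ' x) = fun θ' => η x * (θ'.1 * σ (L θ')) := by
    funext θ'; rw [hL]; rfl
  rw [e, h2.fderiv]
  have e2 : ∀ v : Param d, (η x • (θ.1 • (deriv σ (L θ) • L) +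
      σ (L θ) • ContinuousLinearMap.fst ℝ ℝ (Euc d × ℝ))) v =
      η x * (θ.1 * (deriv σ (L θ) * L v) + σ (L θ) * v.1) := fun v => rfl
  rw [e2, hL, hL]
  rcases j with _ | k | _
  · simp [paramDir, dirUnit, dirFactor, dirWeight, dirAct]
  · simp [paramDir, dirUnit, dirFactor, dirWeight, dirAct, EuclideanSpace.inner_single_left]
    ring
  · simp [paramDir, dirUnit, dirFactor, dirWeight, dirAct]
    ring

theorem contDiff_hiddenUnit_param {n : ℕ} {η : Euc d → ℝ} {σ : ℝ → ℝ} (hη : ContDiff ℝ n η)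
    (hσ : ContDiff ℝ n σ) :
    ContDiff ℝ n fun z : Param d × Euc d => hiddenUnit η σ z.1 z.2 := by
  unfold hiddenUnit
  have : ContDiff ℝ n fun z : Param d × Euc d => ⟪z.1.2.1, z.2⟫_ℝ + z.1.2.2 :=
    (ContDiff.inner ℝ (by fun_prop) (by fun_prop)).add (by fun_prop)
  exact (hη.comp contDiff_snd).mul ((by fun_prop : ContDiff ℝ n fun z : Param d × Euc d =>
    z.1.1).mul (hσ.comp this))

theorem contDiff_dirAct {n : ℕ} {σ : ℝ → ℝ} (hσ : ContDiff ℝ (n + 1 : ℕ) σ)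
    (j : Unit ⊕ Fin d ⊕ Unit) : ContDiff ℝ n (dirAct σ j) := by
  rcases j with _ | j
  · exact hσ.of_le (by norm_cast; omega)
  · exact (contDiff_succ_iff_deriv.1 (by exact_mod_cast hσ)).2.2

theorem contDiff_dirWeight {n : ℕ} {η : Euc d → ℝ} (hη : ContDiff ℝ n η)
    (j : Unit ⊕ Fin d ⊕ Unit) : ContDiff ℝ n (dirWeight η j) := by
  rcases j with _ | k | _
  · exact hη
  · exact hη.mul (by fun_prop : ContDiff ℝ n fun x : Euc d => x k)
  · exact hη

theorem contDiff_dirUnit_param {n : ℕ} {η : Euc d → ℝ} {σ : ℝ → ℝ} (hη : ContDiff ℝ n η)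
    (hσ : ContDiff ℝ (n + 1 : ℕ) σ) (j : Unit ⊕ Fin d ⊕ Unit) :
    ContDiff ℝ n fun z : Param d × Euc d => dirUnit η σ j z.1 z.2 := by
  unfold dirUnit
  have : ContDiff ℝ n fun z : Param d × Euc d => ⟪z.1.2.1, z.2⟫_ℝ + z.1.2.2 :=
    (ContDiff.inner ℝ (by fun_prop) (by fun_prop)).add (by fun_prop)
  have h1 : ContDiff ℝ n fun z : Param d × Euc d => dirFactor j z.1.1 := by
    rcases j with _ | j
    · exact contDiff_const
    · exact (by fun_prop : ContDiff ℝ n fun z : Param d × Euc d => z.1.1)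
  exact h1.mul (((contDiff_dirWeight hη j).comp contDiff_snd).mul
    ((contDiff_dirAct hσ j).comp this))

theorem CkBounded.exists_bound_dirAct {σ : ℝ → ℝ} (hσ : CkBounded 4 σ) :
    ∃ M : ℝ, 0 ≤ M ∧ ∀ (j : Unit ⊕ Fin d ⊕ Unit), ∀ k ≤ 2, ∀ s,
      ‖iteratedFDeriv ℝ k (dirAct σ j) s‖ ≤ M := by
  have : ∀ m : Fin 5, ∃ C : ℝ, ∀ x, ‖iteratedFDeriv ℝ (m : ℕ) σ x‖ ≤ C := fun m =>
    hσ.2 m (Nat.le_of_lt_succ m.2)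
  choose C hC using this
  have hM : ∀ m : Fin 5, ∀ x, ‖iteratedFDeriv ℝ (m : ℕ) σ x‖ ≤ ∑ m, |C m| := fun m x =>
    (hC m x).trans ((le_abs_self _).trans
      (Finset.single_le_sum (f := fun m => |C m|) (fun i _ => abs_nonneg _) (Finset.mem_univ m)))
  refine ⟨∑ m, |C m|, by positivity, fun j k hk s => ?_⟩
  rcases j with _ | j
  · exact hM ⟨k, by omega⟩ s
  · have := hM ⟨k + 1, by omega⟩ s
    rw [norm_iteratedFDeriv_eq_norm_iteratedDeriv] at this ⊢
    dsimp only at this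
    rwa [iteratedDeriv_succ'] at this

end ParamDerivatives

section Moments

variable {d : ℕ} {ν : Measure (Param d)}

/-- By Cauchy–Schwarz, `‖w‖⁴ = (∑ w_k²)² ≤ d ∑ w_k⁴`. -/
theorem IsInitialLaw.integrable_pow_four (hν : IsInitialLaw ν) :
    Integrable (fun θ : Param d => (1 + ‖θ.2.1‖) ^ 4) ν := by
  have := hν.prob
  have h1 : Integrable (fun θ : Param d => 8 + 8 * (d * ∑ k, |θ.2.1 k| ^ 4)) ν :=
    (integrable_const _).add (((integrable_finsetSum _ fun k _ => hν.w_moment k).const_mul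
      _).const_mul _)
  refine h1.mono' (by fun_prop) (ae_of_all _ fun θ => ?_)
  set w := θ.2.1
  have hw : ‖w‖ ^ 4 ≤ d * ∑ k, |w k| ^ 4 := by
    have e : ‖w‖ ^ 4 = (∑ k, |w k| ^ 2) ^ 2 := by
      have := EuclideanSpace.real_norm_sq_eq w
      rw [show ‖w‖ ^ 4 = (‖w‖ ^ 2) ^ 2 by ring, this]
      simp
    rw [e]
    refine (sq_sum_le_card_mul_sum_sq).trans_eq ?_
    simp only [Finset.card_univ, Fintype.card_fin]
    congr 1
    exact Finset.sum_congr rfl fun k _ => by ring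
  rw [Real.norm_eq_abs, abs_of_nonneg (by positivity)]
  have h2 : (1 + ‖w‖) ^ 4 ≤ 8 + 8 * ‖w‖ ^ 4 := by
    nlinarith [sq_nonneg (‖w‖ - 1), sq_nonneg (‖w‖ ^ 2 - 1), sq_nonneg (‖w‖ ^ 2 - ‖w‖),
      norm_nonneg w]
  linarith

end Moments

/-! ### The kernel of `𝒮` and ridge functions. -/

section Kernel

variable {d : ℕ} {Ω : TopologicalSpace.Opens (Euc d)} {μ : Measure (Euc d)}

/-- If `𝒮 h = 0` then `h` is orthogonal to `A` of every ridge function. -/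
theorem inner_ridge_eq_zero_of_opS_eq_zero (hc : IsComparable (Ω : Set (Euc d)) μ)
    (hΩ : Bornology.IsBounded (Ω : Set (Euc d))) {η : Euc d → ℝ} (hη : ContDiff ℝ 3 η)
    {σ : ℝ → ℝ} (hσ : CkBounded 4 σ) {ν : Measure (Param d)} (hν : IsInitialLaw ν)
    {A : L2 μ →ₗ.[ℝ] L2 μ} {T : SobE μ →L[ℝ] L2 μ}
    (hT : ∀ F ∈ sobH Ω μ hc, T F = applyOp A (F (MIdx.zero d)))
    {h : L2 μ} (hS : opS A η σ ν h = 0) (w : Euc d) (b : ℝ) :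
    ⟪h, T (jet μ fun x => η x * σ (⟪w, x⟫_ℝ + b))⟫_ℝ = 0 := by
  classical
  have hfin := hc.finite
  have hprob := hν.prob
  have hσ4 : ContDiff ℝ (3 + 1 : ℕ) σ := hσ.1
  have hσ3 : ContDiff ℝ (3 : ℕ) σ := hσ4.of_le (by norm_cast)
  have hη3 : ContDiff ℝ (3 : ℕ) η := by exact_mod_cast hη
  have hF : ContDiff ℝ 3 fun z : Param d × Euc d => hiddenUnit η σ z.1 z.2 := by
    exact_mod_cast contDiff_hiddenUnit_param hη3 hσ3
  have hα : ∀ j, ContDiff ℝ 3 fun z : Param d × Euc d => dirUnit η σ j z.1 z.2 := fun j => by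
    exact_mod_cast contDiff_dirUnit_param hη3 hσ4 j
  have hαx : ∀ j (θ : Param d), ContDiff ℝ 2 (dirUnit η σ j θ) := fun j θ =>
    ((hα j).of_le (by norm_num)).comp (contDiff_prodMk_right θ)
  have hFx : ∀ θ : Param d, ContDiff ℝ 2 (hiddenUnit η σ θ) := fun θ =>
    (hF.of_le (by norm_num)).comp (contDiff_prodMk_right θ)
  -- the derivative of the hidden units as elements of `L²`
  have hGT : ∀ θ, applyOp A (toL2 μ (hiddenUnit η σ θ)) = T (jet μ (hiddenUnit η σ θ)) :=
    fun θ => by rw [hT _ (jet_mem hc hΩ (hFx θ)), jet_zero]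
  -- `T` is bounded and jets are differentiable in the norm of `SobE μ`, so `A` commutes with the
  -- parameter gradient.
  have hderiv : ∀ (θ : Param d) j, fderiv ℝ (fun θ' => applyOp A (toL2 μ (hiddenUnit η σ θ'))) θ
      (paramDir j) = T (jet μ (dirUnit η σ j θ)) := fun θ j => by
    obtain ⟨L, hL, hL'⟩ := exists_hasFDerivAt_jet hc hΩ hF θ
    simp_rw [hGT]
    have h1 : HasFDerivAt (fun θ' => T (jet μ (hiddenUnit η σ θ'))) (T ∘L L) θ :=
      T.hasFDerivAt.comp θ hL
    rw [h1.fderiv, ContinuousLinearMap.comp_apply, hL']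
    congr 2
    funext x
    rw [← fderiv_hiddenUnit_param η (hσ.1.of_le (by norm_num)) θ x j]
    have h2 : HasFDerivAt (fun z : Param d × Euc d => hiddenUnit η σ z.1 z.2) _ (θ, x) :=
      (hF.differentiable (by norm_num) (θ, x)).hasFDerivAt
    have h3 := HasFDerivAt.comp (f := fun θ' : Param d => (θ', x))
      (g := fun z : Param d × Euc d => hiddenUnit η σ z.1 z.2) θ h2
      (hasFDerivAt_prodMk_left (𝕜 := ℝ) θ x)
    rw [show (fun θ' => hiddenUnit η σ θ' x) =
      (fun z : Param d × Euc d => hiddenUnit η σ z.1 z.2) ∘ fun θ' => (θ', x) from rfl, h3.fderiv]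
    rfl
  set U : Unit ⊕ Fin d ⊕ Unit → Param d → SobE μ := fun j θ => jet μ (dirUnit η σ j θ) with hU
  have hUc : ∀ j, Continuous (U j) := fun j => continuous_jet_param hc hΩ ((hα j).of_le (by norm_num))
  have hUm : ∀ j θ, U j θ ∈ sobH Ω μ hc := fun j θ => jet_mem hc hΩ (hαx j θ)
  -- These pairings are the coefficients of `𝒰 h` with respect to the derivatives of the hidden
  -- units.
  set a : Unit ⊕ Fin d ⊕ Unit → Param d → ℝ := fun j θ => ⟪h, T (U j θ)⟫_ℝ with ha
  have hac : ∀ j, Continuous (a j) := fun j =>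
    continuous_const.inner (T.continuous.comp (hUc j))
  -- bounds
  obtain ⟨M, hM0, hM⟩ := hσ.exists_bound_dirAct (d := d)
  obtain ⟨K, hK⟩ := hν.c_bounded
  have hfac : ∀ᵐ θ ∂ν, ∀ j : Unit ⊕ Fin d ⊕ Unit, |dirFactor j θ.1| ≤ 1 + |K| := by
    filter_upwards [hK] with θ hθ j
    rcases j with _ | j
    · change |(1 : ℝ)| ≤ _; rw [abs_one]; linarith [abs_nonneg K]
    · change |θ.1| ≤ _; linarith [le_abs_self K]
  have hUb : ∀ j, ∃ C : ℝ, 0 ≤ C ∧ ∀ᵐ θ ∂ν, ‖U j θ‖ ≤ C * (1 + ‖θ.2.1‖) ^ 2 := fun j => by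
    obtain ⟨C, hC, hb⟩ := exists_norm_jet_ridge_le hc hΩ (ζ := dirWeight η j)
      (by exact_mod_cast contDiff_dirWeight (hη3.of_le (by norm_cast : ((2 : ℕ) : WithTop ℕ∞) ≤ (3 : ℕ))) j)
    have hact : ContDiff ℝ 2 (dirAct σ j) := by
      exact_mod_cast contDiff_dirAct (n := 2) hσ3 j
    have hw2 : ContDiff ℝ 2 (dirWeight η j) := by
      exact_mod_cast contDiff_dirWeight (n := 2) (hη3.of_le (by norm_cast)) j
    refine ⟨(1 + |K|) * (C * M), by positivity, ?_⟩
    filter_upwards [hfac] with θ hθ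
    have e : U j θ = dirFactor j θ.1 • jet μ fun x => dirWeight η j x *
        dirAct σ j (⟪θ.2.1, x⟫_ℝ + θ.2.2) :=
      jet_const_mul hc hΩ _ (hw2.mul (hact.comp
        ((contDiff_const.inner ℝ contDiff_id).add contDiff_const)))
    rw [e, norm_smul, mul_assoc]
    gcongr
    · exact hθ j
    · exact hb _ _ _ _ hact hM0 fun x _ k hk => hM j k hk _
  choose C hC0 hC using hUb
  have hUb' : ∀ᵐ θ ∂ν, ∀ j, ‖U j θ‖ ≤ (∑ j, C j) * (1 + ‖θ.2.1‖) ^ 2 := by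
    filter_upwards [ae_all_iff.2 hC] with θ hθ j
    refine (hθ j).trans ?_
    gcongr
    exact Finset.single_le_sum (fun j _ => hC0 j) (Finset.mem_univ j)
  set C₁ := ∑ j, C j with hC₁
  have hC₁0 : 0 ≤ C₁ := Finset.sum_nonneg fun j _ => hC0 j
  have hab : ∀ᵐ θ ∂ν, ∀ j, |a j θ| ≤ ‖h‖ * ‖T‖ * C₁ * (1 + ‖θ.2.1‖) ^ 2 := by
    filter_upwards [hUb'] with θ hθ j
    refine (abs_real_inner_le_norm _ _).trans ?_
    rw [mul_assoc, mul_assoc]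
    gcongr
    exact (T.le_opNorm _).trans (by gcongr; exact hθ j)
  have hmom2 : Integrable (fun θ : Param d => (1 + ‖θ.2.1‖) ^ 2) ν := by
    refine hν.integrable_pow_four.mono' (by fun_prop) (ae_of_all _ fun θ => ?_)
    rw [Real.norm_eq_abs, abs_of_nonneg (by positivity)]
    exact pow_le_pow_right₀ (by linarith [norm_nonneg θ.2.1]) (by norm_num)
  -- the kernel
  have hαb : ∀ y, ∀ᵐ θ ∂ν, ∀ j, |dirUnit η σ j θ y| ≤
      (1 + |K|) * ((∑ j, |dirWeight η j y|) * M) := fun y => by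
    filter_upwards [hfac] with θ hθ j
    rw [dirUnit, abs_mul, abs_mul]
    gcongr
    · exact hθ j
    · exact Finset.single_le_sum (f := fun j => |dirWeight η j y|) (fun j _ => abs_nonneg _)
        (Finset.mem_univ j)
    · have := hM j 0 (by norm_num) (⟪θ.2.1, y⟫_ℝ + θ.2.2)
      rwa [norm_iteratedFDeriv_zero] at this
  have hαc : ∀ j y, Continuous fun θ => dirUnit η σ j θ y := fun j y =>
    (hα j).continuous.comp (by fun_prop : Continuous fun θ : Param d => (θ, y))
  have hKint : ∀ y j, Integrable (fun θ => dirUnit η σ j θ y • T (U j θ)) ν := fun y j => by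
    refine (hmom2.const_mul (((1 + |K|) * ((∑ j, |dirWeight η j y|) * M)) * (‖T‖ * C₁))).mono'
      ((hαc j y).smul (T.continuous.comp (hUc j))).aestronglyMeasurable ?_
    filter_upwards [hαb y, hUb'] with θ h1 h2
    rw [norm_smul, mul_assoc, mul_assoc ‖T‖]
    gcongr
    · exact h1 j
    · exact (T.le_opNorm _).trans (by gcongr; exact h2 j)
  have hker : ∀ y, ∫ x, h x * kernelU A η σ ν y x ∂μ =
      ∫ θ, ∑ j, a j θ * dirUnit η σ j θ y ∂ν := fun y => by
    have e1 : ∫ x, h x * kernelU A η σ ν y x ∂μ = ⟪h, kernelU A η σ ν y⟫_ℝ := by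
      rw [L2.inner_def]
      refine integral_congr_ae (ae_of_all _ fun x => ?_)
      simp [mul_comm]
    have e2 : kernelU A η σ ν y = ∫ θ, ∑ j, dirUnit η σ j θ y • T (U j θ) ∂ν := by
      rw [kernelU]
      refine integral_congr_ae (ae_of_all _ fun θ => Finset.sum_congr rfl fun j _ => ?_)
      rw [hderiv, fderiv_hiddenUnit_param η (hσ.1.of_le (by norm_num))]
    rw [e1, e2]
    have e3 := integral_inner (𝕜 := ℝ) (integrable_finsetSum Finset.univ fun j _ => hKint y j) h
    rw [← e3]
    refine integral_congr_ae (ae_of_all _ fun θ => ?_)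
    dsimp only
    rw [inner_sum]
    refine Finset.sum_congr rfl fun j _ => ?_
    rw [inner_smul_right, mul_comm]
  -- the operator `𝒰`
  set f : Param d → Euc d → ℝ := fun θ y => ∑ j, a j θ * dirUnit η σ j θ y with hf
  have hfx : ∀ θ, ContDiff ℝ 2 (f θ) := fun θ =>
    ContDiff.sum fun j _ => contDiff_const.mul (hαx j θ)
  have hZ : ∀ θ, jet μ (f θ) = ∑ j, a j θ • U j θ := fun θ => by
    rw [hf]
    refine (jet_sum hc hΩ Finset.univ fun j => contDiff_const.mul (hαx j θ)).trans ?_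
    exact Finset.sum_congr rfl fun j _ => jet_const_mul hc hΩ _ (hαx j θ)
  -- Both `a j` and `U j` grow at most quadratically in `w`, so their product is integrable by the
  -- fourth moment.
  have hZint : Integrable (fun θ => jet μ (f θ)) ν := by
    simp_rw [hZ]
    refine integrable_finsetSum _ fun j _ => ?_
    refine (hν.integrable_pow_four.const_mul (‖h‖ * ‖T‖ * C₁ * C₁)).mono'
      ((hac j).smul (hUc j)).aestronglyMeasurable ?_
    filter_upwards [hab, hUb'] with θ h1 h2
    rw [norm_smul, Real.norm_eq_abs]
    calc |a j θ| * ‖U j θ‖ ≤ (‖h‖ * ‖T‖ * C₁ * (1 + ‖θ.2.1‖) ^ 2) *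
          (C₁ * (1 + ‖θ.2.1‖) ^ 2) := by
          gcongr
          · exact h1 j
          · exact h2 j
      _ = _ := by ring
  -- The integral defining `𝒰 h` converges in `SobE μ`, not only in `L²`; this allows the bounded
  -- operator `T` to pass under it.
  have hopU : opU A η σ ν h = (∫ θ, jet μ (f θ) ∂ν) (MIdx.zero d) := by
    rw [integral_sobE_apply hZint, opU]
    simp_rw [hker, jet_zero]
    refine toL2_integral ?_ (fun θ => hc.memLp_of_continuousOn hΩ (hfx θ).continuous 2) ?_
    · refine Continuous.aestronglyMeasurable ?_
      refine continuous_finsetSum _ fun j _ => ?_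
      exact ((hac j).comp continuous_fst).mul (hα j).continuous
    · simpa only [SobE.proj_apply, jet_zero] using
        (SobE.proj (MIdx.zero d)).integrable_comp hZint
  have hopS : opS A η σ ν h = ∫ θ, T (jet μ (f θ)) ∂ν := by
    rw [opS, hopU, ← hT _ (integral_mem_sobH hc (fun θ => jet_mem hc hΩ (hfx θ)) hZint)]
    exact (T.integral_comp_comm hZint).symm
  -- Here is the positivity: pairing the integrand of `𝒮 h` with `h` reproduces each coefficient
  -- once more and yields a sum of squares.
  have hsq : ∀ θ, ⟪h, T (jet μ (f θ))⟫_ℝ = ∑ j, a j θ ^ 2 := fun θ => by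
    rw [hZ, map_sum, inner_sum]
    refine Finset.sum_congr rfl fun j _ => ?_
    rw [map_smul, inner_smul_right, pow_two]
  have hzero : ∫ θ, ∑ j, a j θ ^ 2 ∂ν = 0 := by
    simp_rw [← hsq]
    rw [integral_inner (T.integrable_comp hZint) h, ← hopS, hS, inner_zero_right]
  have hsqint : Integrable (fun θ => ∑ j, a j θ ^ 2) ν := by
    simp_rw [← hsq]
    exact (T.integrable_comp hZint).const_inner h
  rw [integral_eq_zero_iff_of_nonneg (fun θ => Finset.sum_nonneg fun j _ => sq_nonneg _)
    hsqint] at hzero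
  -- The direction `c` suffices: the derivative `η σ(w ⬝ x + b)` does not involve `c`, so only the
  -- law of `(w, b)` matters.
  have hae : ∀ᵐ θ ∂ν, a (.inl ()) θ = 0 := by
    filter_upwards [hzero] with θ hθ
    have := (Finset.sum_eq_zero_iff_of_nonneg fun j _ => sq_nonneg _).1 hθ (.inl ())
      (Finset.mem_univ _)
    exact pow_eq_zero_iff two_ne_zero |>.1 this
  -- full support
  set e : Euc d × ℝ → ℝ := fun p => a (.inl ()) (0, p) with he
  have hec : Continuous e := (hac _).comp (by fun_prop)
  have hae' : ∀ θ : Param d, a (.inl ()) θ = e θ.2 := fun θ => by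
    simp only [he, ha, hU]
    rfl
  -- The continuous function `e` is nonzero on an open set; if that set were nonempty it would have
  -- positive probability.
  by_contra hne
  have hne' : e (w, b) ≠ 0 := by
    intro h0
    apply hne
    rw [← h0]
    simp only [he, ha, hU]
    congr 3
    funext x
    simp [dirUnit, dirFactor, dirWeight, dirAct]
  have hopen : IsOpen {p | e p ≠ 0} := isOpen_ne_fun hec continuous_const
  have hpos := hν.full_support _ hopen ⟨(w, b), hne'⟩
  refine hpos.ne' ?_
  have : ∀ᵐ θ ∂ν, ¬ (θ : Param d).2 ∈ {p | e p ≠ 0} := by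
    filter_upwards [hae] with θ hθ
    rw [hae'] at hθ
    simpa using hθ
  simpa [ae_iff] using this

end Kernel

/-! ### Polynomials and smooth functions of one variable. -/

section OneDim

theorem contDiff_nat_of_smooth {E F : Type*} [NormedAddCommGroup E] [NormedSpace ℝ E]
    [NormedAddCommGroup F] [NormedSpace ℝ F] {f : E → F} (hf : ContDiff ℝ (⊤ : ℕ∞) f) (n : ℕ) :
    ContDiff ℝ n f := contDiff_infty.1 hf n

open Polynomial in
theorem exists_polynomial_derivative_eq (q : ℝ[X]) (c : ℝ) :
    ∃ p : ℝ[X], derivative p = q ∧ p.eval 0 = c := by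
  have key : ∃ p : ℝ[X], derivative p = q := by
    induction q using Polynomial.induction_on' with
    | add p q hp hq =>
      obtain ⟨p', rfl⟩ := hp
      obtain ⟨q', rfl⟩ := hq
      exact ⟨p' + q', derivative_add⟩
    | monomial n a =>
      refine ⟨monomial (n + 1) (a / (n + 1)), ?_⟩
      rw [derivative_monomial]
      congr 1
      push_cast
      field_simp
  obtain ⟨p, rfl⟩ := key
  exact ⟨p + C (c - p.eval 0), by simp, by simp⟩

open Polynomial in
theorem exists_polynomial_of_iteratedDeriv_eq_zero (n : ℕ) {f : ℝ → ℝ} (hf : ContDiff ℝ n f)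
    (h : ∀ x, iteratedDeriv n f x = 0) : ∃ p : ℝ[X], ∀ x, f x = p.eval x := by
  induction n generalizing f with
  | zero => exact ⟨0, fun x => by simpa using h x⟩
  | succ n ih =>
    have hf' : ContDiff ℝ (n : WithTop ℕ∞) (deriv f) :=
      (contDiff_succ_iff_deriv.1 (by exact_mod_cast hf)).2.2
    obtain ⟨q, hq⟩ := ih hf' fun x => by rw [← iteratedDeriv_succ']; exact h x
    obtain ⟨p, hp, hp0⟩ := exists_polynomial_derivative_eq q (f 0)
    have hd : Differentiable ℝ f := hf.differentiable (by simp)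
    have h0 : ∀ x, deriv (fun x => f x - p.eval x) x = 0 := fun x => by
      rw [deriv_fun_sub (hd x) p.differentiableAt, Polynomial.deriv, hp, hq, sub_self]
    refine ⟨p, fun x => ?_⟩
    have := is_const_of_deriv_eq_zero (hd.sub p.differentiable) h0 x 0
    simp only [Pi.sub_apply, hp0, sub_self] at this
    linarith

/-- Otherwise `f` would be a polynomial, and a bounded polynomial is constant. -/
theorem exists_iteratedDeriv_ne_zero {f : ℝ → ℝ} (hf : ContDiff ℝ (⊤ : ℕ∞) f) {C : ℝ}
    (hC : ∀ x, |f x| ≤ C) {s t : ℝ} (hst : f s ≠ f t) (n : ℕ) :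
    ∃ x, iteratedDeriv n f x ≠ 0 := by
  by_contra! h
  obtain ⟨p, hp⟩ := exists_polynomial_of_iteratedDeriv_eq_zero n (contDiff_nat_of_smooth hf n) h
  have hb : IsBoundedUnder (· ≤ ·) atTop fun x => |p.eval x| :=
    ⟨C, eventually_map.2 (Eventually.of_forall fun x => by rw [← hp]; exact hC x)⟩
  have h0 := Polynomial.eq_C_of_degree_le_zero (p.isBoundedUnder_abs_atTop_iff.1 hb)
  apply hst
  rw [hp, hp, h0, Polynomial.eval_C, Polynomial.eval_C]

open Polynomial in
/-- Weierstrass approximation together with derivatives. -/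
theorem exists_polynomial_iteratedDeriv_near (n : ℕ) {g : ℝ → ℝ} (hg : ContDiff ℝ n g) {R ε : ℝ}
    (hR : 0 ≤ R) (hε : 0 < ε) : ∃ p : ℝ[X], ∀ k ≤ n, ∀ x ∈ Set.Icc (-R) R,
      |iteratedDeriv k (fun x => g x - p.eval x) x| ≤ ε := by
  induction n generalizing g ε with
  | zero =>
    obtain ⟨p, hp⟩ := exists_polynomial_near_of_continuousOn (-R) R g
      hg.continuous.continuousOn ε hε
    refine ⟨p, fun k hk x hx => ?_⟩
    obtain rfl : k = 0 := by omega
    rw [iteratedDeriv_zero, abs_sub_comm]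
    exact (hp x hx).le
  | succ n ih =>
    have hg' : ContDiff ℝ (n : WithTop ℕ∞) (deriv g) :=
      (contDiff_succ_iff_deriv.1 (by exact_mod_cast hg)).2.2
    -- The derivative is approximated and the approximation integrated from `0`, which costs a
    -- factor `|x| ≤ R`; `R + 1` avoids division by zero.
    obtain ⟨q, hq⟩ := ih hg' (ε := ε / (R + 1)) (by positivity)
    obtain ⟨p, hp, hp0⟩ := exists_polynomial_derivative_eq q (g 0)
    have hd : Differentiable ℝ g := hg.differentiable (by simp)
    have hder : deriv (fun x => g x - p.eval x) = fun x => deriv g x - q.eval x := by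
      funext x
      rw [deriv_fun_sub (hd x) p.differentiableAt, Polynomial.deriv, hp]
    have hle : ε / (R + 1) ≤ ε := div_le_self hε.le (by linarith)
    refine ⟨p, fun k hk x hx => ?_⟩
    rcases k with _ | k
    · rw [iteratedDeriv_zero]
      have h1 := (convex_Icc (-R) R).norm_image_sub_le_of_norm_deriv_le
        (f := fun x => g x - p.eval x) (x := 0) (y := x) (C := ε / (R + 1))
        (fun y _ => (hd y).sub p.differentiableAt) (fun y hy => by
          rw [hder]
          have := hq 0 (Nat.zero_le _) y hy
          rwa [iteratedDeriv_zero] at this) ⟨by linarith, hR⟩ hx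
      rw [hp0, sub_self, sub_zero, sub_zero] at h1
      refine h1.trans ?_
      have hx' : ‖x‖ ≤ R := abs_le.2 hx
      calc ε / (R + 1) * ‖x‖ ≤ ε / (R + 1) * (R + 1) := by gcongr; linarith
        _ = ε := by field_simp
    · rw [iteratedDeriv_succ', hder]
      exact (hq k (by omega) x hx).trans hle

end OneDim

/-! ### From one activation to all profiles of class `C²`. -/

section Universal

variable {d : ℕ} {Ω : TopologicalSpace.Opens (Euc d)} {μ : Measure (Euc d)}

theorem contDiff_ridge {n : WithTop ℕ∞} {ζ : Euc d → ℝ} (hζ : ContDiff ℝ n ζ) {τ : ℝ → ℝ}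
    (hτ : ContDiff ℝ n τ) (w : Euc d) (b : ℝ) :
    ContDiff ℝ n fun x => ζ x * τ (⟪w, x⟫_ℝ + b) :=
  hζ.mul (hτ.comp ((contDiff_const.inner ℝ contDiff_id).add contDiff_const))

/-- The kernel of `l` is stable under superposition. The Bochner integral of the jets is the jet of
the pointwise integral because both lie in `sobH` and have the same entry of order zero. -/
theorem functional_integral_eq_zero (h : IsComparable (Ω : Set (Euc d)) μ)
    (hΩ : Bornology.IsBounded (Ω : Set (Euc d))) (l : SobE μ →L[ℝ] ℝ)
    {X : Type*} [MeasurableSpace X] {m : Measure X} [SFinite m] {f : X → Euc d → ℝ}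
    (hfm : AEStronglyMeasurable (Function.uncurry f) (m.prod μ)) (hf : ∀ t, ContDiff ℝ 2 (f t))
    (hint : Integrable (fun t => jet μ (f t)) m) (hl : ∀ t, l (jet μ (f t)) = 0)
    {g : Euc d → ℝ} (hg : ContDiff ℝ 2 g) (hfg : ∀ x, g x = ∫ t, f t x ∂m) :
    l (jet μ g) = 0 := by
  have := h.finite
  have e : ∫ t, jet μ (f t) ∂m = jet μ g := by
    refine jet_congr h hΩ (integral_mem_sobH h (fun t => jet_mem h hΩ (hf t)) hint) hg ?_
    rw [integral_sobE_apply hint]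
    simp_rw [jet_zero]
    have e1 : g = fun x => ∫ t, f t x ∂m := funext hfg
    rw [e1, toL2_integral hfm (fun t => h.memLp_of_continuousOn hΩ (hf t).continuous 2)]
    simpa only [SobE.proj_apply, jet_zero] using (SobE.proj (MIdx.zero d)).integrable_comp hint
  rw [← e, ← l.integral_comp_comm hint]
  simp [hl]

-- A convolution with `σ` is a superposition of shifts of the bias `b`.
open scoped Convolution in
theorem functional_ridge_convolution_eq_zero (h : IsComparable (Ω : Set (Euc d)) μ)
    (hΩ : Bornology.IsBounded (Ω : Set (Euc d))) (l : SobE μ →L[ℝ] ℝ) {ζ : Euc d → ℝ}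
    (hζ : ContDiff ℝ 2 ζ) {σ : ℝ → ℝ} (hσ : ContDiff ℝ 2 σ)
    (hl : ∀ w b, l (jet μ fun x => ζ x * σ (⟪w, x⟫_ℝ + b)) = 0) {φ : ℝ → ℝ}
    (hφ : ContDiff ℝ (⊤ : ℕ∞) φ) (hφc : HasCompactSupport φ) (w : Euc d) (b : ℝ) :
    l (jet μ fun x => ζ x * (φ ⋆[ContinuousLinearMap.lsmul ℝ ℝ, volume] σ) (⟪w, x⟫_ℝ + b)) = 0 := by
  have hτ : ContDiff ℝ 2 (φ ⋆[ContinuousLinearMap.lsmul ℝ ℝ, volume] σ) :=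
    hφc.contDiff_convolution_left (n := 2) _ (contDiff_nat_of_smooth hφ 2)
      hσ.continuous.locallyIntegrable
  have hr : ∀ t, ContDiff ℝ 2 fun x : Euc d => ζ x * σ (⟪w, x⟫_ℝ + (b - t)) := fun t =>
    contDiff_ridge hζ hσ w _
  have hF : ContDiff ℝ 2 fun z : ℝ × Euc d => ζ z.2 * σ (⟪w, z.2⟫_ℝ + (b - z.1)) :=
    (hζ.comp contDiff_snd).mul (hσ.comp ((contDiff_const.inner ℝ contDiff_snd).add
      (contDiff_const.sub contDiff_fst)))
  refine functional_integral_eq_zero h hΩ l (m := volume)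
    (f := fun t x => φ t * (ζ x * σ (⟪w, x⟫_ℝ + (b - t)))) ?_
    (fun t => contDiff_const.mul (hr t)) ?_ (fun t => ?_) (contDiff_ridge hζ hτ w b) fun x => ?_
  · refine Continuous.aestronglyMeasurable ?_
    exact (hφ.continuous.comp continuous_fst).mul hF.continuous
  · simp_rw [jet_const_mul h hΩ _ (hr _)]
    exact (hφ.continuous.smul (continuous_jet_param h hΩ hF)).integrable_of_hasCompactSupport
      hφc.smul_right
  · rw [jet_const_mul h hΩ _ (hr t), map_smul, hl, smul_zero]
  · rw [convolution_def, ← integral_const_mul]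
    refine integral_congr_ae (ae_of_all _ fun t => ?_)
    simp only [ContinuousLinearMap.lsmul_apply, smul_eq_mul, add_sub_assoc]
    ring

/-- Differentiation in the scale `t` of `w` produces one factor `⟪w, x⟫` each time. At `t = 0` the
activation becomes the number `iteratedDeriv n τ b`, and the monomial `⟪w, x⟫ ^ n` is isolated. -/
theorem functional_ridge_iteratedDeriv_eq_zero (h : IsComparable (Ω : Set (Euc d)) μ)
    (hΩ : Bornology.IsBounded (Ω : Set (Euc d))) (l : SobE μ →L[ℝ] ℝ) {ζ : Euc d → ℝ}
    (hζ : ContDiff ℝ 3 ζ) {τ : ℝ → ℝ} (hτ : ContDiff ℝ (⊤ : ℕ∞) τ)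
    (hl : ∀ w b, l (jet μ fun x => ζ x * τ (⟪w, x⟫_ℝ + b)) = 0) (w : Euc d) (n : ℕ) :
    ∀ t b : ℝ, l (jet μ fun x => ζ x * ⟪w, x⟫_ℝ ^ n *
      iteratedDeriv n τ (t * ⟪w, x⟫_ℝ + b)) = 0 := by
  induction n with
  | zero =>
    intro t b
    have := hl (t • w) b
    simp only [pow_zero, mul_one, iteratedDeriv_zero]
    simpa only [inner_smul_left, conj_trivial] using this
  | succ n ih =>
    intro t b
    have hin : ∀ {P : Type} [NormedAddCommGroup P] [NormedSpace ℝ P],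
        ContDiff ℝ 3 fun z : P × Euc d => ⟪w, z.2⟫_ℝ := contDiff_const.inner ℝ contDiff_snd
    have hτn : ContDiff ℝ (⊤ : ℕ∞) (iteratedDeriv n τ) := by
      rw [iteratedDeriv_eq_iterate]; exact hτ.iterate_deriv n
    have hτ3 : ContDiff ℝ 3 (iteratedDeriv n τ) := contDiff_nat_of_smooth hτn 3
    let F : ℝ × Euc d → ℝ := fun z => ζ z.2 * ⟪w, z.2⟫_ℝ ^ n *
      iteratedDeriv n τ (z.1 * ⟪w, z.2⟫_ℝ + b)
    have hF : ContDiff ℝ 3 F := ((hζ.comp contDiff_snd).mul (hin.pow n)).mul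
      (hτ3.comp ((contDiff_fst.mul hin).add contDiff_const))
    obtain ⟨L, hL, hL'⟩ := exists_hasFDerivAt_jet h hΩ hF t
    have h1 : HasFDerivAt (fun t => l (jet μ fun x => F (t, x))) (l ∘L L) t :=
      l.hasFDerivAt.comp t hL
    have h2 : (fun t => l (jet μ fun x => F (t, x))) = fun _ => 0 := funext fun t => ih t b
    rw [h2] at h1
    have h3 : l ∘L L = 0 := h1.unique (hasFDerivAt_const 0 t)
    have h4 : l (L 1) = 0 := congrArg (fun M : ℝ →L[ℝ] ℝ => M 1) h3
    rw [hL'] at h4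
    rw [← h4]
    congr 2
    funext x
    have hFd : HasFDerivAt F (fderiv ℝ F (t, x)) (t, x) :=
      (hF.differentiable (by norm_num) (t, x)).hasFDerivAt
    have h5 : HasDerivAt (fun s : ℝ => F (s, x)) (fderiv ℝ F (t, x) (1, 0)) t :=
      HasFDerivAt.comp_hasDerivAt (f := fun s : ℝ => (s, x)) t hFd
        ((hasDerivAt_id t).prodMk (hasDerivAt_const t x))
    have h6 : HasDerivAt (fun s : ℝ => F (s, x)) (ζ x * ⟪w, x⟫_ℝ ^ n *
        (iteratedDeriv (n + 1) τ (t * ⟪w, x⟫_ℝ + b) * (1 * ⟪w, x⟫_ℝ))) t := by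
      refine HasDerivAt.const_mul (d := fun s => iteratedDeriv n τ (s * ⟪w, x⟫_ℝ + b))
        (ζ x * ⟪w, x⟫_ℝ ^ n) ?_
      have hd : HasDerivAt (iteratedDeriv n τ) (iteratedDeriv (n + 1) τ (t * ⟪w, x⟫_ℝ + b))
          (t * ⟪w, x⟫_ℝ + b) := by
        rw [iteratedDeriv_succ]
        exact (hτn.differentiable (by simp) _).hasDerivAt
      exact hd.comp t (((hasDerivAt_id t).mul_const _).add_const b)
    rw [h5.unique h6]
    ring

theorem functional_ridge_polynomial_eq_zero (h : IsComparable (Ω : Set (Euc d)) μ)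
    (hΩ : Bornology.IsBounded (Ω : Set (Euc d))) (l : SobE μ →L[ℝ] ℝ) {ζ : Euc d → ℝ}
    (hζ : ContDiff ℝ 3 ζ) {τ : ℝ → ℝ} (hτ : ContDiff ℝ (⊤ : ℕ∞) τ)
    (hl : ∀ w b, l (jet μ fun x => ζ x * τ (⟪w, x⟫_ℝ + b)) = 0)
    (hτ0 : ∀ n, ∃ b, iteratedDeriv n τ b ≠ 0) (w : Euc d) (p : Polynomial ℝ) :
    l (jet μ fun x => ζ x * p.eval ⟪w, x⟫_ℝ) = 0 := by
  have hζ2 : ContDiff ℝ 2 ζ := hζ.of_le (by norm_num)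
  have hin : ContDiff ℝ 2 fun x : Euc d => ⟪w, x⟫_ℝ := contDiff_const.inner ℝ contDiff_id
  have hmon : ∀ n : ℕ, ContDiff ℝ 2 fun x => ζ x * ⟪w, x⟫_ℝ ^ n := fun n => hζ2.mul (hin.pow n)
  have h1 : ∀ n : ℕ, l (jet μ fun x => ζ x * ⟪w, x⟫_ℝ ^ n) = 0 := fun n => by
    obtain ⟨b, hb⟩ := hτ0 n
    have := functional_ridge_iteratedDeriv_eq_zero h hΩ l hζ hτ hl w n 0 b
    simp only [zero_mul, zero_add] at this
    simp_rw [mul_comm (_ * _) (iteratedDeriv n τ b)] at this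
    rw [jet_const_mul h hΩ _ (hmon n), map_smul, smul_eq_mul] at this
    exact (mul_eq_zero.1 this).resolve_left hb
  have e : (fun x => ζ x * p.eval ⟪w, x⟫_ℝ) = fun x =>
      ∑ i ∈ Finset.range (p.natDegree + 1), p.coeff i * (ζ x * ⟪w, x⟫_ℝ ^ i) := by
    funext x
    rw [Polynomial.eval_eq_sum_range, Finset.mul_sum]
    exact Finset.sum_congr rfl fun i _ => by ring
  rw [e, jet_sum h hΩ _ fun i => contDiff_const.mul (hmon i), map_sum]
  refine Finset.sum_eq_zero fun i _ => ?_
  rw [jet_const_mul h hΩ _ (hmon i), map_smul, h1, smul_zero]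

/-- On bounded `Ω` the argument `⟪w, x⟫` stays in a compact interval, and the jet is controlled by
the `C²` norm of the profile there; Weierstrass approximation with two derivatives applies. -/
theorem functional_ridge_eq_zero_of_polynomial (h : IsComparable (Ω : Set (Euc d)) μ)
    (hΩ : Bornology.IsBounded (Ω : Set (Euc d))) (l : SobE μ →L[ℝ] ℝ) {ζ : Euc d → ℝ}
    (hζ : ContDiff ℝ 2 ζ) (w : Euc d)
    (hl : ∀ p : Polynomial ℝ, l (jet μ fun x => ζ x * p.eval ⟪w, x⟫_ℝ) = 0)
    {g : ℝ → ℝ} (hg : ContDiff ℝ 2 g) : l (jet μ fun x => ζ x * g ⟪w, x⟫_ℝ) = 0 := by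
  obtain ⟨C, hC, hb⟩ := exists_norm_jet_ridge_le h hΩ hζ
  obtain ⟨R, hR⟩ := hΩ.exists_norm_le
  set K := ‖l‖ * (C * (1 + ‖w‖) ^ 2) with hK
  have hK0 : 0 ≤ K := by positivity
  have key : ∀ ε > 0, |l (jet μ fun x => ζ x * g ⟪w, x⟫_ℝ)| ≤ K * ε := fun ε hε => by
    obtain ⟨p, hp⟩ := exists_polynomial_iteratedDeriv_near 2 (by exact_mod_cast hg)
      (R := ‖w‖ * |R|) (by positivity) hε
    have hpc : ContDiff ℝ 2 fun s => p.eval s := by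
      simpa [Polynomial.coe_aeval_eq_eval] using p.contDiff_aeval (𝕜 := ℝ) 2
    have hd : ContDiff ℝ 2 fun s => g s - p.eval s := hg.sub hpc
    have hin : ContDiff ℝ 2 fun x : Euc d => ⟪w, x⟫_ℝ := contDiff_const.inner ℝ contDiff_id
    have e : (fun x => ζ x * g ⟪w, x⟫_ℝ) = fun x => ζ x * (g (⟪w, x⟫_ℝ + 0) - p.eval (⟪w, x⟫_ℝ + 0))
        + ζ x * p.eval ⟪w, x⟫_ℝ := by
      funext x; rw [add_zero]; ring
    have hpc1 : ContDiff ℝ 2 fun x => ζ x * p.eval ⟪w, x⟫_ℝ := hζ.mul (hpc.comp hin)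
    have hc1 := contDiff_ridge hζ hd w 0
    rw [e, jet_add h hΩ hc1 hpc1, map_add, hl, add_zero]
    refine (l.le_opNorm _).trans ?_
    rw [hK, mul_assoc]
    gcongr
    refine (hb (fun s => g s - p.eval s) w 0 ε hd hε.le fun x hx k hk => ?_).trans_eq (by ring)
    rw [norm_iteratedFDeriv_eq_norm_iteratedDeriv, add_zero]
    refine hp k hk _ (abs_le.1 ((abs_real_inner_le_norm _ _).trans ?_))
    gcongr
    exact (hR x hx).trans (le_abs_self R)
  by_contra hne
  have hpos : 0 < |l (jet μ fun x => ζ x * g ⟪w, x⟫_ℝ)| := abs_pos.2 hne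
  have := key (|l (jet μ fun x => ζ x * g ⟪w, x⟫_ℝ)| / (2 * (K + 1))) (by positivity)
  rw [mul_div_assoc', le_div_iff₀ (by positivity)] at this
  nlinarith

end Universal

/-! ### From ridge functions to all test functions by Fourier inversion. -/

section Fourier

variable {d : ℕ} {Ω : TopologicalSpace.Opens (Euc d)} {μ : Measure (Euc d)}

-- The activation is first mollified to gain infinitely many derivatives. A fine enough
-- mollification still separates two points at which `σ` differs, and it keeps the bound `C`, so
-- none of its derivatives vanishes identically.
open scoped Convolution in
theorem functional_ridge_eq_zero (h : IsComparable (Ω : Set (Euc d)) μ)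
    (hΩ : Bornology.IsBounded (Ω : Set (Euc d))) (l : SobE μ →L[ℝ] ℝ) {ζ : Euc d → ℝ}
    (hζ : ContDiff ℝ 3 ζ) {σ : ℝ → ℝ} (hσ : ContDiff ℝ 2 σ) {C : ℝ} (hσC : ∀ x, |σ x| ≤ C)
    (hσ' : ¬ ∃ s : ℝ, ∀ x, σ x = s)
    (hl : ∀ w b, l (jet μ fun x => ζ x * σ (⟪w, x⟫_ℝ + b)) = 0) (w : Euc d)
    {g : ℝ → ℝ} (hg : ContDiff ℝ 2 g) : l (jet μ fun x => ζ x * g ⟪w, x⟫_ℝ) = 0 := by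
  have hζ2 : ContDiff ℝ 2 ζ := hζ.of_le (by norm_num)
  obtain ⟨s, hs⟩ : ∃ s, σ s ≠ σ 0 := by
    by_contra! H
    exact hσ' ⟨σ 0, H⟩
  let φ : ℕ → ContDiffBump (0 : ℝ) := fun n =>
    ⟨1 / (2 * (n + 1)), 1 / (n + 1), by positivity, by
      rw [div_lt_div_iff₀ (by positivity) (by positivity)]
      nlinarith [(Nat.cast_nonneg n : (0 : ℝ) ≤ n)]⟩
  have hφ : Tendsto (fun n => (φ n).rOut) atTop (𝓝 0) := tendsto_one_div_add_atTop_nhds_zero_nat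
  let τ : ℕ → ℝ → ℝ := fun n => (φ n).normed volume ⋆[ContinuousLinearMap.lsmul ℝ ℝ, volume] σ
  have hlim : ∀ x, Tendsto (fun n => τ n x) atTop (𝓝 (σ x)) := fun x =>
    ContDiffBump.convolution_tendsto_right_of_continuous hφ hσ.continuous x
  obtain ⟨n, hn⟩ := ((hlim s).sub (hlim 0)).eventually_ne (sub_ne_zero.2 hs) |>.exists
  have hsm : ContDiff ℝ (⊤ : ℕ∞) ((φ n).normed volume) := (φ n).contDiff_normed
  have hcs : HasCompactSupport ((φ n).normed volume) := (φ n).hasCompactSupport_normed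
  have hτ : ContDiff ℝ (⊤ : ℕ∞) (τ n) :=
    hcs.contDiff_convolution_left _ hsm hσ.continuous.locallyIntegrable
  have hτC : ∀ x, |τ n x| ≤ C := fun x => by
    have h1 : ‖τ n x‖ ≤ ∫ t, C * (φ n).normed volume t := by
      refine norm_integral_le_of_norm_le ((φ n).integrable_normed.const_mul C)
        (ae_of_all _ fun t => ?_)
      rw [ContinuousLinearMap.lsmul_apply, smul_eq_mul, norm_mul, mul_comm,
        Real.norm_of_nonneg ((φ n).nonneg_normed t)]
      exact mul_le_mul_of_nonneg_right (hσC _) ((φ n).nonneg_normed t)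
    rwa [integral_const_mul, (φ n).integral_normed, mul_one] at h1
  refine functional_ridge_eq_zero_of_polynomial h hΩ l hζ2 w (fun p => ?_) hg
  exact functional_ridge_polynomial_eq_zero h hΩ l hζ hτ
    (functional_ridge_convolution_eq_zero h hΩ l hζ2 hσ hl hsm hcs)
    (exists_iteratedDeriv_ne_zero hτ hτC (sub_ne_zero.1 hn)) w p

/-- Differentiation only permutes the two coefficients, up to sign. -/
theorem norm_iteratedFDeriv_trig_le (a b s : ℝ) {k : ℕ} (hk : k ≤ 2) :
    ‖iteratedFDeriv ℝ k (fun s => a * Real.cos s - b * Real.sin s) s‖ ≤ |a| + |b| := by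
  rw [norm_iteratedFDeriv_eq_norm_iteratedDeriv]
  have key : ∀ p q c e : ℝ, |c| ≤ 1 → |e| ≤ 1 → |p * c + q * e| ≤ |p| + |q| := fun p q c e hc he => by
    refine (abs_add_le _ _).trans ?_
    rw [abs_mul, abs_mul]
    nlinarith [abs_nonneg p, abs_nonneg q]
  have hd : ∀ p q : ℝ, deriv (fun s => p * Real.cos s - q * Real.sin s) =
      fun s => (-q) * Real.cos s - p * Real.sin s := fun p q => by
    funext s
    have := ((Real.hasDerivAt_cos s).const_mul p).sub ((Real.hasDerivAt_sin s).const_mul q)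
    rw [HasDerivAt.deriv (f := fun s => p * Real.cos s - q * Real.sin s) this]
    ring
  have h0 : ∀ p q : ℝ, |p * Real.cos s - q * Real.sin s| ≤ |p| + |q| := fun p q => by
    have := key p (-q) _ _ (Real.abs_cos_le_one s) (Real.abs_sin_le_one s)
    rw [abs_neg] at this
    rwa [neg_mul, ← sub_eq_add_neg] at this
  interval_cases k
  · exact h0 a b
  · rw [iteratedDeriv_one, hd]
    refine (h0 _ _).trans_eq ?_
    rw [abs_neg, add_comm]
  · rw [iteratedDeriv_succ', iteratedDeriv_one, hd, hd]
    refine (h0 _ _).trans_eq ?_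
    rw [abs_neg, abs_neg]

-- The real part of Fourier inversion: each frequency contributes a ridge function in the direction
-- `2πξ` with a trigonometric profile.
open scoped FourierTransform in
theorem exists_fourier_representation {f : Euc d → ℝ} (hf : ContDiff ℝ (⊤ : ℕ∞) f)
    (hfc : HasCompactSupport f) : ∃ G : SchwartzMap (Euc d) ℂ, ∀ x, f x =
      ∫ ξ, ((G ξ).re * Real.cos ⟪(2 * Real.pi) • ξ, x⟫_ℝ -
        (G ξ).im * Real.sin ⟪(2 * Real.pi) • ξ, x⟫_ℝ) := by
  have hc : HasCompactSupport fun x => (f x : ℂ) := hfc.comp_left (g := Complex.ofReal) (by simp)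
  have hs : ContDiff ℝ (⊤ : ℕ∞) fun x => (f x : ℂ) := Complex.ofRealCLM.contDiff.comp hf
  let S : SchwartzMap (Euc d) ℂ := hc.toSchwartzMap hs
  refine ⟨𝓕 S, fun x => ?_⟩
  have h1 : 𝓕⁻ (𝓕 S) = S := FourierTransform.fourierInv_fourier_eq S
  have h2 : (𝓕⁻ (𝓕 S) : SchwartzMap (Euc d) ℂ) x = (f x : ℂ) := by rw [h1]; rfl
  rw [SchwartzMap.fourierInv_coe, Real.fourierInv_eq'] at h2
  have hint : Integrable fun ξ => Complex.exp ((↑(2 * Real.pi * ⟪ξ, x⟫_ℝ) * Complex.I)) •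
      (𝓕 S : SchwartzMap (Euc d) ℂ) ξ := by
    refine (𝓕 S : SchwartzMap (Euc d) ℂ).integrable.norm.mono' ?_ (ae_of_all _ fun ξ => ?_)
    · refine Continuous.aestronglyMeasurable ?_
      have := (𝓕 S : SchwartzMap (Euc d) ℂ).continuous
      fun_prop
    · rw [norm_smul, Complex.norm_exp_ofReal_mul_I, one_mul]
  have h3 := congrArg Complex.re h2
  rw [Complex.ofReal_re] at h3
  rw [← h3]
  have h4 := (Complex.reCLM.integral_comp_comm hint).symm
  refine h4.trans (integral_congr_ae (ae_of_all _ fun ξ => ?_))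
  simp only [Complex.reCLM_apply, smul_eq_mul, Complex.mul_re, Complex.exp_ofReal_mul_I_re,
    Complex.exp_ofReal_mul_I_im, inner_smul_left, conj_trivial]
  ring

/-- A functional on `ℋ²` that annihilates the ridge functions `ζ σ(w ⬝ x + b)` annihilates
`ζ f` for each test function `f` on `ℝ^d`. -/
theorem functional_mul_eq_zero (h : IsComparable (Ω : Set (Euc d)) μ)
    (hΩ : Bornology.IsBounded (Ω : Set (Euc d))) (l : SobE μ →L[ℝ] ℝ) {ζ : Euc d → ℝ}
    (hζ : ContDiff ℝ 3 ζ) {σ : ℝ → ℝ} (hσ : ContDiff ℝ 2 σ) {C : ℝ} (hσC : ∀ x, |σ x| ≤ C)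
    (hσ' : ¬ ∃ s : ℝ, ∀ x, σ x = s)
    (hl : ∀ w b, l (jet μ fun x => ζ x * σ (⟪w, x⟫_ℝ + b)) = 0)
    {f : Euc d → ℝ} (hf : ContDiff ℝ (⊤ : ℕ∞) f) (hfc : HasCompactSupport f) :
    l (jet μ fun x => ζ x * f x) = 0 := by
  have hζ2 : ContDiff ℝ 2 ζ := hζ.of_le (by norm_num)
  have hf2 : ContDiff ℝ 2 f := contDiff_nat_of_smooth hf 2
  obtain ⟨G, hG⟩ := exists_fourier_representation hf hfc
  obtain ⟨K, hK0, hK⟩ := exists_norm_jet_ridge_le h hΩ hζ2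
  have hGs : ContDiff ℝ 2 G := contDiff_nat_of_smooth (G.smooth ⊤) 2
  have hre : ContDiff ℝ 2 fun ξ => (G ξ).re := Complex.reCLM.contDiff.comp hGs
  have him : ContDiff ℝ 2 fun ξ => (G ξ).im := Complex.imCLM.contDiff.comp hGs
  let g : Euc d → ℝ → ℝ := fun ξ s => (G ξ).re * Real.cos s - (G ξ).im * Real.sin s
  have hg : ∀ ξ, ContDiff ℝ 2 (g ξ) := fun ξ =>
    (contDiff_const.mul Real.contDiff_cos).sub (contDiff_const.mul Real.contDiff_sin)
  have hF : ContDiff ℝ 2 fun z : Euc d × Euc d => ζ z.2 * g z.1 ⟪(2 * Real.pi) • z.1, z.2⟫_ℝ := by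
    have hin : ContDiff ℝ 2 fun z : Euc d × Euc d => ⟪(2 * Real.pi) • z.1, z.2⟫_ℝ :=
      ContDiff.inner ℝ (by fun_prop) contDiff_snd
    exact (hζ2.comp contDiff_snd).mul
      (((hre.comp contDiff_fst).mul (Real.contDiff_cos.comp hin)).sub
        ((him.comp contDiff_fst).mul (Real.contDiff_sin.comp hin)))
  have hx : ∀ ξ, ContDiff ℝ 2 fun x => ζ x * g ξ ⟪(2 * Real.pi) • ξ, x⟫_ℝ := fun ξ =>
    hF.comp (contDiff_prodMk_right ξ)
  refine functional_integral_eq_zero h hΩ l (m := volume)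
    (f := fun ξ x => ζ x * g ξ ⟪(2 * Real.pi) • ξ, x⟫_ℝ) hF.continuous.aestronglyMeasurable hx
    ?_ (fun ξ => functional_ridge_eq_zero h hΩ l hζ hσ hσC hσ' hl _ (hg ξ)) (hζ2.mul hf2)
    fun x => ?_
  -- The jet at frequency `ξ` grows like `(1 + 2π‖ξ‖)²` times `‖G ξ‖`, which the Schwartz decay of
  -- `G` makes integrable.
  · have hb : Integrable fun ξ : Euc d => K * 2 * (2 * (‖ξ‖ ^ 0 * ‖G ξ‖) +
        2 * (2 * Real.pi) ^ 2 * (‖ξ‖ ^ 2 * ‖G ξ‖)) :=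
      (((G.integrable_pow_mul volume 0).const_mul _).add
        ((G.integrable_pow_mul volume 2).const_mul _)).const_mul _
    refine hb.mono' (continuous_jet_param h hΩ hF).aestronglyMeasurable (ae_of_all _ fun ξ => ?_)
    have h1 := hK (g ξ) ((2 * Real.pi) • ξ) 0 (|(G ξ).re| + |(G ξ).im|) (hg ξ) (by positivity)
      fun x _ k hk => norm_iteratedFDeriv_trig_le _ _ _ hk
    simp only [add_zero] at h1
    refine h1.trans ?_
    have h2 := Complex.abs_re_le_norm (G ξ)
    have h3 := Complex.abs_im_le_norm (G ξ)
    rw [norm_smul, Real.norm_of_nonneg (by positivity)]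
    have h4 : (1 + 2 * Real.pi * ‖ξ‖) ^ 2 ≤ 2 + 2 * (2 * Real.pi) ^ 2 * ‖ξ‖ ^ 2 := by
      nlinarith [sq_nonneg (1 - 2 * Real.pi * ‖ξ‖)]
    calc K * (|(G ξ).re| + |(G ξ).im|) * (1 + 2 * Real.pi * ‖ξ‖) ^ 2
        ≤ K * (2 * ‖G ξ‖) * (2 + 2 * (2 * Real.pi) ^ 2 * ‖ξ‖ ^ 2) := by
          gcongr; linarith
      _ = _ := by ring
  · rw [hG x, ← integral_const_mul]

end Fourier

/-! ### Mollification in `L²`. -/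

section Mollifier

variable {d : ℕ}

/-- A mollifying kernel: smooth, of compact support, nonnegative and of integral one. -/
structure IsKernel (φ : Euc d → ℝ) : Prop where
  smooth : ContDiff ℝ (⊤ : ℕ∞) φ
  compact : HasCompactSupport φ
  nonneg : ∀ x, 0 ≤ φ x
  integral : ∫ x, φ x = 1

/-- The centre `y` need not be the origin: near the boundary the kernels have to be displaced. -/
theorem exists_isKernel (y : Euc d) {ρ : ℝ} (hρ : 0 < ρ) :
    ∃ φ : Euc d → ℝ, IsKernel φ ∧ Function.support φ = Metric.ball y ρ := by
  let b : ContDiffBump y := ⟨ρ / 2, ρ, by positivity, by linarith⟩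
  exact ⟨b.normed volume, ⟨b.contDiff_normed, b.hasCompactSupport_normed, b.nonneg_normed,
    b.integral_normed⟩, b.support_normed_eq⟩

open scoped Convolution in
/-- The mollification `Q * φ`. -/
def moll (φ Q : Euc d → ℝ) : Euc d → ℝ := Q ⋆[ContinuousLinearMap.mul ℝ ℝ, volume] φ

theorem moll_apply (φ Q : Euc d → ℝ) (x : Euc d) : moll φ Q x = ∫ t, Q t * φ (x - t) := rfl

theorem moll_apply' (φ Q : Euc d → ℝ) (x : Euc d) : moll φ Q x = ∫ t, φ t * Q (x - t) := by
  rw [moll_apply, ← integral_sub_left_eq_self _ _ x]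
  simp [mul_comm]

theorem contDiff_moll {φ Q : Euc d → ℝ} (hφ : ContDiff ℝ (⊤ : ℕ∞) φ) (hφc : HasCompactSupport φ)
    (hQ : LocallyIntegrable Q) : ContDiff ℝ (⊤ : ℕ∞) (moll φ Q) :=
  hφc.contDiff_convolution_right _ hQ hφ

theorem pd_moll {φ Q : Euc d → ℝ} (hφ : ContDiff ℝ 1 φ) (hφc : HasCompactSupport φ)
    (hQ : LocallyIntegrable Q) (k : Fin d) (x : Euc d) :
    pd k (moll φ Q) x = moll (pd k φ) Q x := by
  have h1 := hφc.hasFDerivAt_convolution_right (ContinuousLinearMap.mul ℝ ℝ) hQ hφ x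
  rw [pd, moll, h1.fderiv, convolution_precompR_apply _ hQ (hφc.fderiv ℝ)
    (hφ.continuous_fderiv one_ne_zero)]
  rfl

/-- Integration by parts against translates of a kernel moves a derivative of the mollification
to the mollified function. -/
theorem pd_moll_eq {φ Q Q' : Euc d → ℝ} (hφ : ContDiff ℝ 1 φ) (hφc : HasCompactSupport φ)
    (hQ : LocallyIntegrable Q) (k : Fin d) (x : Euc d)
    (h : ∫ t, Q t * pd k (fun t => φ (x - t)) t = - ∫ t, Q' t * φ (x - t)) :
    pd k (moll φ Q) x = moll φ Q' x := by
  have e : ∀ t, pd k (fun t => φ (x - t)) t = - pd k φ (x - t) := fun t => by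
    have h1 : HasFDerivAt (fun t : Euc d => x - t) (-(ContinuousLinearMap.id ℝ (Euc d))) t :=
      (hasFDerivAt_id t).const_sub x
    have h2 := ((hφ.differentiable one_ne_zero (x - t)).hasFDerivAt).comp t h1
    rw [pd, show (fun t => φ (x - t)) = φ ∘ fun t => x - t from rfl, h2.fderiv]
    simp [pd]
  rw [pd_moll hφ hφc hQ, moll_apply, moll_apply]
  simp_rw [e, mul_neg] at h
  rw [integral_neg] at h
  linarith

theorem moll_eq_zero {φ Q : Euc d → ℝ} {x : Euc d} (h : ∀ t, φ t ≠ 0 → Q (x - t) = 0) :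
    moll φ Q x = 0 := by
  rw [moll_apply']
  refine integral_eq_zero_of_ae (ae_of_all _ fun t => ?_)
  by_cases ht : φ t = 0
  · simp [ht]
  · simp [h t ht]

/-- Translation on `L²`. -/
def translate (Q : Euc d → ℝ) (t : Euc d) : L2 (volume : Measure (Euc d)) :=
  toL2 volume fun x => Q (x - t)

theorem memLp_translate {Q : Euc d → ℝ} (hQ : MemLp Q 2) (t : Euc d) :
    MemLp (fun x => Q (x - t)) 2 :=
  hQ.comp_measurePreserving (measurePreserving_sub_right volume t)

theorem translate_eq {Q : Euc d → ℝ} (hQ : MemLp Q 2) (t : Euc d) : translate Q t =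
    Lp.compMeasurePreserving (fun x => x - t) (measurePreserving_sub_right volume t)
      (toL2 volume Q) := by
  rw [translate, toL2_of_memLp (memLp_translate hQ t), toL2_of_memLp hQ,
    Lp.toLp_compMeasurePreserving]
  rfl

theorem continuous_translate {Q : Euc d → ℝ} (hQ : MemLp Q 2) : Continuous (translate Q) := by
  let g : C(Euc d, C(Euc d, Euc d)) :=
    (ContinuousMap.mk (fun p : Euc d × Euc d => p.2 - p.1) (by fun_prop)).curry
  have := Continuous.compMeasurePreservingLp (μ := (volume : Measure (Euc d)))
    (ν := (volume : Measure (Euc d))) (f := fun _ : Euc d => toL2 volume Q) (g := g)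
    continuous_const g.continuous (fun t => measurePreserving_sub_right volume t)
    (by norm_num)
  refine this.congr fun t => ?_
  rw [translate_eq hQ]
  rfl

theorem norm_translate {Q : Euc d → ℝ} (hQ : MemLp Q 2) (t : Euc d) :
    ‖translate Q t‖ = ‖toL2 volume Q‖ := by
  rw [translate_eq hQ, Lp.norm_compMeasurePreserving]

theorem translate_zero (Q : Euc d → ℝ) : translate Q 0 = toL2 volume Q := by
  simp [translate]

theorem integrable_smul_translate {φ Q : Euc d → ℝ} (hφ : IsKernel φ) (hQ : MemLp Q 2) :
    Integrable fun t => φ t • translate Q t :=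
  (hφ.smooth.continuous.smul (continuous_translate hQ)).integrable_of_hasCompactSupport
    hφ.compact.smul_right

/-- As an `L²`-valued average of translates, a mollification inherits bounds from the isometry of
translations and convergence from their continuity. -/
theorem coeFn_integral_translate {φ Q : Euc d → ℝ} (hφ : IsKernel φ) (hQ : MemLp Q 2) :
    ((∫ t, φ t • translate Q t : L2 (volume : Measure (Euc d))) : Euc d → ℝ) =ᵐ[volume]
      moll φ Q := by
  have e : ∀ t, φ t • translate Q t = toL2 volume fun x => φ t * Q (x - t) := fun t =>
    (toL2_const_mul _ (memLp_translate hQ t)).symm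
  simp_rw [e]
  refine (coeFn_integral_toL2 ?_ (fun t => (memLp_translate hQ t).const_mul _) ?_).trans
    (ae_of_all _ fun x => (moll_apply' φ Q x).symm)
  · have h1 := AEStronglyMeasurable.convolution_integrand' (ContinuousLinearMap.mul ℝ ℝ)
      (μ := (volume : Measure (Euc d))) (ν := (volume : Measure (Euc d)))
      hφ.smooth.continuous.aestronglyMeasurable
      (hQ.1.mono_ac (quasiMeasurePreserving_sub_of_right_invariant volume volume).absolutelyContinuous)
    exact h1.prod_swap
  · simp_rw [← e]
    exact integrable_smul_translate hφ hQ

theorem memLp_moll {φ Q : Euc d → ℝ} (hφ : IsKernel φ) (hQ : MemLp Q 2) : MemLp (moll φ Q) 2 :=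
  (Lp.memLp _).ae_eq (coeFn_integral_translate hφ hQ)

theorem toL2_moll {φ Q : Euc d → ℝ} (hφ : IsKernel φ) (hQ : MemLp Q 2) :
    toL2 volume (moll φ Q) = ∫ t, φ t • translate Q t := by
  rw [← toL2_congr (coeFn_integral_translate hφ hQ), toL2_coeFn]

theorem IsKernel.integrable {φ : Euc d → ℝ} (hφ : IsKernel φ) : Integrable φ :=
  hφ.smooth.continuous.integrable_of_hasCompactSupport hφ.compact

theorem norm_toL2_moll_le {φ Q : Euc d → ℝ} (hφ : IsKernel φ) (hQ : MemLp Q 2) :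
    ‖toL2 volume (moll φ Q)‖ ≤ ‖toL2 volume Q‖ := by
  rw [toL2_moll hφ hQ]
  refine (norm_integral_le_of_norm_le (g := fun t => φ t * ‖toL2 volume Q‖)
    (hφ.integrable.mul_const _) (ae_of_all _ fun t => ?_)).trans_eq ?_
  · rw [norm_smul, norm_translate hQ, Real.norm_of_nonneg (hφ.nonneg t)]
  · rw [integral_mul_const, hφ.integral, one_mul]

theorem norm_toL2_moll_sub_le {φ Q : Euc d → ℝ} (hφ : IsKernel φ) (hQ : MemLp Q 2) {ε : ℝ}
    (h : ∀ t, φ t ≠ 0 → ‖translate Q t - toL2 volume Q‖ ≤ ε) :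
    ‖toL2 volume (moll φ Q) - toL2 volume Q‖ ≤ ε := by
  have e : toL2 volume (moll φ Q) - toL2 volume Q =
      ∫ t, φ t • (translate Q t - toL2 volume Q) := by
    simp_rw [smul_sub]
    rw [integral_sub (integrable_smul_translate hφ hQ) (hφ.integrable.smul_const _),
      integral_smul_const, hφ.integral, one_smul, toL2_moll hφ hQ]
  rw [e]
  refine (norm_integral_le_of_norm_le (g := fun t => φ t * ε)
    (hφ.integrable.mul_const _) (ae_of_all _ fun t => ?_)).trans_eq ?_
  · rw [norm_smul, Real.norm_of_nonneg (hφ.nonneg t)]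
    by_cases ht : φ t = 0
    · simp [ht]
    · exact mul_le_mul_of_nonneg_left (h t ht) (hφ.nonneg t)
  · rw [integral_mul_const, hφ.integral, one_mul]

theorem tendsto_toL2_moll {φ : ℕ → Euc d → ℝ} (hφ : ∀ n, IsKernel (φ n))
    {r : ℕ → ℝ} (hr : Tendsto r atTop (𝓝 0)) (hs : ∀ n t, φ n t ≠ 0 → ‖t‖ ≤ r n)
    {Q : Euc d → ℝ} (hQ : MemLp Q 2) :
    Tendsto (fun n => toL2 volume (moll (φ n) Q)) atTop (𝓝 (toL2 volume Q)) := by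
  rw [Metric.tendsto_atTop]
  intro ε hε
  have hc := (continuous_translate hQ).continuousAt (x := (0 : Euc d))
  obtain ⟨δ, hδ, hδ'⟩ := Metric.continuousAt_iff.1 hc (ε / 2) (by positivity)
  obtain ⟨N, hN⟩ := Metric.tendsto_atTop.1 hr δ hδ
  refine ⟨N, fun n hn => ?_⟩
  rw [dist_eq_norm]
  refine (norm_toL2_moll_sub_le (hφ n) hQ (ε := ε / 2) fun t ht => ?_).trans_lt (by linarith)
  have h1 : dist t 0 < δ := by
    rw [dist_zero_right]
    have := hN n hn
    rw [Real.dist_eq, sub_zero] at this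
    exact (hs n t ht).trans_lt ((le_abs_self _).trans_lt this)
  have := hδ' h1
  rw [translate_zero, dist_eq_norm] at this
  exact this.le

theorem integral_mul_eq_inner {f g : Euc d → ℝ} (hf : MemLp f 2) (hg : MemLp g 2) :
    ∫ x, f x * g x = ⟪toL2 volume f, toL2 volume g⟫_ℝ := by
  rw [L2.inner_def]
  refine integral_congr_ae ?_
  filter_upwards [coeFn_toL2 hf, coeFn_toL2 hg] with x h1 h2
  rw [h1, h2]
  simp [mul_comm]

end Mollifier

/-! ### Weak partial derivatives: integration by parts and the product rule. -/

section WeakPartial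

variable {d : ℕ}

/-- `g` is the weak partial derivative `∂_k f` in `Ω`. -/
def IsWeakPartial (Ω : Set (Euc d)) (k : Fin d) (f g : Euc d → ℝ) : Prop :=
  ∀ φ : Euc d → ℝ, ContDiff ℝ (⊤ : ℕ∞) φ → HasCompactSupport φ → tsupport φ ⊆ Ω →
    ∫ x, f x * pd k φ x = - ∫ x, g x * φ x

theorem isWeakPartial_pd {f : Euc d → ℝ} (hf : ContDiff ℝ 1 f) (Ω : Set (Euc d)) (k : Fin d) :
    IsWeakPartial Ω k f (pd k f) := fun _ hφ hφc _ =>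
  integral_mul_pd hf (contDiff_nat_of_smooth hφ 1) hφc k

/-- Integration by parts of a Sobolev function against a Sobolev function with compact support. -/
theorem IsWeakPartial.integral_mul_eq {Ω : Set (Euc d)} (hΩ : IsOpen Ω) {k : Fin d}
    {f f' g g' : Euc d → ℝ} (H : IsWeakPartial Ω k f f') (hf : MemLp f 2) (hf' : MemLp f' 2)
    (Hg : IsWeakPartial Set.univ k g g') (hg : MemLp g 2) (hg' : MemLp g' 2)
    {K : Set (Euc d)} (hK : IsCompact K) (hKΩ : K ⊆ Ω) (hgK : ∀ x, x ∉ K → g x = 0) :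
    ∫ x, f x * g' x = - ∫ x, f' x * g x := by
  -- Mollifying `g` at scales at most `δ` keeps its support inside `Ω`, so the mollifications are
  -- admissible test functions.
  obtain ⟨δ, hδ, hδΩ⟩ := hK.exists_cthickening_subset_open hΩ hKΩ
  choose φ hφ hφs using fun n : ℕ =>
    exists_isKernel (0 : Euc d) (ρ := δ / (n + 1)) (by positivity)
  have hr : Tendsto (fun n : ℕ => δ / ((n : ℝ) + 1)) atTop (𝓝 0) := by
    have := tendsto_one_div_add_atTop_nhds_zero_nat (𝕜 := ℝ)
    simpa [div_eq_mul_inv] using this.const_mul δ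
  have hs : ∀ n t, φ n t ≠ 0 → ‖t‖ ≤ δ / (n + 1) := fun n t ht => by
    have : t ∈ Function.support (φ n) := ht
    rw [hφs, mem_ball_zero_iff] at this
    exact this.le
  have hli : LocallyIntegrable g := hg.locallyIntegrable (by norm_num)
  have hzero : ∀ n x, x ∉ Metric.cthickening δ K → moll (φ n) g x = 0 := fun n x hx => by
    refine moll_eq_zero fun t ht => hgK _ fun hxt => hx ?_
    refine Metric.mem_cthickening_of_dist_le x (x - t) δ K hxt ?_
    rw [dist_eq_norm, sub_sub_cancel]
    refine (hs n t ht).trans (div_le_self hδ.le ?_)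
    linarith [(Nat.cast_nonneg n : (0 : ℝ) ≤ n)]
  have hcs : ∀ n, tsupport (moll (φ n) g) ⊆ Metric.cthickening δ K := fun n =>
    closure_minimal (fun x hx => by
      by_contra hx'
      exact hx (hzero n x hx')) Metric.isClosed_cthickening
  have hcc : ∀ n, HasCompactSupport (moll (φ n) g) := fun n =>
    HasCompactSupport.intro hK.cthickening (hzero n)
  have key : ∀ n, ∫ x, f x * moll (φ n) g' x = - ∫ x, f' x * moll (φ n) g x := fun n => by
    rw [← H _ (contDiff_moll (hφ n).smooth (hφ n).compact hli) (hcc n) ((hcs n).trans hδΩ)]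
    refine integral_congr_ae (ae_of_all _ fun x => ?_)
    dsimp only
    rw [pd_moll_eq (contDiff_nat_of_smooth (hφ n).smooth 1) (hφ n).compact hli k x]
    refine Hg _ ((hφ n).smooth.comp (contDiff_const.sub contDiff_id)) ?_ (Set.subset_univ _)
    exact (hφ n).compact.comp_homeomorph (Homeomorph.subLeft x)
  have h1 : Tendsto (fun n => ∫ x, f x * moll (φ n) g' x) atTop (𝓝 (∫ x, f x * g' x)) := by
    simp_rw [fun n => integral_mul_eq_inner hf (memLp_moll (hφ n) hg'),
      integral_mul_eq_inner hf hg']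
    exact tendsto_const_nhds.inner (tendsto_toL2_moll hφ hr hs hg')
  have h2 : Tendsto (fun n => - ∫ x, f' x * moll (φ n) g x) atTop (𝓝 (- ∫ x, f' x * g x)) := by
    simp_rw [fun n => integral_mul_eq_inner hf' (memLp_moll (hφ n) hg),
      integral_mul_eq_inner hf' hg]
    exact (tendsto_const_nhds.inner (tendsto_toL2_moll hφ hr hs hg)).neg
  simp_rw [key] at h1
  exact tendsto_nhds_unique h1 h2

theorem IsWeakPartial.integral_mul_pd {Ω : Set (Euc d)} (hΩ : IsOpen Ω) {k : Fin d}
    {f f' g : Euc d → ℝ} (H : IsWeakPartial Ω k f f') (hf : MemLp f 2) (hf' : MemLp f' 2)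
    (hg : ContDiff ℝ 1 g) (hgc : HasCompactSupport g) (hgs : tsupport g ⊆ Ω) :
    ∫ x, f x * pd k g x = - ∫ x, f' x * g x :=
  H.integral_mul_eq hΩ hf hf' (isWeakPartial_pd hg _ k)
    (hg.continuous.memLp_of_hasCompactSupport hgc)
    ((continuous_pd k hg).memLp_of_hasCompactSupport (hasCompactSupport_pd k hgc)) hgc hgs
    fun _ hx => image_eq_zero_of_notMem_tsupport hx

theorem contDiff_mul_of_tsupport {Ω : Set (Euc d)} (hΩ : IsOpen Ω) {n : WithTop ℕ∞}
    {ρ φ : Euc d → ℝ} (hρ : ContDiffOn ℝ n ρ Ω) (hφ : ContDiff ℝ n φ) (hs : tsupport φ ⊆ Ω) :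
    ContDiff ℝ n fun x => ρ x * φ x := by
  refine contDiff_iff_contDiffAt.2 fun x => ?_
  by_cases hx : x ∈ tsupport φ
  · exact (hρ.contDiffAt (hΩ.mem_nhds (hs hx))).mul hφ.contDiffAt
  · refine (contDiffAt_const (c := (0 : ℝ))).congr_of_eventuallyEq ?_
    filter_upwards [notMem_tsupport_iff_eventuallyEq.1 hx] with y hy
    rw [hy, Pi.zero_apply, mul_zero]

theorem pd_mul {ρ φ : Euc d → ℝ} {x : Euc d} (hρ : DifferentiableAt ℝ ρ x)
    (hφ : DifferentiableAt ℝ φ x) (k : Fin d) :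
    pd k (fun x => ρ x * φ x) x = ρ x * pd k φ x + pd k ρ x * φ x := by
  have := hρ.hasFDerivAt.mul hφ.hasFDerivAt
  rw [pd, HasFDerivAt.fderiv (f := fun x => ρ x * φ x) this]
  simp [pd, mul_comm]

theorem pd_eq_zero_of_notMem_tsupport {φ : Euc d → ℝ} {x : Euc d} (hx : x ∉ tsupport φ)
    (k : Fin d) : pd k φ x = 0 :=
  image_eq_zero_of_notMem_tsupport fun h => hx (tsupport_pd_subset k h)

theorem pd_mul_of_tsupport {Ω : Set (Euc d)} (hΩ : IsOpen Ω)
    {ρ φ : Euc d → ℝ} (hρ : ContDiffOn ℝ 1 ρ Ω) (hφ : ContDiff ℝ 1 φ) (hs : tsupport φ ⊆ Ω)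
    (k : Fin d) (x : Euc d) :
    pd k (fun x => ρ x * φ x) x = ρ x * pd k φ x + pd k ρ x * φ x := by
  by_cases hx : x ∈ tsupport φ
  · exact pd_mul ((hρ.contDiffAt (hΩ.mem_nhds (hs hx))).differentiableAt one_ne_zero)
      (hφ.differentiable one_ne_zero x) k
  · have h1 : x ∉ tsupport fun x => ρ x * φ x := fun h => hx (tsupport_mul_subset_right h)
    rw [pd_eq_zero_of_notMem_tsupport h1, pd_eq_zero_of_notMem_tsupport hx,
      image_eq_zero_of_notMem_tsupport hx]
    ring

/-- The product rule. -/
theorem IsWeakPartial.mul {Ω : Set (Euc d)} (hΩ : IsOpen Ω) {k : Fin d}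
    {f f' ρ : Euc d → ℝ} (H : IsWeakPartial Ω k f f') (hf : MemLp f 2) (hf' : MemLp f' 2)
    (hρ : ContDiffOn ℝ 1 ρ Ω) :
    IsWeakPartial Ω k (fun x => f x * ρ x) fun x => f' x * ρ x + f x * pd k ρ x := by
  intro φ hφ hφc hφs
  have hφ1 : ContDiff ℝ 1 φ := contDiff_nat_of_smooth hφ 1
  have hg : ContDiff ℝ 1 fun x => ρ x * φ x := contDiff_mul_of_tsupport hΩ hρ hφ1 hφs
  have hgc : HasCompactSupport fun x => ρ x * φ x := hφc.mul_left
  have h1 := H.integral_mul_pd hΩ hf hf' hg hgc (tsupport_mul_subset_right.trans hφs)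
  have hmul := pd_mul_of_tsupport hΩ hρ hφ1 hφs k
  have hc : Continuous fun x => ρ x * pd k φ x :=
    (contDiff_mul_of_tsupport (n := 0) hΩ (hρ.of_le (by norm_num))
      (contDiff_zero.2 (continuous_pd k hφ1)) ((tsupport_pd_subset k).trans hφs)).continuous
  have hm1 : MemLp (fun x => ρ x * pd k φ x) 2 :=
    hc.memLp_of_hasCompactSupport (hasCompactSupport_pd k hφc).mul_left
  have hm2 : MemLp (fun x => pd k ρ x * φ x) 2 := by
    have e : (fun x => pd k ρ x * φ x) = fun x =>
        pd k (fun x => ρ x * φ x) x - ρ x * pd k φ x := by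
      funext x; rw [hmul]; ring
    rw [e]
    exact ((continuous_pd k hg).memLp_of_hasCompactSupport (hasCompactSupport_pd k hgc)).sub hm1
  have hm3 : MemLp (fun x => ρ x * φ x) 2 := hg.continuous.memLp_of_hasCompactSupport hgc
  have i1 : Integrable fun x => f x * (ρ x * pd k φ x) := hf.integrable_mul hm1
  have i2 : Integrable fun x => f x * (pd k ρ x * φ x) := hf.integrable_mul hm2
  have i3 : Integrable fun x => f' x * (ρ x * φ x) := hf'.integrable_mul hm3
  have e1 : ∫ x, f x * pd k (fun x => ρ x * φ x) x =
      (∫ x, f x * (ρ x * pd k φ x)) + ∫ x, f x * (pd k ρ x * φ x) := by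
    rw [← integral_add i1 i2]
    refine integral_congr_ae (ae_of_all _ fun x => ?_)
    dsimp only
    rw [hmul]; ring
  have e2 : ∫ x, (f' x * ρ x + f x * pd k ρ x) * φ x =
      (∫ x, f' x * (ρ x * φ x)) + ∫ x, f x * (pd k ρ x * φ x) := by
    rw [← integral_add i3 i2]
    refine integral_congr_ae (ae_of_all _ fun x => ?_)
    ring
  have e3 : ∫ x, f x * ρ x * pd k φ x = ∫ x, f x * (ρ x * pd k φ x) :=
    integral_congr_ae (ae_of_all _ fun x => mul_assoc _ _ _)
  rw [e2, e3]
  linarith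

theorem exists_bound_of_hasCompactSupport {X : Euc d → ℝ} (hX : Continuous X)
    (hXc : HasCompactSupport X) : ∃ C, ∀ x, ‖X x‖ ≤ C :=
  hX.bounded_above_of_compact_support hXc

theorem memLp_mul_bounded {f X : Euc d → ℝ} (hf : MemLp f 2) (hX : Continuous X) {C : ℝ}
    (hC : ∀ x, ‖X x‖ ≤ C) : MemLp (fun x => f x * X x) 2 :=
  hf.of_le_mul (c := C) (hf.1.mul hX.aestronglyMeasurable) (ae_of_all _ fun x => by
    rw [norm_mul, mul_comm]
    exact mul_le_mul_of_nonneg_right (hC x) (norm_nonneg _))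

/-- Integration by parts of two Sobolev functions against a compactly supported function. -/
theorem IsWeakPartial.integral_mul_mul {Ω : Set (Euc d)} (hΩ : IsOpen Ω) {k : Fin d}
    {f f' v v' X : Euc d → ℝ} (H : IsWeakPartial Ω k f f') (hf : MemLp f 2) (hf' : MemLp f' 2)
    (Hv : IsWeakPartial Ω k v v') (hv : MemLp v 2) (hv' : MemLp v' 2) (hX : ContDiff ℝ 1 X)
    (hXc : HasCompactSupport X) (hXs : tsupport X ⊆ Ω) :
    ∫ x, f x * (v' x * X x + v x * pd k X x) = - ∫ x, f' x * (v x * X x) := by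
  obtain ⟨C, hC⟩ := exists_bound_of_hasCompactSupport hX.continuous hXc
  obtain ⟨C', hC'⟩ := exists_bound_of_hasCompactSupport (continuous_pd k hX)
    (hasCompactSupport_pd k hXc)
  have h1 := memLp_mul_bounded hv hX.continuous hC
  have h2 := memLp_mul_bounded hv' hX.continuous hC
  have h3 := memLp_mul_bounded hv (continuous_pd k hX) hC'
  -- The product `v X` is compactly supported in `Ω`, so the product rule gives its weak derivative
  -- on all of `ℝ^d`.
  refine H.integral_mul_eq hΩ hf hf' (fun φ hφ hφc _ => ?_) h1 (h2.add h3) hXc hXs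
    fun x hx => by rw [image_eq_zero_of_notMem_tsupport hx, mul_zero]
  have hφ1 : ContDiff ℝ 1 φ := contDiff_nat_of_smooth hφ 1
  have h4 := Hv.integral_mul_pd hΩ hv hv' (hX.mul hφ1) hφc.mul_left
    (tsupport_mul_subset_left.trans hXs)
  obtain ⟨B, hB⟩ := exists_bound_of_hasCompactSupport (continuous_pd k hφ1)
    (hasCompactSupport_pd k hφc)
  have m1 : MemLp (fun x => X x * pd k φ x) 2 :=
    (hX.continuous.mul (continuous_pd k hφ1)).memLp_of_hasCompactSupport hXc.mul_right
  have m2 : MemLp (fun x => pd k X x * φ x) 2 :=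
    ((continuous_pd k hX).mul hφ1.continuous).memLp_of_hasCompactSupport hφc.mul_left
  have m3 : MemLp (fun x => X x * φ x) 2 :=
    (hX.continuous.mul hφ1.continuous).memLp_of_hasCompactSupport hφc.mul_left
  have i1 : Integrable fun x => v x * (X x * pd k φ x) := hv.integrable_mul m1
  have i2 : Integrable fun x => v x * (pd k X x * φ x) := hv.integrable_mul m2
  have i3 : Integrable fun x => v' x * (X x * φ x) := hv'.integrable_mul m3
  have e1 : ∫ x, v x * pd k (fun x => X x * φ x) x =
      (∫ x, v x * (X x * pd k φ x)) + ∫ x, v x * (pd k X x * φ x) := by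
    rw [← integral_add i1 i2]
    refine integral_congr_ae (ae_of_all _ fun x => ?_)
    dsimp only
    rw [pd_mul (hX.differentiable one_ne_zero x) (hφ1.differentiable one_ne_zero x)]; ring
  have e2 : ∫ x, (v' x * X x + v x * pd k X x) * φ x =
      (∫ x, v' x * (X x * φ x)) + ∫ x, v x * (pd k X x * φ x) := by
    rw [← integral_add i3 i2]
    refine integral_congr_ae (ae_of_all _ fun x => ?_)
    ring
  have e3 : ∫ x, v x * X x * pd k φ x = ∫ x, v x * (X x * pd k φ x) :=
    integral_congr_ae (ae_of_all _ fun x => mul_assoc _ _ _)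
  change ∫ x, v x * X x * pd k φ x = - ∫ x, (v' x * X x + v x * pd k X x) * φ x
  rw [e2, e3]
  linarith

end WeakPartial

/-! ### Geometry of the domain near its boundary. -/

section Geometry

variable {d : ℕ}

/-- `η` is a defining function of the bounded open set `Ω`: it is of class `C³`, positive in `Ω`,
and vanishes with nonzero gradient on the boundary. -/
structure IsDefining (Ω : Set (Euc d)) (η : Euc d → ℝ) : Prop where
  isOpen : IsOpen Ω
  bounded : Bornology.IsBounded Ω
  smooth : ContDiff ℝ 3 η
  pos : ∀ x ∈ Ω, 0 < η x
  zero : ∀ x ∈ frontier Ω, η x = 0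
  grad : ∀ x ∈ frontier Ω, ∃ k, pd k η x ≠ 0

/-- Locally `Ω` is `{F > 0}` and its frontier lies in `{F = 0}`. Hence the gradient `p` is
orthogonal to the frontier to first order, and the sign of `F` along the line through `x₀` in the
direction of `p` tells the sides apart. -/
theorem isOutwardUnitNormal_of_hasFDerivAt {Ω : Set (Euc d)} (hΩ : IsOpen Ω) {x₀ : Euc d}
    (hx₀ : x₀ ∈ frontier Ω) {F : Euc d → ℝ} (hF : Continuous F) {r : ℝ} (hr : 0 < r)
    (h : ∀ x ∈ Metric.ball x₀ r, (x ∈ Ω ↔ 0 < F x)) {p : Euc d} (hp : p ≠ 0)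
    (hd : HasFDerivAt F (innerSL ℝ p) x₀) :
    IsOutwardUnitNormal Ω x₀ (-(‖p‖⁻¹ • p)) := by
  have hp' : 0 < ‖p‖ := norm_pos_iff.2 hp
  have hU : ∀ x ∈ Metric.ball x₀ r, x ∈ closure Ω → 0 ≤ F x := by
    intro x hx hxc
    by_contra! hneg
    have ho : IsOpen (Metric.ball x₀ r ∩ F ⁻¹' Set.Iio 0) :=
      Metric.isOpen_ball.inter (isOpen_Iio.preimage hF)
    obtain ⟨y, ⟨hy1, hy2⟩, hy3⟩ := mem_closure_iff.1 hxc _ ho ⟨hx, hneg⟩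
    exact absurd ((h y hy1).1 hy3) (not_lt.2 (le_of_lt hy2))
  have hfr : ∀ x ∈ Metric.ball x₀ r, x ∈ frontier Ω → F x = 0 := by
    intro x hx hxf
    rw [hΩ.frontier_eq] at hxf
    refine le_antisymm (not_lt.1 fun hpos => hxf.2 ((h x hx).2 hpos)) (hU x hx hxf.1)
  have h0 : F x₀ = 0 := hfr x₀ (Metric.mem_ball_self hr) hx₀
  have hline : ∀ c : ℝ, HasDerivAt (fun t : ℝ => F (x₀ + t • (c • p))) (c * ‖p‖ ^ 2) 0 := by
    intro c
    have h1 : HasDerivAt (fun t : ℝ => x₀ + t • (c • p)) (c • p) 0 := by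
      simpa using ((hasDerivAt_id (0 : ℝ)).smul_const (c • p)).const_add x₀
    have h2 : HasFDerivAt F (innerSL ℝ p) (x₀ + (0 : ℝ) • (c • p)) := by simpa using hd
    have := h2.comp_hasDerivAt (0 : ℝ) h1
    rw [innerSL_apply_apply, real_inner_smul_right, real_inner_self_eq_norm_sq] at this
    exact this
  have hball : ∀ c : ℝ, ∀ᶠ t in 𝓝[>] (0 : ℝ), x₀ + t • (c • p) ∈ Metric.ball x₀ r := by
    intro c
    have hc : ContinuousAt (fun t : ℝ => x₀ + t • (c • p)) 0 := by fun_prop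
    refine nhdsWithin_le_nhds (hc.eventually_mem (Metric.isOpen_ball.mem_nhds ?_))
    simpa using hr
  have hsign : ∀ c : ℝ, 0 < c → (∀ᶠ t in 𝓝[>] (0 : ℝ), 0 < F (x₀ + t • (c • p))) ∧
      ∀ᶠ t in 𝓝[>] (0 : ℝ), F (x₀ + t • (-c • p)) < 0 := by
    intro c hc
    constructor
    · have h1 := (hline c).tendsto_slope.mono_left
        (nhdsWithin_mono (0 : ℝ) (fun t (ht : 0 < t) => ht.ne'))
      filter_upwards [h1.eventually_const_lt (show (0 : ℝ) < c * ‖p‖ ^ 2 by positivity),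
        self_mem_nhdsWithin] with t ht ht0
      rw [slope_def_field] at ht
      simp only [zero_smul, add_zero, h0, sub_zero] at ht
      exact (div_pos_iff_of_pos_right ht0).1 ht
    · have h1 := (hline (-c)).tendsto_slope.mono_left
        (nhdsWithin_mono (0 : ℝ) (fun t (ht : 0 < t) => ht.ne'))
      have hneg : -c * ‖p‖ ^ 2 < 0 := by
        rw [neg_mul]; exact neg_neg_of_pos (by positivity)
      filter_upwards [h1.eventually_lt_const hneg, self_mem_nhdsWithin] with t ht ht0
      rw [slope_def_field] at ht
      simp only [zero_smul, add_zero, h0, sub_zero] at ht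
      have ht0' : (0 : ℝ) < t := ht0
      exact (div_neg_iff.1 ht).elim (fun h => absurd h.2 (not_lt.2 ht0'.le)) fun h => h.1
  have hpi : 0 < ‖p‖⁻¹ := inv_pos.2 hp'
  refine ⟨?_, ?_, ?_⟩
  · rw [norm_neg, norm_smul, norm_inv, norm_norm, inv_mul_cancel₀ hp'.ne']
  · have h1 := (hd.isLittleO.mono (nhdsWithin_le_nhds (s := frontier Ω))).const_mul_left ‖p‖⁻¹
    refine h1.congr' ?_ EventuallyEq.rfl
    filter_upwards [self_mem_nhdsWithin,
      nhdsWithin_le_nhds (Metric.ball_mem_nhds x₀ hr)] with y hy hyb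
    rw [hfr y hyb hy, h0]
    simp [real_inner_smul_right, real_inner_comm]
  · filter_upwards [(hsign _ hpi).1, (hsign _ hpi).2, hball ‖p‖⁻¹, hball (-‖p‖⁻¹)]
      with t h1 h2 h3 h4
    rw [smul_neg, sub_neg_eq_add, ← smul_neg, ← neg_smul]
    exact ⟨(h _ h3).2 h1, fun h5 => absurd (hU _ h4 h5) (not_le.2 h2)⟩

/-- The graph gives the local defining function `⟪e, x⟫ - γ(P x)`. Since `P e = 0`, its derivative
along `e` is `1`, so its gradient is nonzero. -/
theorem HasHolderBoundary.exists_isOutwardUnitNormal {Ω : Set (Euc d)} (hΩ : IsOpen Ω)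
    {k : ℕ} (hk : k ≠ 0) {a : ℝ≥0} (h : HasHolderBoundary k a Ω) {x₀ : Euc d}
    (hx₀ : x₀ ∈ frontier Ω) : ∃ n, IsOutwardUnitNormal Ω x₀ n := by
  obtain ⟨e, r, γ, he, hr, hγ, -, hΩr⟩ := h x₀ hx₀
  have hγ1 : ContDiff ℝ 1 γ := hγ.of_le (by exact_mod_cast Nat.one_le_iff_ne_zero.2 hk)
  let P := (ℝ ∙ e)ᗮ.orthogonalProjectionOnto
  let F : Euc d → ℝ := fun x => ⟪e, x⟫_ℝ - γ (P x)
  have hF : ContDiff ℝ 1 F :=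
    (contDiff_const.inner ℝ contDiff_id).sub (hγ1.comp P.contDiff)
  have hPe : P e = 0 := by
    refine Submodule.orthogonalProjectionOnto_eq_zero_iff.2 ?_
    rw [Submodule.orthogonal_orthogonal]
    exact Submodule.mem_span_singleton_self e
  let p : Euc d := (InnerProductSpace.toDual ℝ (Euc d)).symm (fderiv ℝ F x₀)
  have hp : innerSL ℝ p = fderiv ℝ F x₀ := by
    ext y
    simp [p]
  have hp0 : ⟪p, e⟫_ℝ = 1 := by
    have h1 : HasFDerivAt F (innerSL ℝ e - (fderiv ℝ γ (P x₀)).comp P) x₀ :=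
      (innerSL ℝ e).hasFDerivAt.sub
        ((hγ1.differentiable one_ne_zero _).hasFDerivAt.comp x₀ P.hasFDerivAt)
    have h2 : innerSL ℝ p e = 1 := by
      rw [hp, h1.fderiv]
      simp [hPe, he]
    simpa using h2
  refine ⟨_, isOutwardUnitNormal_of_hasFDerivAt hΩ hx₀ hF.continuous hr (fun x hx => ?_)
    (p := p) (fun h0 => by simp [h0] at hp0) (hp ▸ (hF.differentiable one_ne_zero x₀).hasFDerivAt)⟩
  rw [hΩr x hx, real_inner_comm]
  exact sub_pos.symm

theorem fderiv_apply_eq_sum (f : Euc d → ℝ) (x v : Euc d) :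
    fderiv ℝ f x v = ∑ k, v k * pd k f x := by
  conv_lhs => rw [← (EuclideanSpace.basisFun (Fin d) ℝ).sum_repr v]
  simp [pd]

/-- The condition on normal derivatives has content only where a normal exists; the regularity of
the boundary supplies one at every point. -/
theorem IsAuxiliary.isDefining {Ω : Set (Euc d)} (hΩ : IsOpen Ω) (hb : Bornology.IsBounded Ω)
    {a : ℝ≥0} (h : HasHolderBoundary 3 a Ω) {η : Euc d → ℝ} (hη : IsAuxiliary Ω η) :
    IsDefining Ω η where
  isOpen := hΩ
  bounded := hb
  smooth := hη.smooth.1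
  pos := hη.pos
  zero := hη.zero
  grad x hx := by
    obtain ⟨n, hn⟩ := h.exists_isOutwardUnitNormal hΩ (by norm_num) hx
    by_contra! h0
    exact hη.normal x hx n hn (by simp [fderiv_apply_eq_sum, h0])

namespace IsDefining

variable {Ω : Set (Euc d)} {η : Euc d → ℝ}

theorem isCompact_closure (H : IsDefining Ω η) : IsCompact (closure Ω) :=
  H.bounded.isCompact_closure

theorem exists_bound (H : IsDefining Ω η) {f : Euc d → ℝ} (hf : Continuous f) :
    ∃ C, 0 < C ∧ ∀ x ∈ Ω, |f x| ≤ C := by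
  obtain ⟨C, hC⟩ := H.isCompact_closure.exists_bound_of_continuousOn hf.continuousOn
  exact ⟨|C| + 1, by positivity, fun x hx =>
    (hC x (subset_closure hx)).trans ((le_abs_self C).trans (by linarith))⟩

theorem exists_grad_lower (H : IsDefining Ω η) :
    ∃ c, 0 < c ∧ ∀ x ∈ Ω, c ≤ (∑ k, pd k η x ^ 2) + η x ^ 2 := by
  have hη1 : ContDiff ℝ 1 η := H.smooth.of_le (by norm_num)
  have hc : ContinuousOn (fun x => (∑ k, pd k η x ^ 2) + η x ^ 2) (closure Ω) := by
    have := fun k => continuous_pd k hη1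
    have := hη1.continuous
    fun_prop
  obtain ⟨c, hc0, hc⟩ := H.isCompact_closure.exists_forall_le' hc (a := 0) fun x hx => by
    by_cases h : x ∈ Ω
    · have := H.pos x h
      positivity
    · obtain ⟨k, hk⟩ := H.grad x (H.isOpen.frontier_eq ▸ ⟨hx, h⟩)
      have h1 : 0 < pd k η x ^ 2 := by positivity
      have h2 := Finset.single_le_sum (f := fun k => pd k η x ^ 2)
        (fun k _ => sq_nonneg _) (Finset.mem_univ k)
      have h3 := sq_nonneg (η x)
      linarith
  exact ⟨c, hc0, fun x hx => hc x (subset_closure hx)⟩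

/-- Near a point of the closure, small translations in suitable directions stay in `Ω` and do not
decrease `η` by more than a constant factor. -/
theorem exists_inward (H : IsDefining Ω η) {x₀ : Euc d} (hx₀ : x₀ ∈ closure Ω) :
    ∃ (y₀ : Euc d) (ρ r δ₀ C : ℝ), 0 < ρ ∧ 0 < r ∧ 0 < δ₀ ∧ 0 < C ∧
      ∀ x ∈ Ω ∩ Metric.ball x₀ r, ∀ y ∈ Metric.ball y₀ ρ, ∀ δ, 0 < δ → δ ≤ δ₀ →
        x + δ • y ∈ Ω ∧ η x ≤ C * η (x + δ • y) := by
  by_cases h0 : x₀ ∈ Ω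
  · obtain ⟨R, hR, hRΩ⟩ := Metric.isOpen_iff.1 H.isOpen x₀ h0
    obtain ⟨C, hC, hCb⟩ := H.exists_bound H.smooth.continuous
    have hcpt : IsCompact (Metric.closedBall x₀ (R / 2)) := isCompact_closedBall _ _
    have hsub : Metric.closedBall x₀ (R / 2) ⊆ Ω :=
      (Metric.closedBall_subset_ball (by linarith)).trans hRΩ
    obtain ⟨c, hc, hcb⟩ := hcpt.exists_forall_le' H.smooth.continuous.continuousOn (a := 0)
      fun x hx => H.pos x (hsub hx)
    refine ⟨0, 1, R / 4, R / 4, C / c, one_pos, by positivity, by positivity, by positivity,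
      fun x hx y hy δ hδ hδ' => ?_⟩
    have hmem : x + δ • y ∈ Metric.closedBall x₀ (R / 2) := by
      have h1 := mem_ball_iff_norm.1 hx.2
      have h2 := mem_ball_zero_iff.1 hy
      rw [mem_closedBall_iff_norm, add_sub_right_comm]
      refine (norm_add_le _ _).trans ?_
      rw [norm_smul, Real.norm_of_nonneg hδ.le]
      nlinarith [norm_nonneg y]
    refine ⟨hsub hmem, ?_⟩
    have h1 := (le_abs_self _).trans (hCb x hx.1)
    have h2 := hcb _ hmem
    calc η x ≤ C := h1
      _ = C / c * c := by field_simp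
      _ ≤ _ := by gcongr
  · have hf : x₀ ∈ frontier Ω := H.isOpen.frontier_eq ▸ ⟨hx₀, h0⟩
    have hη1 : ContDiff ℝ 1 η := H.smooth.of_le (by norm_num)
    obtain ⟨k, hk⟩ := H.grad x₀ hf
    -- A coordinate direction, oriented so that the derivative of `η` along it at `x₀` is `(∂_k η)²
    -- > 0`. By continuity `η` increases in all nearby directions at all nearby points.
    let y₀ : Euc d := pd k η x₀ • EuclideanSpace.single k (1 : ℝ)
    have hy₀ : 0 < fderiv ℝ η x₀ y₀ := by
      have : fderiv ℝ η x₀ y₀ = pd k η x₀ * pd k η x₀ := by simp [y₀, pd]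
      rw [this]
      exact mul_self_pos.2 hk
    have hcont : Continuous fun p : Euc d × Euc d => fderiv ℝ η p.1 p.2 :=
      ((hη1.continuous_fderiv one_ne_zero).comp continuous_fst).clm_apply continuous_snd
    obtain ⟨R, hR, hRp⟩ := Metric.eventually_nhds_iff_ball.1
      ((hcont.tendsto (x₀, y₀)).eventually_const_lt hy₀)
    have hRp' : ∀ z ∈ Metric.ball x₀ R, ∀ y ∈ Metric.ball y₀ R, 0 < fderiv ℝ η z y :=
      fun z hz y hy => hRp (z, y) (by rw [← ball_prod_same]; exact ⟨hz, hy⟩)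
    have hB : 0 < ‖y₀‖ + R := by positivity
    refine ⟨y₀, R, R / 2, R / (2 * (‖y₀‖ + R)), 1, hR, by positivity, by positivity, one_pos,
      fun x hx y hy δ hδ hδ' => ?_⟩
    have hny : ‖y‖ ≤ ‖y₀‖ + R := by
      have := (mem_ball_iff_norm.1 hy).le
      have h2 := norm_add_le y₀ (y - y₀)
      rw [add_sub_cancel] at h2
      linarith
    have hseg : ∀ t ∈ Set.Icc 0 δ, x + t • y ∈ Metric.ball x₀ R := fun t ht => by
      have h1 := mem_ball_iff_norm.1 hx.2
      rw [mem_ball_iff_norm, add_sub_right_comm]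
      refine (norm_add_le _ _).trans_lt ?_
      rw [norm_smul, Real.norm_of_nonneg ht.1]
      have : t * ‖y‖ ≤ R / (2 * (‖y₀‖ + R)) * (‖y₀‖ + R) :=
        mul_le_mul (ht.2.trans hδ') hny (norm_nonneg _) (by positivity)
      have e : R / (2 * (‖y₀‖ + R)) * (‖y₀‖ + R) = R / 2 := by field_simp
      linarith
    have hder : ∀ t, HasDerivAt (fun t : ℝ => η (x + t • y)) (fderiv ℝ η (x + t • y) y) t :=
      fun t => by
        have h1 : HasDerivAt (fun t : ℝ => x + t • y) y t := by
          simpa using ((hasDerivAt_id t).smul_const y).const_add x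
        exact (hη1.differentiable one_ne_zero (x + t • y)).hasFDerivAt.comp_hasDerivAt t h1
    have hmono : MonotoneOn (fun t : ℝ => η (x + t • y)) (Set.Icc 0 δ) :=
      monotoneOn_of_deriv_nonneg (convex_Icc _ _)
        (fun t _ => (hder t).continuousAt.continuousWithinAt)
        (fun t _ => (hder t).differentiableAt.differentiableWithinAt) fun t ht => by
          rw [interior_Icc] at ht
          rw [(hder t).deriv]
          exact (hRp' _ (hseg t ⟨ht.1.le, ht.2.le⟩) y hy).le
    have hge : ∀ t ∈ Set.Icc 0 δ, η x ≤ η (x + t • y) := fun t ht => by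
      simpa using hmono (Set.left_mem_Icc.2 hδ.le) ht ht.1
    refine ⟨?_, by simpa using hge δ (Set.right_mem_Icc.2 hδ.le)⟩
    -- Along the segment `η` stays at least `η x > 0`, so the segment misses the frontier and, being
    -- connected, cannot leave `Ω`.
    have hpre : IsPreconnected ((fun t : ℝ => x + t • y) '' Set.Icc 0 δ) :=
      isPreconnected_Icc.image _ (by fun_prop)
    by_contra hout
    have hfr : ∀ t ∈ Set.Icc 0 δ, x + t • y ∉ frontier Ω := fun t ht hz => by
      linarith [H.zero _ hz, hge t ht, H.pos x hx.1]
    have hcl : ∀ t ∈ Set.Icc 0 δ, x + t • y ∉ Ω → x + t • y ∈ (closure Ω)ᶜ := fun t ht h h' =>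
      hfr t ht (H.isOpen.frontier_eq ▸ ⟨h', h⟩)
    have hr' := Set.right_mem_Icc.2 hδ.le
    obtain ⟨z, -, hz, hz'⟩ := hpre Ω (closure Ω)ᶜ H.isOpen isClosed_closure.isOpen_compl
      (by
        rintro _ ⟨t, ht, rfl⟩
        exact or_iff_not_imp_left.2 (hcl t ht))
      ⟨x, ⟨0, Set.left_mem_Icc.2 hδ.le, by simp⟩, hx.1⟩
      ⟨x + δ • y, ⟨δ, hr', rfl⟩, hcl δ hr' hout⟩
    exact hz' (subset_closure hz)

end IsDefining

end Geometry

/-! ### Cutoff functions of the level sets of `η`. -/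

section Cutoff

variable {d : ℕ}

theorem exists_smooth_step : ∃ (χ : ℝ → ℝ) (C : ℝ), ContDiff ℝ (⊤ : ℕ∞) χ ∧ 0 < C ∧
    (∀ t, 0 ≤ χ t) ∧ (∀ t, χ t ≤ 1) ∧ (∀ t ≤ 1, χ t = 0) ∧ (∀ t, 2 ≤ t → χ t = 1) ∧
    (∀ t, |deriv χ t| ≤ C) ∧ ∀ t, 2 < t → deriv χ t = 0 := by
  let χ : ℝ → ℝ := fun t => Real.smoothTransition (t - 1)
  have hχ : ContDiff ℝ (⊤ : ℕ∞) χ := Real.smoothTransition.contDiff.comp (by fun_prop)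
  have h0 : ∀ t ≤ 1, χ t = 0 := fun t ht => Real.smoothTransition.zero_of_nonpos (by linarith)
  have h1 : ∀ t, 2 ≤ t → χ t = 1 := fun t ht => Real.smoothTransition.one_of_one_le (by linarith)
  have hd : ∀ t, 2 < t → deriv χ t = 0 := fun t ht => by
    have : χ =ᶠ[𝓝 t] fun _ => 1 := by
      filter_upwards [lt_mem_nhds ht] with s hs using h1 s hs.le
    rw [this.deriv_eq, deriv_const]
  have hd0 : ∀ t, t < 1 → deriv χ t = 0 := fun t ht => by
    have : χ =ᶠ[𝓝 t] fun _ => 0 := by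
      filter_upwards [gt_mem_nhds ht] with s hs using h0 s hs.le
    rw [this.deriv_eq, deriv_const]
  have hc : Continuous (deriv χ) := (contDiff_one_iff_deriv.1 (hχ.of_le (by simp))).2
  obtain ⟨C, hC⟩ := (isCompact_Icc (a := (1 : ℝ)) (b := 2)).exists_bound_of_continuousOn
    hc.continuousOn
  refine ⟨χ, |C| + 1, hχ, by positivity, fun t => Real.smoothTransition.nonneg _,
    fun t => Real.smoothTransition.le_one _, h0, h1, fun t => ?_, hd⟩
  rcases lt_or_ge t 1 with h | h
  · rw [hd0 t h, abs_zero]; positivity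
  rcases lt_or_ge 2 t with h' | h'
  · rw [hd t h', abs_zero]; positivity
  · exact (hC t ⟨h, h'⟩).trans ((le_abs_self C).trans (by linarith))

/-- A domain with a defining function has cutoff functions that are functions of `η` and whose
gradients are bounded by a multiple of `η⁻¹`. -/
theorem IsDefining.exists_cutoff {Ω : Set (Euc d)} {η : Euc d → ℝ} (H : IsDefining Ω η) :
    ∃ (κ κ' : ℕ → Euc d → ℝ) (C : ℝ), 0 < C ∧
      (∀ n, ContDiff ℝ 1 (κ n) ∧ HasCompactSupport (κ n) ∧ tsupport (κ n) ⊆ Ω ∧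
        (∀ x, 0 ≤ κ n x) ∧ ∀ x, κ n x ≤ 1) ∧
      (∀ n, ∀ x ∈ Ω, (∀ k, pd k (κ n) x = κ' n x * pd k η x) ∧ |κ' n x| ≤ C / η x) ∧
      (∀ n x, x ∉ Ω → κ n x = 0) ∧
      ∀ x ∈ Ω, ∀ᶠ n in atTop, κ n x = 1 ∧ κ' n x = 0 := by
  obtain ⟨χ, C, hχ, hC, hχ0, hχ1, hz, ho, hdC, hd0⟩ := exists_smooth_step
  let δ : ℕ → ℝ := fun n => 1 / ((n : ℝ) + 1)
  have hδ : ∀ n, 0 < δ n := fun n => by positivity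
  -- The indicator is needed because the sign of `η` outside the closure of `Ω` is not prescribed.
  let κ : ℕ → Euc d → ℝ := fun n => Ω.indicator fun x => χ (η x / δ n)
  let κ' : ℕ → Euc d → ℝ := fun n x => deriv χ (η x / δ n) / δ n
  have hη1 : ContDiff ℝ 1 η := H.smooth.of_le (by norm_num)
  have hχ1' : ContDiff ℝ 1 χ := hχ.of_le (by simp)
  have hin : ∀ n, ∀ x ∈ Ω, κ n =ᶠ[𝓝 x] fun x => χ (η x / δ n) := fun n x hx => by
    filter_upwards [H.isOpen.mem_nhds hx] with y hy using Set.indicator_of_mem hy _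
  have hη' : ∀ n, ContDiff ℝ 1 fun x => χ (η x / δ n) := fun n => hχ1'.comp (hη1.div_const _)
  have hS : ∀ n, Function.support (κ n) ⊆ closure Ω ∩ η ⁻¹' Set.Ici (δ n) := fun n x hx => by
    have hxΩ : x ∈ Ω := by
      by_contra h
      exact hx (Set.indicator_of_notMem h _)
    refine ⟨subset_closure hxΩ, ?_⟩
    by_contra h
    refine hx ((Set.indicator_of_mem hxΩ _).trans (hz _ ?_))
    exact (div_le_one (hδ n)).2 (not_le.1 h).le
  have hcl : ∀ n, IsClosed (closure Ω ∩ η ⁻¹' Set.Ici (δ n)) := fun n =>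
    isClosed_closure.inter (isClosed_Ici.preimage hη1.continuous)
  have hts : ∀ n, tsupport (κ n) ⊆ closure Ω ∩ η ⁻¹' Set.Ici (δ n) := fun n =>
    closure_minimal (hS n) (hcl n)
  have htΩ : ∀ n, tsupport (κ n) ⊆ Ω := fun n x hx => by
    obtain ⟨h1, h2⟩ := hts n hx
    by_contra h
    have h3 := H.zero x (H.isOpen.frontier_eq ▸ ⟨h1, h⟩)
    have h4 : δ n ≤ η x := h2
    linarith [hδ n]
  refine ⟨κ, κ', 2 * C, by positivity, fun n => ⟨?_, ?_, htΩ n, fun x => ?_, fun x => ?_⟩,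
    fun n x hx => ⟨fun k => ?_, ?_⟩, fun n x hx => Set.indicator_of_notMem hx _, fun x hx => ?_⟩
  · refine contDiff_iff_contDiffAt.2 fun x => ?_
    by_cases hx : x ∈ tsupport (κ n)
    · exact (hη' n).contDiffAt.congr_of_eventuallyEq (hin n x (htΩ n hx))
    · exact (contDiffAt_const (c := (0 : ℝ))).congr_of_eventuallyEq
        (notMem_tsupport_iff_eventuallyEq.1 hx)
  · exact (H.isCompact_closure.inter_right (isClosed_Ici.preimage hη1.continuous)).of_isClosed_subset
      (isClosed_tsupport _) (hts n)
  · exact Set.indicator_nonneg (fun _ _ => hχ0 _) x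
  · exact Set.indicator_le' (fun _ _ => hχ1 _) (fun _ _ => zero_le_one) x
  · have h1 : HasFDerivAt (fun x => η x / δ n) ((δ n)⁻¹ • fderiv ℝ η x) x := by
      simp_rw [div_eq_inv_mul]
      exact (hη1.differentiable one_ne_zero x).hasFDerivAt.const_mul _
    have h2 := ((hχ1'.differentiable one_ne_zero (η x / δ n)).hasDerivAt).comp_hasFDerivAt x h1
    rw [pd, (hin n x hx).fderiv_eq, HasFDerivAt.fderiv (f := fun x => χ (η x / δ n)) h2]
    simp [κ', pd]
    ring
  -- Where `deriv χ` does not vanish, `η x ≤ 2 δ n`, hence `1 / δ n ≤ 2 / η x`; this gives the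
  -- constant `2 * C`.
  · have hp := H.pos x hx
    rw [abs_div, abs_of_pos (hδ n), div_le_div_iff₀ (hδ n) hp]
    rcases lt_or_ge 2 (η x / δ n) with h | h
    · rw [hd0 _ h, abs_zero, zero_mul]
      have := hδ n
      positivity
    · rw [div_le_iff₀ (hδ n)] at h
      have h3 := hdC (η x / δ n)
      nlinarith [hδ n]
  · have hlim : Tendsto (fun n => η x / δ n) atTop atTop := by
      have : (fun n => η x / δ n) = fun n : ℕ => η x * ((n : ℝ) + 1) := by
        funext n; simp [δ]
      rw [this]
      exact (tendsto_atTop_add_const_right _ _ tendsto_natCast_atTop_atTop).const_mul_atTop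
        (H.pos x hx)
    filter_upwards [hlim.eventually_gt_atTop 2] with n hn
    exact ⟨(Set.indicator_of_mem hx _).trans (ho _ hn.le), by simp [κ', hd0 _ hn]⟩

end Cutoff

/-! ### Hardy's inequality with weights in powers of `η`. -/

section Hardy

variable {d : ℕ} {Ω : Set (Euc d)} {η : Euc d → ℝ}

/-- Integration by parts of `v²` without boundary terms. -/
theorem IsDefining.integral_sq_mul_pd (H : IsDefining Ω η) {k : Fin d} {v v' ρ : Euc d → ℝ}
    (hw : IsWeakPartial Ω k v v') (hv : MemLp v 2) (hv' : MemLp v' 2)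
    (hv0 : ∀ x, x ∉ Ω → v x = 0) (hI : Integrable fun x => v x ^ 2 / η x)
    (hρ : ContDiffOn ℝ 1 ρ Ω) {B : ℝ} (hB : ∀ x ∈ Ω, |ρ x| ≤ B)
    (hB' : ∀ x ∈ Ω, |pd k ρ x| ≤ B) :
    ∫ x, v x ^ 2 * pd k ρ x = - 2 * ∫ x, v x * v' x * ρ x := by
  obtain ⟨κ, κ', C, hC, hκ, hκ', hκ0, hlim⟩ := H.exists_cutoff
  have hη1 : ContDiff ℝ 1 η := H.smooth.of_le (by norm_num)
  obtain ⟨D, hD, hDb⟩ := H.exists_bound (continuous_pd k hη1)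
  let X : ℕ → Euc d → ℝ := fun n x => ρ x * κ n x
  have hX : ∀ n, ContDiff ℝ 1 (X n) := fun n =>
    contDiff_mul_of_tsupport H.isOpen hρ (hκ n).1 (hκ n).2.2.1
  have hXc : ∀ n, HasCompactSupport (X n) := fun n => (hκ n).2.1.mul_left
  have hXs : ∀ n, tsupport (X n) ⊆ Ω := fun n =>
    tsupport_mul_subset_right.trans (hκ n).2.2.1
  have hpd : ∀ n x, pd k (X n) x = ρ x * pd k (κ n) x + pd k ρ x * κ n x := fun n x =>
    pd_mul_of_tsupport H.isOpen hρ (hκ n).1 (hκ n).2.2.1 k x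
  have key : ∀ n, ∫ x, v x ^ 2 * pd k (X n) x = - 2 * ∫ x, v x * v' x * X n x := fun n => by
    have h1 := hw.integral_mul_mul H.isOpen hv hv' hw hv hv' (hX n) (hXc n) (hXs n)
    obtain ⟨a, ha⟩ := exists_bound_of_hasCompactSupport (hX n).continuous (hXc n)
    obtain ⟨b, hb⟩ := exists_bound_of_hasCompactSupport (continuous_pd k (hX n))
      (hasCompactSupport_pd k (hXc n))
    have i1 : Integrable fun x => v x * (v' x * X n x) :=
      hv.integrable_mul (memLp_mul_bounded hv' (hX n).continuous ha)
    have i2 : Integrable fun x => v x * (v x * pd k (X n) x) :=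
      hv.integrable_mul (memLp_mul_bounded hv (continuous_pd k (hX n)) hb)
    have e1 : ∫ x, v x * (v' x * X n x + v x * pd k (X n) x) =
        (∫ x, v x * v' x * X n x) + ∫ x, v x ^ 2 * pd k (X n) x := by
      rw [show (∫ x, v x * v' x * X n x) = ∫ x, v x * (v' x * X n x) by simp_rw [mul_assoc],
        show (∫ x, v x ^ 2 * pd k (X n) x) = ∫ x, v x * (v x * pd k (X n) x) by
          simp_rw [sq, mul_assoc], ← integral_add i1 i2]
      simp_rw [mul_add]
    have e2 : ∫ x, v' x * (v x * X n x) = ∫ x, v x * v' x * X n x :=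
      integral_congr_ae (ae_of_all _ fun x => by ring)
    rw [e1, e2] at h1
    linarith
  -- The derivative of the cutoff is at most a constant over `η` and tends to zero pointwise, so the
  -- integrability of `v² / η` removes the boundary term by dominated convergence.
  have l1 : Tendsto (fun n => ∫ x, v x ^ 2 * pd k (X n) x) atTop
      (𝓝 (∫ x, v x ^ 2 * pd k ρ x)) := by
    refine tendsto_integral_of_dominated_convergence
      (fun x => B * C * D * (v x ^ 2 / η x) + B * v x ^ 2)
      (fun n => (hv.1.pow 2).mul (continuous_pd k (hX n)).aestronglyMeasurable)
      ((hI.const_mul _).add (hv.integrable_sq.const_mul _))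
      (fun n => ae_of_all _ fun x => ?_) (ae_of_all _ fun x => ?_)
    · by_cases hx : x ∈ Ω
      · have hp := H.pos x hx
        have h0 : |pd k (κ n) x| ≤ C / η x * D := by
          rw [(hκ' n x hx).1, abs_mul]
          exact mul_le_mul (hκ' n x hx).2 (hDb x hx) (abs_nonneg _) (by positivity)
        have hB0 : 0 ≤ B := (abs_nonneg _).trans (hB x hx)
        have h1 : |ρ x * pd k (κ n) x| ≤ B * (C / η x * D) := by
          rw [abs_mul]
          exact mul_le_mul (hB x hx) h0 (abs_nonneg _) hB0
        have h2 : |pd k ρ x * κ n x| ≤ B := by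
          rw [abs_mul, abs_of_nonneg ((hκ n).2.2.2.1 x)]
          exact (mul_le_mul (hB' x hx) ((hκ n).2.2.2.2 x) ((hκ n).2.2.2.1 x) hB0).trans_eq
            (mul_one _)
        rw [hpd, Real.norm_eq_abs, abs_mul, abs_of_nonneg (sq_nonneg (v x))]
        calc v x ^ 2 * |ρ x * pd k (κ n) x + pd k ρ x * κ n x|
            ≤ v x ^ 2 * (B * (C / η x * D) + B) :=
              mul_le_mul_of_nonneg_left ((abs_add_le _ _).trans (add_le_add h1 h2)) (sq_nonneg _)
          _ = _ := by ring
      · simp [hv0 x hx]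
    · by_cases hx : x ∈ Ω
      · refine tendsto_const_nhds.congr' ?_
        filter_upwards [hlim x hx] with n hn
        rw [hpd, (hκ' n x hx).1, hn.1, hn.2]
        ring
      · simp [hv0 x hx]
  have l2 : Tendsto (fun n => ∫ x, v x * v' x * X n x) atTop
      (𝓝 (∫ x, v x * v' x * ρ x)) := by
    refine tendsto_integral_of_dominated_convergence (fun x => B * |v x * v' x|)
      (fun n => (hv.1.mul hv'.1).mul (hX n).continuous.aestronglyMeasurable)
      ((hv.integrable_mul hv').abs.const_mul _)
      (fun n => ae_of_all _ fun x => ?_) (ae_of_all _ fun x => ?_)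
    · by_cases hx : x ∈ Ω
      · have hB0 : 0 ≤ B := (abs_nonneg _).trans (hB x hx)
        have h2 : |X n x| ≤ B := by
          rw [abs_mul, abs_of_nonneg ((hκ n).2.2.2.1 x)]
          exact (mul_le_mul (hB x hx) ((hκ n).2.2.2.2 x) ((hκ n).2.2.2.1 x) hB0).trans_eq
            (mul_one _)
        rw [Real.norm_eq_abs, abs_mul, mul_comm]
        exact mul_le_mul_of_nonneg_right h2 (abs_nonneg _)
      · simp [hv0 x hx]
    · by_cases hx : x ∈ Ω
      · refine tendsto_const_nhds.congr' ?_
        filter_upwards [hlim x hx] with n hn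
        simp only [X]
        rw [hn.1, mul_one]
      · simp [hv0 x hx]
  simp_rw [key] at l1
  exact tendsto_nhds_unique l1 (l2.const_mul _)

end Hardy

section HardyInequality

variable {d : ℕ} {Ω : Set (Euc d)} {η : Euc d → ℝ}

theorem integrable_mul_of_bound_on {f ρ : Euc d → ℝ} (hf : Integrable f)
    (hf0 : ∀ x, x ∉ Ω → f x = 0) (hρ : Measurable ρ) {B : ℝ} (hB : ∀ x ∈ Ω, |ρ x| ≤ B) :
    Integrable fun x => f x * ρ x := by
  refine (hf.abs.const_mul B).mono' (hf.1.mul hρ.aestronglyMeasurable) (ae_of_all _ fun x => ?_)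
  by_cases hx : x ∈ Ω
  · rw [Real.norm_eq_abs, abs_mul, mul_comm]
    exact mul_le_mul_of_nonneg_right (hB x hx) (abs_nonneg _)
  · simp [hf0 x hx]

theorem pd_inv_pow (hη : ContDiff ℝ 1 η) {ε : ℝ} (m : ℕ) {x : Euc d} (hx : η x + ε ≠ 0)
    (k : Fin d) : DifferentiableAt ℝ (fun x => (η x + ε)⁻¹ ^ (m + 1)) x ∧
      pd k (fun x => (η x + ε)⁻¹ ^ (m + 1)) x =
      -((m + 1 : ℕ) * pd k η x * (η x + ε)⁻¹ ^ (m + 2)) := by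
  have h1 : HasDerivAt (fun t : ℝ => (t + ε)⁻¹ ^ (m + 1))
      ((m + 1 : ℕ) * (η x + ε)⁻¹ ^ m * (-1 / (η x + ε) ^ 2)) (η x) :=
    (((hasDerivAt_id (η x)).add_const ε).fun_inv hx).fun_pow (m + 1)
  have h2 := h1.comp_hasFDerivAt x (hη.differentiable one_ne_zero x).hasFDerivAt
  have h3 : HasFDerivAt (fun x => (η x + ε)⁻¹ ^ (m + 1)) _ x := h2
  refine ⟨h3.differentiableAt, ?_⟩
  rw [pd, h3.fderiv]
  have e : -1 / (η x + ε) ^ 2 = -(η x + ε)⁻¹ ^ 2 := by rw [neg_div, one_div, inv_pow]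
  rw [e]
  change _ * fderiv ℝ η x _ = _
  rw [pd]
  ring

/-- With `e = (η + ε)⁻¹`, the expression under the minus sign is the divergence of `v² e^(2s+1) ∇η`.
Its main part `-(2s+1) |∇η|² (v e^(s+1))²` is estimated by `|∇η|² ≥ c - η²`. Young's inequality
spends `c / 4` on the Laplacian and `c / 4` on `G`, leaving `c / 2`. The three summands of the
constant come from `η²`, the Laplacian and `G`. -/
theorem hardy_pointwise {c D ε η g lap v G : ℝ} (s : ℕ) (hc : 0 < c) (hε : 0 < ε) (hη : 0 < η)
    (hg : 0 ≤ g) (hcg : c ≤ g + η ^ 2) (hD : |lap| ≤ D) :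
    c / 2 * (v * (η + ε)⁻¹ ^ (s + 1)) ^ 2 ≤
      -(v ^ 2 * (lap * (η + ε)⁻¹ ^ (2 * s + 1) - (2 * s + 1 : ℕ) * g * (η + ε)⁻¹ ^ (2 * s + 2)) +
        2 * (v * ((η ^ s * G) * (η + ε)⁻¹ ^ (2 * s + 1)))) +
      (1 + D ^ 2 / c + 4 / c) * ((v / η ^ s) ^ 2 + G ^ 2) := by
  set e := (η + ε)⁻¹ with he
  have he0 : 0 < e := by positivity
  have hηe : η * e ≤ 1 := by
    rw [he, ← div_eq_mul_inv]
    exact (div_le_one (by positivity)).2 (by linarith)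
  have hηe0 : 0 ≤ η * e := by positivity
  set z := v * e ^ s with hz
  set p := (η * e) ^ s with hp
  have hp1 : p ≤ 1 := pow_le_one₀ hηe0 hηe
  have hp0 : 0 ≤ p := by positivity
  have hz2 : z ^ 2 ≤ (v / η ^ s) ^ 2 := by
    have e1 : z = v / η ^ s * p := by
      rw [hz, hp, mul_pow]; field_simp
    rw [e1, mul_pow]
    exact mul_le_of_le_one_right (sq_nonneg _) (pow_le_one₀ hp0 hp1)
  have e1 : v * e ^ (s + 1) = z * e := by rw [hz]; ring
  have e2 : v ^ 2 * (lap * e ^ (2 * s + 1) - (2 * s + 1 : ℕ) * g * e ^ (2 * s + 2)) +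
      2 * (v * ((η ^ s * G) * e ^ (2 * s + 1))) =
      lap * z ^ 2 * e - (2 * s + 1 : ℕ) * g * (z * e) ^ 2 + 2 * ((z * e) * (G * p)) := by
    rw [hz, hp]; ring
  rw [e1, e2]
  have hD0 : 0 ≤ D := (abs_nonneg _).trans hD
  have a1 : c * (z * e) ^ 2 - z ^ 2 ≤ (2 * s + 1 : ℕ) * g * (z * e) ^ 2 := by
    have h1 : (1 : ℝ) ≤ (2 * s + 1 : ℕ) := by
      exact_mod_cast Nat.le_add_left 1 (2 * s)
    have h2 : g * (z * e) ^ 2 ≤ (2 * s + 1 : ℕ) * g * (z * e) ^ 2 :=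
      mul_le_mul_of_nonneg_right (by nlinarith) (sq_nonneg _)
    have h3 : (c - η ^ 2) * (z * e) ^ 2 ≤ g * (z * e) ^ 2 :=
      mul_le_mul_of_nonneg_right (by linarith) (sq_nonneg _)
    have h4 : η ^ 2 * (z * e) ^ 2 ≤ z ^ 2 := by
      have : η ^ 2 * (z * e) ^ 2 = z ^ 2 * (η * e) ^ 2 := by ring
      rw [this]
      exact mul_le_of_le_one_right (sq_nonneg _) (pow_le_one₀ hηe0 hηe)
    linarith
  have a2 : lap * z ^ 2 * e ≤ c / 4 * (z * e) ^ 2 + D ^ 2 / c * z ^ 2 := by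
    have h1 : lap * z ^ 2 * e ≤ D * z ^ 2 * e := by
      have := (le_abs_self lap).trans hD
      gcongr
    have h2 : 0 ≤ (c / 2 * e - D) ^ 2 * z ^ 2 / c := by positivity
    have h3 : (c / 2 * e - D) ^ 2 * z ^ 2 / c =
        c / 4 * (z * e) ^ 2 + D ^ 2 / c * z ^ 2 - D * z ^ 2 * e := by
      field_simp; ring
    linarith
  have a3 : 2 * ((z * e) * (G * p)) ≤ c / 4 * (z * e) ^ 2 + 4 / c * G ^ 2 := by
    have h2 : 0 ≤ (c / 2 * (z * e) - 2 * (G * p)) ^ 2 / c := by positivity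
    have h3 : (c / 2 * (z * e) - 2 * (G * p)) ^ 2 / c =
        c / 4 * (z * e) ^ 2 + 4 / c * (G ^ 2 * p ^ 2) - 2 * ((z * e) * (G * p)) := by
      field_simp; ring
    have h4 : G ^ 2 * p ^ 2 ≤ G ^ 2 := mul_le_of_le_one_right (sq_nonneg _) (pow_le_one₀ hp0 hp1)
    have h5 : 4 / c * (G ^ 2 * p ^ 2) ≤ 4 / c * G ^ 2 := by gcongr
    linarith
  have a4 : (1 + D ^ 2 / c + 4 / c) * z ^ 2 ≤ (1 + D ^ 2 / c + 4 / c) * (v / η ^ s) ^ 2 := by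
    gcongr
  have a5 : 0 ≤ 4 / c * z ^ 2 := by positivity
  have a6 : 0 ≤ (1 + D ^ 2 / c) * G ^ 2 := by positivity
  nlinarith

/-- Hardy's inequality, in a form that improves by one the power of the distance to the boundary,
for functions that vanish at the boundary in a weak sense. -/
theorem IsDefining.exists_hardy (H : IsDefining Ω η) (s : ℕ) : ∃ K : ℝ, 0 ≤ K ∧
    ∀ (v G : Euc d → ℝ) (v' : Fin d → Euc d → ℝ), (∀ k, IsWeakPartial Ω k v (v' k)) →
      MemLp v 2 → (∀ k, MemLp (v' k) 2) → (∀ x, x ∉ Ω → v x = 0) →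
      (Integrable fun x => v x ^ 2 / η x) → (MemLp (fun x => v x / η x ^ s) 2) → MemLp G 2 →
      (∀ x ∈ Ω, ∑ k, pd k η x * v' k x = η x ^ s * G x) → ∀ ε, 0 < ε →
      ∫ x, (v x * (η x + ε)⁻¹ ^ (s + 1)) ^ 2 ≤
        K * ((∫ x, (v x / η x ^ s) ^ 2) + ∫ x, G x ^ 2) := by
  have hη1 : ContDiff ℝ 1 η := H.smooth.of_le (by norm_num)
  have hη2 : ∀ k, ContDiff ℝ 1 (pd k η) := fun k =>
    contDiff_pd (n := 1) k (H.smooth.of_le (by norm_num))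
  have hc2 : ∀ k, Continuous (pd k (pd k η)) := fun k => continuous_pd k (hη2 k)
  have hc1 : ∀ k, Continuous (pd k η) := fun k => (hη2 k).continuous
  obtain ⟨c, hc, hcg⟩ := H.exists_grad_lower
  obtain ⟨D, hD, hDb⟩ := H.exists_bound (f := fun x => ∑ k, pd k (pd k η) x)
    (continuous_finsetSum _ fun k _ => hc2 k)
  refine ⟨2 / c * (1 + D ^ 2 / c + 4 / c), by positivity,
    fun v G v' hw hv hv' hv0 hI hvs hG hGeq ε hε => ?_⟩
  let e : Euc d → ℝ := fun x => (η x + ε)⁻¹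
  have hem : Measurable e := (hη1.continuous.measurable.add_const ε).inv
  have hpos : ∀ x ∈ Ω, 0 < η x + ε := fun x hx => by linarith [H.pos x hx]
  have heb : ∀ x ∈ Ω, 0 < e x ∧ e x ≤ ε⁻¹ := fun x hx =>
    ⟨inv_pos.2 (hpos x hx), inv_anti₀ hε (by linarith [H.pos x hx])⟩
  have hep : ∀ (n : ℕ), ∀ x ∈ Ω, |e x ^ n| ≤ ε⁻¹ ^ n := fun n x hx => by
    rw [abs_of_nonneg (pow_nonneg (heb x hx).1.le n)]
    exact pow_le_pow_left₀ (heb x hx).1.le (heb x hx).2 n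
  -- The field `e^(2s+1) ∇η`; here `ε` keeps it bounded on `Ω`, while the constant of the inequality
  -- does not depend on `ε`.
  let ρ : Fin d → Euc d → ℝ := fun k x => pd k η x * e x ^ (2 * s + 1)
  let R : Fin d → Euc d → ℝ := fun k x =>
    pd k (pd k η) x * e x ^ (2 * s + 1) - (2 * s + 1 : ℕ) * pd k η x ^ 2 * e x ^ (2 * s + 2)
  have hρm : ∀ k, Measurable (ρ k) := fun k => (hc1 k).measurable.mul (hem.pow_const _)
  have hRm : ∀ k, Measurable (R k) := fun k =>
    ((hc2 k).measurable.mul (hem.pow_const _)).sub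
      ((((hc1 k).measurable.pow_const 2).const_mul _).mul (hem.pow_const _))
  have hpdρ : ∀ k, ∀ x ∈ Ω, pd k (ρ k) x = R k x := fun k x hx => by
    obtain ⟨h1, h2⟩ := pd_inv_pow hη1 (2 * s) (hpos x hx).ne' k
    have h3 := pd_mul ((hη2 k).differentiable one_ne_zero x) h1 k
    have h4 : pd k (ρ k) x = _ := h3
    rw [h4, h2]
    simp only [R, e]
    ring
  have hρB : ∀ k, ∃ B, ∀ x ∈ Ω, |ρ k x| ≤ B ∧ |R k x| ≤ B := fun k => by
    obtain ⟨B1, hB1, hB1'⟩ := H.exists_bound (hc1 k)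
    obtain ⟨B2, hB2, hB2'⟩ := H.exists_bound (hc2 k)
    have h1 : ∀ x ∈ Ω, |ρ k x| ≤ B1 * ε⁻¹ ^ (2 * s + 1) := fun x hx => by
      rw [abs_mul]
      exact mul_le_mul (hB1' x hx) (hep _ x hx) (abs_nonneg _) hB1.le
    have h2 : ∀ x ∈ Ω, |R k x| ≤ B2 * ε⁻¹ ^ (2 * s + 1) +
        (2 * s + 1 : ℕ) * B1 ^ 2 * ε⁻¹ ^ (2 * s + 2) := fun x hx => by
      refine (abs_sub _ _).trans (add_le_add ?_ ?_)
      · rw [abs_mul]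
        exact mul_le_mul (hB2' x hx) (hep _ x hx) (abs_nonneg _) hB2.le
      · rw [abs_mul, abs_mul, Nat.abs_cast, abs_pow]
        have := hB1' x hx
        have := hep (2 * s + 2) x hx
        gcongr
    refine ⟨_, fun x hx => ⟨(h1 x hx).trans (le_add_of_nonneg_right ?_),
      (h2 x hx).trans (le_add_of_nonneg_left ?_)⟩⟩
    all_goals positivity
  have hρc : ∀ k, ContDiffOn ℝ 1 (ρ k) Ω := fun k =>
    (hη2 k).contDiffOn.mul (((hη1.contDiffOn.add contDiffOn_const).inv
      fun x hx => (hpos x hx).ne').pow _)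
  have hvsq : Integrable fun x => v x ^ 2 := hv.integrable_sq
  have hvsq0 : ∀ x, x ∉ Ω → v x ^ 2 = 0 := fun x hx => by simp [hv0 x hx]
  have key : ∀ k, (∫ x, v x ^ 2 * R k x) + 2 * ∫ x, v x * v' k x * ρ k x = 0 := fun k => by
    obtain ⟨B, hB⟩ := hρB k
    have h1 := H.integral_sq_mul_pd (hw k) hv (hv' k) hv0 hI (hρc k) (fun x hx => (hB x hx).1)
      (fun x hx => (hpdρ k x hx).symm ▸ (hB x hx).2)
    have h2 : ∫ x, v x ^ 2 * R k x = ∫ x, v x ^ 2 * pd k (ρ k) x := by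
      refine integral_congr_ae (ae_of_all _ fun x => ?_)
      by_cases hx : x ∈ Ω
      · dsimp only; rw [hpdρ k x hx]
      · simp [hv0 x hx]
    rw [h2, h1]
    ring
  have i1 : ∀ k, Integrable fun x => v x ^ 2 * R k x := fun k => by
    obtain ⟨B, hB⟩ := hρB k
    exact integrable_mul_of_bound_on hvsq hvsq0 (hRm k) fun x hx => (hB x hx).2
  have i2 : ∀ k, Integrable fun x => v x * v' k x * ρ k x := fun k => by
    obtain ⟨B, hB⟩ := hρB k
    exact integrable_mul_of_bound_on (hv.integrable_mul (hv' k))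
      (fun x hx => by simp [hv0 x hx]) (hρm k) fun x hx => (hB x hx).1
  let J : Euc d → ℝ := fun x =>
    ∑ k, (v x ^ 2 * R k x + 2 * (v x * v' k x * ρ k x))
  have iJ : Integrable J := integrable_finsetSum _ fun k _ => (i1 k).add ((i2 k).const_mul 2)
  have hJ : ∫ x, J x = 0 := by
    have h1 : ∫ x, J x = ∑ k, ∫ x, (v x ^ 2 * R k x + 2 * (v x * v' k x * ρ k x)) :=
      integral_finsetSum _ fun k _ => (i1 k).add ((i2 k).const_mul 2)
    rw [h1]
    refine Finset.sum_eq_zero fun k _ => ?_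
    rw [integral_add (i1 k) ((i2 k).const_mul 2), integral_const_mul, key k]
  have hJe : ∀ x ∈ Ω, J x = v x ^ 2 * ((∑ k, pd k (pd k η) x) * e x ^ (2 * s + 1) -
      (2 * s + 1 : ℕ) * (∑ k, pd k η x ^ 2) * e x ^ (2 * s + 2)) +
      2 * (v x * ((η x ^ s * G x) * e x ^ (2 * s + 1))) := fun x hx => by
    rw [← hGeq x hx]
    simp only [J, R, ρ, Finset.sum_add_distrib, Finset.sum_mul, Finset.mul_sum,
      Finset.sum_sub_distrib, mul_sub]
    congr 1
    exact Finset.sum_congr rfl fun k _ => by ring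
  have iw : Integrable fun x => (v x * e x ^ (s + 1)) ^ 2 := by
    have := integrable_mul_of_bound_on hvsq hvsq0 (hem.pow_const (2 * (s + 1))) (hep _)
    refine this.congr (ae_of_all _ fun x => ?_)
    dsimp only
    rw [mul_pow, ← pow_mul, mul_comm (s + 1)]
  have iK := (hvs.integrable_sq.add hG.integrable_sq).const_mul (1 + D ^ 2 / c + 4 / c)
  have hmono : ∫ x, c / 2 * (v x * e x ^ (s + 1)) ^ 2 ≤
      ∫ x, (-J x + (1 + D ^ 2 / c + 4 / c) * ((v x / η x ^ s) ^ 2 + G x ^ 2)) := by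
    refine integral_mono (iw.const_mul _) (iJ.neg.add iK) fun x => ?_
    by_cases hx : x ∈ Ω
    · dsimp only
      rw [hJe x hx]
      exact hardy_pointwise s hc hε (H.pos x hx) (Finset.sum_nonneg fun k _ => sq_nonneg _)
        (hcg x hx) (hDb x hx)
    · simp only [J, hv0 x hx]
      have : 0 ≤ (1 + D ^ 2 / c + 4 / c) * G x ^ 2 := by positivity
      simpa using this
  have e2 : ∫ x, (-J x + (1 + D ^ 2 / c + 4 / c) * ((v x / η x ^ s) ^ 2 + G x ^ 2)) =
      (1 + D ^ 2 / c + 4 / c) * ((∫ x, (v x / η x ^ s) ^ 2) + ∫ x, G x ^ 2) := by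
    have h1 : ∫ x, (-J x + (1 + D ^ 2 / c + 4 / c) * ((v x / η x ^ s) ^ 2 + G x ^ 2)) =
        (∫ x, -J x) + ∫ x, (1 + D ^ 2 / c + 4 / c) * ((v x / η x ^ s) ^ 2 + G x ^ 2) :=
      integral_add iJ.neg iK
    rw [h1, integral_neg, hJ, neg_zero, zero_add, integral_const_mul,
      integral_add hvs.integrable_sq hG.integrable_sq]
  rw [e2, integral_const_mul] at hmono
  calc ∫ x, (v x * e x ^ (s + 1)) ^ 2
      = 2 / c * (c / 2 * ∫ x, (v x * e x ^ (s + 1)) ^ 2) := by field_simp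
    _ ≤ 2 / c * ((1 + D ^ 2 / c + 4 / c) * ((∫ x, (v x / η x ^ s) ^ 2) + ∫ x, G x ^ 2)) := by
        gcongr
    _ = _ := by ring

theorem norm_toL2_sq {f : Euc d → ℝ} (hf : MemLp f 2) :
    ‖toL2 volume f‖ ^ 2 = ∫ x, f x ^ 2 := by
  rw [← real_inner_self_eq_norm_sq, ← integral_mul_eq_inner hf hf]
  simp_rw [sq]

/-- Fatou's lemma in `L²`. -/
theorem memLp_of_tendsto_of_integral_sq_le {f : ℕ → Euc d → ℝ} {g : Euc d → ℝ}
    (hf : ∀ n, MemLp (f n) 2) {B : ℝ} (hB : ∀ n, ∫ x, f n x ^ 2 ≤ B)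
    (hlim : ∀ x, Tendsto (fun n => f n x) atTop (𝓝 (g x))) : MemLp g 2 := by
  have hle : ∀ n, eLpNorm (f n) 2 volume ≤ ENNReal.ofReal (Real.sqrt B) := fun n => by
    rw [← ENNReal.ofReal_toReal (hf n).2.ne]
    refine ENNReal.ofReal_le_ofReal (Real.le_sqrt_of_sq_le ?_)
    refine le_trans (le_of_eq ?_) (hB n)
    rw [← norm_toL2_sq (hf n), toL2_of_memLp (hf n), Lp.norm_toLp]
  refine ⟨aestronglyMeasurable_of_tendsto_ae atTop (fun n => (hf n).1) (ae_of_all _ hlim), ?_⟩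
  refine (Lp.eLpNorm_lim_le_liminf_eLpNorm (fun n => (hf n).1) g (ae_of_all _ hlim)).trans_lt ?_
  refine lt_of_le_of_lt (b := ENNReal.ofReal (Real.sqrt B)) ?_ ENNReal.ofReal_lt_top
  exact liminf_le_of_le (by isBoundedDefault) fun b hb => by
    obtain ⟨n, hn⟩ := hb.exists
    exact hn.trans (hle n)

theorem IsDefining.memLp_mul_inv_pow (H : IsDefining Ω η) {v : Euc d → ℝ} (hv : MemLp v 2)
    (hv0 : ∀ x, x ∉ Ω → v x = 0) {ε : ℝ} (hε : 0 < ε) (m : ℕ) :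
    MemLp (fun x => v x * (η x + ε)⁻¹ ^ m) 2 := by
  have hem : Measurable fun x => (η x + ε)⁻¹ ^ m :=
    ((H.smooth.continuous.measurable.add_const ε).inv).pow_const m
  refine hv.of_le_mul (c := ε⁻¹ ^ m) (hv.1.mul hem.aestronglyMeasurable) (ae_of_all _ fun x => ?_)
  by_cases hx : x ∈ Ω
  · have hp := H.pos x hx
    rw [norm_mul, mul_comm, norm_pow, norm_inv, Real.norm_of_nonneg (by linarith : 0 ≤ η x + ε)]
    have : (η x + ε)⁻¹ ≤ ε⁻¹ := inv_anti₀ hε (by linarith)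
    gcongr
  · simp [hv0 x hx]

/-- Fatou's lemma along `ε = 1 / (n + 1)`. -/
theorem IsDefining.memLp_div_of_bound (H : IsDefining Ω η) {v : Euc d → ℝ} (hv : MemLp v 2)
    (hv0 : ∀ x, x ∉ Ω → v x = 0) (m : ℕ) {B : ℝ}
    (hB : ∀ ε, 0 < ε → ∫ x, (v x * (η x + ε)⁻¹ ^ m) ^ 2 ≤ B) :
    MemLp (fun x => v x / η x ^ m) 2 := by
  refine memLp_of_tendsto_of_integral_sq_le
    (f := fun n x => v x * (η x + 1 / ((n : ℝ) + 1))⁻¹ ^ m)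
    (fun n => H.memLp_mul_inv_pow hv hv0 (by positivity) m)
    (fun n => hB _ (by positivity)) fun x => ?_
  by_cases hx : x ∈ Ω
  · have h1 := (tendsto_one_div_add_atTop_nhds_zero_nat (𝕜 := ℝ)).const_add (η x)
    rw [add_zero] at h1
    have := ((h1.inv₀ (H.pos x hx).ne').pow m).const_mul (v x)
    simpa [div_eq_mul_inv] using this
  · simp [hv0 x hx]

end HardyInequality

/-! ### Tangential derivatives vanish at the boundary. -/

section Division

variable {d : ℕ} {Ω : Set (Euc d)} {η : Euc d → ℝ}

theorem IsWeakPartial.congr {k : Fin d} {f f' g g' : Euc d → ℝ} (H : IsWeakPartial Ω k f f')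
    (h : ∀ x ∈ Ω, f x = g x) (h' : ∀ x ∈ Ω, f' x = g' x) : IsWeakPartial Ω k g g' := by
  intro φ hφ hφc hφs
  have e1 : ∫ x, g x * pd k φ x = ∫ x, f x * pd k φ x :=
    integral_congr_ae (ae_of_all _ fun x => by
      by_cases hx : x ∈ Ω
      · simp only [h x hx]
      · simp [pd_eq_zero_of_notMem_tsupport (fun h => hx (hφs h)) k])
  have e2 : ∫ x, g' x * φ x = ∫ x, f' x * φ x :=
    integral_congr_ae (ae_of_all _ fun x => by
      by_cases hx : x ∈ Ω
      · simp only [h' x hx]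
      · simp [image_eq_zero_of_notMem_tsupport (fun h => hx (hφs h))])
  rw [e1, e2, H φ hφ hφc hφs]

theorem IsWeakPartial.sub {k : Fin d} {f f' g g' : Euc d → ℝ} (H : IsWeakPartial Ω k f f')
    (H' : IsWeakPartial Ω k g g') (hf : MemLp f 2) (hf' : MemLp f' 2) (hg : MemLp g 2)
    (hg' : MemLp g' 2) : IsWeakPartial Ω k (fun x => f x - g x) fun x => f' x - g' x := by
  intro φ hφ hφc hφs
  have m1 : MemLp (pd k φ) 2 :=
    (continuous_pd k (contDiff_nat_of_smooth hφ 1)).memLp_of_hasCompactSupport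
      (hasCompactSupport_pd k hφc)
  have m2 : MemLp φ 2 := hφ.continuous.memLp_of_hasCompactSupport hφc
  have e1 : ∫ x, (f x - g x) * pd k φ x = (∫ x, f x * pd k φ x) - ∫ x, g x * pd k φ x := by
    have := integral_sub (hf.integrable_mul m1) (hg.integrable_mul m1)
    simp_rw [sub_mul]
    exact this
  have e2 : ∫ x, (f' x - g' x) * φ x = (∫ x, f' x * φ x) - ∫ x, g' x * φ x := by
    have := integral_sub (hf'.integrable_mul m2) (hg'.integrable_mul m2)
    simp_rw [sub_mul]
    exact this
  rw [e1, e2, H φ hφ hφc hφs, H' φ hφ hφc hφs]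
  ring

theorem IsWeakPartial.add {k : Fin d} {f f' g g' : Euc d → ℝ} (H : IsWeakPartial Ω k f f')
    (H' : IsWeakPartial Ω k g g') (hf : MemLp f 2) (hf' : MemLp f' 2) (hg : MemLp g 2)
    (hg' : MemLp g' 2) : IsWeakPartial Ω k (fun x => f x + g x) fun x => f' x + g' x := by
  intro φ hφ hφc hφs
  have m1 : MemLp (pd k φ) 2 :=
    (continuous_pd k (contDiff_nat_of_smooth hφ 1)).memLp_of_hasCompactSupport
      (hasCompactSupport_pd k hφc)
  have m2 : MemLp φ 2 := hφ.continuous.memLp_of_hasCompactSupport hφc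
  have e1 : ∫ x, (f x + g x) * pd k φ x = (∫ x, f x * pd k φ x) + ∫ x, g x * pd k φ x := by
    have := integral_add (hf.integrable_mul m1) (hg.integrable_mul m1)
    simp_rw [add_mul]
    exact this
  have e2 : ∫ x, (f' x + g' x) * φ x = (∫ x, f' x * φ x) + ∫ x, g' x * φ x := by
    have := integral_add (hf'.integrable_mul m2) (hg'.integrable_mul m2)
    simp_rw [add_mul]
    exact this
  rw [e1, e2, H φ hφ hφc hφs, H' φ hφ hφc hφs]
  ring

theorem memLp_mul_of_bound_on {f ρ : Euc d → ℝ} (hf : MemLp f 2)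
    (hf0 : ∀ x, x ∉ Ω → f x = 0) (hρ : Measurable ρ) {B : ℝ} (hB : ∀ x ∈ Ω, |ρ x| ≤ B) :
    MemLp (fun x => f x * ρ x) 2 := by
  refine hf.of_le_mul (c := B) (hf.1.mul hρ.aestronglyMeasurable) (ae_of_all _ fun x => ?_)
  by_cases hx : x ∈ Ω
  · rw [norm_mul, mul_comm]
    exact mul_le_mul_of_nonneg_right (hB x hx) (norm_nonneg _)
  · simp [hf0 x hx]

theorem IsDefining.memLp_mul (H : IsDefining Ω η) {f ρ : Euc d → ℝ} (hf : MemLp f 2)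
    (hf0 : ∀ x, x ∉ Ω → f x = 0) (hρ : Continuous ρ) : MemLp (fun x => f x * ρ x) 2 := by
  obtain ⟨B, -, hB⟩ := H.exists_bound hρ
  exact memLp_mul_of_bound_on hf hf0 hρ.measurable hB

/-- A function `u` in `H²` of the open set `Ω` (with its derivatives, all extended by zero) such
that `u / η` is square integrable. -/
structure IsSobZero (Ω : Set (Euc d)) (η u : Euc d → ℝ) (u₁ : Fin d → Euc d → ℝ)
    (u₂ : Fin d → Fin d → Euc d → ℝ) : Prop where
  mem : MemLp u 2
  mem₁ : ∀ i, MemLp (u₁ i) 2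
  mem₂ : ∀ i j, MemLp (u₂ i j) 2
  zero : ∀ x, x ∉ Ω → u x = 0
  zero₁ : ∀ i x, x ∉ Ω → u₁ i x = 0
  zero₂ : ∀ i j x, x ∉ Ω → u₂ i j x = 0
  weak₁ : ∀ i, IsWeakPartial Ω i u (u₁ i)
  weak₂ : ∀ i j, IsWeakPartial Ω j (u₁ i) (u₂ i j)
  div : MemLp (fun x => u x / η x) 2

/-- A function `q` such that `q`, `∇q` and `η D²q` are square integrable. -/
structure IsWeightedSob (Ω : Set (Euc d)) (η q : Euc d → ℝ) (q₁ : Fin d → Euc d → ℝ)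
    (q₂ : Fin d → Fin d → Euc d → ℝ) : Prop where
  mem : MemLp q 2
  mem₁ : ∀ i, MemLp (q₁ i) 2
  mem₂ : ∀ i j, MemLp (fun x => η x * q₂ i j x) 2
  zero : ∀ x, x ∉ Ω → q x = 0
  weak₁ : ∀ i, IsWeakPartial Ω i q (q₁ i)
  weak₂ : ∀ i j, IsWeakPartial Ω j (q₁ i) (q₂ i j)

/-- The derivative of `u` in a direction tangential to the level sets of `η`. -/
def tangential (η : Euc d → ℝ) (u₁ : Fin d → Euc d → ℝ) (i j : Fin d) (x : Euc d) : ℝ :=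
  u₁ i x * pd j η x - u₁ j x * pd i η x

theorem IsDefining.contDiff_pd (H : IsDefining Ω η) (k : Fin d) : ContDiff ℝ 1 (pd k η) :=
  DGM.contDiff_pd (n := 1) k (H.smooth.of_le (by norm_num))

theorem IsDefining.contDiff_one (H : IsDefining Ω η) : ContDiff ℝ 1 η :=
  H.smooth.of_le (by norm_num)

namespace IsSobZero

variable {u : Euc d → ℝ} {u₁ : Fin d → Euc d → ℝ} {u₂ : Fin d → Fin d → Euc d → ℝ}

theorem memLp_tangential (h : IsSobZero Ω η u u₁ u₂) (H : IsDefining Ω η) (i j : Fin d) :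
    MemLp (tangential η u₁ i j) 2 :=
  (H.memLp_mul (h.mem₁ i) (h.zero₁ i) (H.contDiff_pd j).continuous).sub
    (H.memLp_mul (h.mem₁ j) (h.zero₁ j) (H.contDiff_pd i).continuous)

theorem tangential_zero (h : IsSobZero Ω η u u₁ u₂) (i j : Fin d) (x : Euc d) (hx : x ∉ Ω) :
    tangential η u₁ i j x = 0 := by
  simp [tangential, h.zero₁ i x hx, h.zero₁ j x hx]

/-- The weak derivatives of the tangential derivatives. -/
def tangentialPartial (η : Euc d → ℝ) (u₁ : Fin d → Euc d → ℝ)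
    (u₂ : Fin d → Fin d → Euc d → ℝ) (i j k : Fin d) (x : Euc d) : ℝ :=
  (u₂ i k x * pd j η x + u₁ i x * pd k (pd j η) x) -
    (u₂ j k x * pd i η x + u₁ j x * pd k (pd i η) x)

theorem memLp_deriv_mul_pd (h : IsSobZero Ω η u u₁ u₂) (H : IsDefining Ω η) (i j k : Fin d) :
    MemLp (fun x => u₂ i k x * pd j η x + u₁ i x * pd k (pd j η) x) 2 :=
  (H.memLp_mul (h.mem₂ i k) (h.zero₂ i k) (H.contDiff_pd j).continuous).add
    (H.memLp_mul (h.mem₁ i) (h.zero₁ i) (continuous_pd k (H.contDiff_pd j)))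

theorem memLp_tangentialPartial (h : IsSobZero Ω η u u₁ u₂) (H : IsDefining Ω η)
    (i j k : Fin d) : MemLp (tangentialPartial η u₁ u₂ i j k) 2 :=
  (h.memLp_deriv_mul_pd H i j k).sub (h.memLp_deriv_mul_pd H j i k)

theorem isWeakPartial_tangential (h : IsSobZero Ω η u u₁ u₂) (H : IsDefining Ω η)
    (i j k : Fin d) : IsWeakPartial Ω k (tangential η u₁ i j) (tangentialPartial η u₁ u₂ i j k) :=
  ((h.weak₂ i k).mul H.isOpen (h.mem₁ i) (h.mem₂ i k) (H.contDiff_pd j).contDiffOn).sub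
    ((h.weak₂ j k).mul H.isOpen (h.mem₁ j) (h.mem₂ j k) (H.contDiff_pd i).contDiffOn)
    (H.memLp_mul (h.mem₁ i) (h.zero₁ i) (H.contDiff_pd j).continuous)
    (h.memLp_deriv_mul_pd H i j k)
    (H.memLp_mul (h.mem₁ j) (h.zero₁ j) (H.contDiff_pd i).continuous)
    (h.memLp_deriv_mul_pd H j i k)

theorem pd_inv (H : IsDefining Ω η) (m : ℕ) {x : Euc d} (hx : x ∈ Ω) (k : Fin d) :
    DifferentiableAt ℝ (fun x => (η x)⁻¹ ^ (m + 1)) x ∧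
      pd k (fun x => (η x)⁻¹ ^ (m + 1)) x = -((m + 1 : ℕ) * pd k η x * (η x)⁻¹ ^ (m + 2)) := by
  have := pd_inv_pow H.contDiff_one (ε := 0) m (x := x) (by simpa using (H.pos x hx).ne') k
  simpa only [add_zero] using this

theorem contDiffOn_inv (H : IsDefining Ω η) (m : ℕ) :
    ContDiffOn ℝ 1 (fun x => (η x)⁻¹ ^ m) Ω :=
  (H.contDiff_one.contDiffOn.inv fun x hx => (H.pos x hx).ne').pow m

/-- One factor `M = u₁ i ∂_j η - u₁ j ∂_i η` is integrated by parts against the weight `κ / η`. The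
operator `∂_j η ∂_i - ∂_i η ∂_j` annihilates functions of `η` and the mixed second derivatives of
`η` agree, so every derivative of the weight cancels. What is left is `u / η` times derivatives of
`M`, with no further negative power of `η`. -/
theorem integral_tangential_le (h : IsSobZero Ω η u u₁ u₂) (H : IsDefining Ω η) (i j : Fin d)
    {κ κ' : Euc d → ℝ} (hκ : ContDiff ℝ 1 κ) (hκc : HasCompactSupport κ) (hκs : tsupport κ ⊆ Ω)
    (hκ1 : ∀ x, |κ x| ≤ 1) (hκ' : ∀ x ∈ Ω, ∀ k, pd k κ x = κ' x * pd k η x) :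
    ∫ x, tangential η u₁ i j x * (tangential η u₁ i j x * ((η x)⁻¹ * κ x)) ≤
      ∫ x, |u x / η x| * (|tangentialPartial η u₁ u₂ i j i x * pd j η x| +
        |tangentialPartial η u₁ u₂ i j j x * pd i η x|) := by
  set M := tangential η u₁ i j
  set M' := tangentialPartial η u₁ u₂ i j
  have hM := h.memLp_tangential H i j
  have hM' := h.memLp_tangentialPartial H i j
  have hMz : ∀ k x, x ∉ Ω → M' k x = 0 := fun k x hx => by
    simp [M', tangentialPartial, h.zero₁ _ x hx, h.zero₂ _ _ x hx]
  have hinv : ContDiffOn ℝ 1 (fun x => (η x)⁻¹) Ω := by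
    simpa using contDiffOn_inv H 1
  have hρ : ∀ l, ContDiffOn ℝ 1 (fun x => pd l η x * (η x)⁻¹) Ω := fun l =>
    (H.contDiff_pd l).contDiffOn.mul hinv
  let X : Fin d → Euc d → ℝ := fun l x => pd l η x * (η x)⁻¹ * κ x
  have hX : ∀ l, ContDiff ℝ 1 (X l) := fun l => contDiff_mul_of_tsupport H.isOpen (hρ l) hκ hκs
  have hXc : ∀ l, HasCompactSupport (X l) := fun l => hκc.mul_left
  have hXs : ∀ l, tsupport (X l) ⊆ Ω := fun l => tsupport_mul_subset_right.trans hκs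
  have hpd : ∀ l k, ∀ x ∈ Ω, pd k (X l) x = pd l η x * (η x)⁻¹ * (κ' x * pd k η x) +
      (pd l η x * -(pd k η x * (η x)⁻¹ ^ 2) + pd k (pd l η) x * (η x)⁻¹) * κ x :=
    fun l k x hx => by
      obtain ⟨h1, h2⟩ := pd_inv H 0 hx k
      simp only [zero_add, pow_one, Nat.cast_one, one_mul] at h1 h2
      have h3 := pd_mul ((H.contDiff_pd l).differentiable one_ne_zero x) h1 k
      have h4 := pd_mul_of_tsupport H.isOpen (hρ l) hκ hκs k x
      rw [← hκ' x hx k, show pd k (X l) x = _ from h4, h3, h2]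
  have I1 := (h.weak₁ i).integral_mul_mul H.isOpen h.mem (h.mem₁ i)
    (h.isWeakPartial_tangential H i j i) hM (hM' i) (hX j) (hXc j) (hXs j)
  have I2 := (h.weak₁ j).integral_mul_mul H.isOpen h.mem (h.mem₁ j)
    (h.isWeakPartial_tangential H i j j) hM (hM' j) (hX i) (hXc i) (hXs i)
  choose b hb using fun l => exists_bound_of_hasCompactSupport (hX l).continuous (hXc l)
  choose b' hb' using fun l k => exists_bound_of_hasCompactSupport (continuous_pd k (hX l))
    (hasCompactSupport_pd k (hXc l))
  have J : ∀ l k, Integrable fun x => u x * (M' k x * X l x + M x * pd k (X l) x) := fun l k =>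
    h.mem.integrable_mul ((memLp_mul_bounded (hM' k) (hX l).continuous (hb l)).add
      (memLp_mul_bounded hM (continuous_pd k (hX l)) (hb' l k)))
  have J' : ∀ l k, Integrable fun x => u₁ k x * (M x * X l x) := fun l k =>
    (h.mem₁ k).integrable_mul (memLp_mul_bounded hM (hX l).continuous (hb l))
  have e1 : ∫ x, M x * (M x * ((η x)⁻¹ * κ x)) =
      (∫ x, u₁ i x * (M x * X j x)) - ∫ x, u₁ j x * (M x * X i x) := by
    rw [← integral_sub (J' j i) (J' i j)]
    refine integral_congr_ae (ae_of_all _ fun x => ?_)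
    simp only [X]
    rw [show M x = u₁ i x * pd j η x - u₁ j x * pd i η x from rfl]
    ring
  have e2 : ∫ x, M x * (M x * ((η x)⁻¹ * κ x)) =
      ∫ x, (u x * (M' j x * X i x + M x * pd j (X i) x) -
        u x * (M' i x * X j x + M x * pd i (X j) x)) := by
    rw [e1, integral_sub (J i j) (J j i), I1, I2]
    ring
  have hq : MemLp (fun x => |u x / η x|) 2 := h.div.norm
  have hb1 := (H.memLp_mul (hM' i) (hMz i) (H.contDiff_pd j).continuous).norm
  have hb2 := (H.memLp_mul (hM' j) (hMz j) (H.contDiff_pd i).continuous).norm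
  rw [e2]
  refine integral_mono ((J i j).sub (J j i)) (hq.integrable_mul (hb1.add hb2)) fun x => ?_
  by_cases hx : x ∈ Ω
  · have hp := H.pos x hx
    dsimp only
    rw [hpd i j x hx, hpd j i x hx, pd_comm (H.smooth.of_le (by norm_num)) i j]
    have e3 : u x * (M' j x * X i x + M x * (pd i η x * (η x)⁻¹ * (κ' x * pd j η x) +
        (pd i η x * -(pd j η x * (η x)⁻¹ ^ 2) + pd j (pd i η) x * (η x)⁻¹) * κ x)) -
        u x * (M' i x * X j x + M x * (pd j η x * (η x)⁻¹ * (κ' x * pd i η x) +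
        (pd j η x * -(pd i η x * (η x)⁻¹ ^ 2) + pd j (pd i η) x * (η x)⁻¹) * κ x)) =
        (u x / η x) * (M' j x * pd i η x - M' i x * pd j η x) * κ x := by
      simp only [X]
      rw [div_eq_mul_inv]
      ring
    rw [e3]
    refine (le_abs_self _).trans ?_
    rw [abs_mul, abs_mul]
    refine (mul_le_of_le_one_right (by positivity) (hκ1 x)).trans ?_
    refine mul_le_mul_of_nonneg_left ((abs_sub _ _).trans_eq (add_comm _ _)) (abs_nonneg _)
  · simp [h.zero x hx]

/-- The preceding bound is uniform in the cutoff, so Fatou's lemma applies to `M √(κ / η)`. This is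
the weak form of vanishing on the boundary that Hardy's inequality asks for. -/
theorem integrable_tangential (h : IsSobZero Ω η u u₁ u₂) (H : IsDefining Ω η) (i j : Fin d) :
    Integrable fun x => tangential η u₁ i j x ^ 2 / η x := by
  obtain ⟨κ, κ', C, hC, hκ, hκ', hκ0, hlim⟩ := H.exists_cutoff
  have hM := h.memLp_tangential H i j
  have hinv : ContDiffOn ℝ 1 (fun x => (η x)⁻¹) Ω := by
    simpa using contDiffOn_inv H 1
  have hw : ∀ n, Continuous fun x => (η x)⁻¹ * κ n x := fun n =>
    (contDiff_mul_of_tsupport H.isOpen hinv (hκ n).1 (hκ n).2.2.1).continuous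
  have hw0 : ∀ n x, 0 ≤ (η x)⁻¹ * κ n x := fun n x => by
    by_cases hx : x ∈ Ω
    · have := H.pos x hx
      have := (hκ n).2.2.2.1 x
      positivity
    · simp [hκ0 n x hx]
  have hsq : ∀ n x, (tangential η u₁ i j x * Real.sqrt ((η x)⁻¹ * κ n x)) ^ 2 =
      tangential η u₁ i j x * (tangential η u₁ i j x * ((η x)⁻¹ * κ n x)) := fun n x => by
    rw [mul_pow, Real.sq_sqrt (hw0 n x)]
    ring
  have hmem : MemLp (fun x => tangential η u₁ i j x * Real.sqrt (η x)⁻¹) 2 := by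
    refine memLp_of_tendsto_of_integral_sq_le
      (f := fun n x => tangential η u₁ i j x * Real.sqrt ((η x)⁻¹ * κ n x))
      (B := ∫ x, |u x / η x| * (|tangentialPartial η u₁ u₂ i j i x * pd j η x| +
        |tangentialPartial η u₁ u₂ i j j x * pd i η x|)) (fun n => ?_) (fun n => ?_) fun x => ?_
    · refine (memLp_two_iff_integrable_sq (hM.1.mul (hw n).sqrt.aestronglyMeasurable)).2 ?_
      simp only [Pi.mul_apply, hsq]
      obtain ⟨b, hb⟩ := exists_bound_of_hasCompactSupport (hw n) (hκ n).2.1.mul_left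
      exact hM.integrable_mul (memLp_mul_bounded hM (hw n) hb)
    · simp_rw [hsq]
      refine h.integral_tangential_le H i j (hκ n).1 (hκ n).2.1 (hκ n).2.2.1 (fun x => ?_)
        fun x hx => (hκ' n x hx).1
      rw [abs_of_nonneg ((hκ n).2.2.2.1 x)]
      exact (hκ n).2.2.2.2 x
    · by_cases hx : x ∈ Ω
      · refine tendsto_const_nhds.congr' ?_
        filter_upwards [hlim x hx] with n hn
        rw [hn.1, mul_one]
      · simp [h.tangential_zero i j x hx]
  refine hmem.integrable_sq.congr (ae_of_all _ fun x => ?_)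
  by_cases hx : x ∈ Ω
  · have := H.pos x hx
    dsimp only
    rw [mul_pow, Real.sq_sqrt (by positivity), div_eq_mul_inv]
  · simp [h.tangential_zero i j x hx]

/-- Hardy's inequality with `s = 0`, where `G` is the derivative along `∇η`. -/
theorem memLp_tangential_div (h : IsSobZero Ω η u u₁ u₂) (H : IsDefining Ω η) (i j : Fin d) :
    MemLp (fun x => tangential η u₁ i j x / η x) 2 := by
  obtain ⟨K, -, hK⟩ := H.exists_hardy 0
  have hz : ∀ k x, x ∉ Ω → tangentialPartial η u₁ u₂ i j k x = 0 := fun k x hx => by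
    simp [tangentialPartial, h.zero₁ _ x hx, h.zero₂ _ _ x hx]
  have hG : MemLp (fun x => ∑ k, pd k η x * tangentialPartial η u₁ u₂ i j k x) 2 :=
    memLp_finsetSum _ fun k _ => by
      simpa only [mul_comm] using
        H.memLp_mul (h.memLp_tangentialPartial H i j k) (hz k) (H.contDiff_pd k).continuous
  have := H.memLp_div_of_bound (h.memLp_tangential H i j) (h.tangential_zero i j) (0 + 1)
    (hK _ _ _ (h.isWeakPartial_tangential H i j) (h.memLp_tangential H i j)
      (h.memLp_tangentialPartial H i j) (h.tangential_zero i j) (h.integrable_tangential H i j)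
      (by simpa using h.memLp_tangential H i j) hG fun x _ => by simp)
  simpa using this

end IsSobZero

end Division

/-! ### Division by the defining function. -/

section Quotient

variable {d : ℕ} {Ω : Set (Euc d)} {η : Euc d → ℝ}

namespace IsSobZero

variable {u : Euc d → ℝ} {u₁ : Fin d → Euc d → ℝ} {u₂ : Fin d → Fin d → Euc d → ℝ}

/-- `η² ∂ᵢ(u / η)`. -/
def quotNum (η u : Euc d → ℝ) (u₁ : Fin d → Euc d → ℝ) (i : Fin d) (x : Euc d) : ℝ :=
  u₁ i x * η x - u x * pd i η x

/-- The derivative `∂ⱼ` of `η² ∂ᵢ(u / η)`, divided by `η`. -/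
def quotRem (η u : Euc d → ℝ) (u₁ : Fin d → Euc d → ℝ) (u₂ : Fin d → Fin d → Euc d → ℝ)
    (i j : Fin d) (x : Euc d) : ℝ :=
  u₂ i j x - u x / η x * pd j (pd i η) x + tangential η u₁ i j x / η x

theorem memLp_quotNum (h : IsSobZero Ω η u u₁ u₂) (H : IsDefining Ω η) (i : Fin d) :
    MemLp (quotNum η u u₁ i) 2 :=
  (H.memLp_mul (h.mem₁ i) (h.zero₁ i) H.contDiff_one.continuous).sub
    (H.memLp_mul h.mem h.zero (H.contDiff_pd i).continuous)

theorem quotNum_zero (h : IsSobZero Ω η u u₁ u₂) (i : Fin d) (x : Euc d) (hx : x ∉ Ω) :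
    quotNum η u u₁ i x = 0 := by
  simp [quotNum, h.zero x hx, h.zero₁ i x hx]

theorem memLp_quotRem (h : IsSobZero Ω η u u₁ u₂) (H : IsDefining Ω η) (i j : Fin d) :
    MemLp (quotRem η u u₁ u₂ i j) 2 :=
  ((h.mem₂ i j).sub (H.memLp_mul h.div (fun x hx => by simp [h.zero x hx])
    (continuous_pd j (H.contDiff_pd i)))).add (h.memLp_tangential_div H i j)

theorem quotRem_zero (h : IsSobZero Ω η u u₁ u₂) (i j : Fin d) (x : Euc d) (hx : x ∉ Ω) :
    quotRem η u u₁ u₂ i j x = 0 := by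
  simp [quotRem, h.zero x hx, h.zero₂ i j x hx, h.tangential_zero i j x hx]

theorem memLp_mul_quotRem (h : IsSobZero Ω η u u₁ u₂) (H : IsDefining Ω η) (i j : Fin d) :
    MemLp (fun x => η x * quotRem η u u₁ u₂ i j x) 2 := by
  simpa only [mul_comm] using
    H.memLp_mul (h.memLp_quotRem H i j) (h.quotRem_zero i j) H.contDiff_one.continuous

/-- In `∂_j(u₁ i η - u ∂_i η)` the terms of first order combine into a tangential derivative, which
like `u` is divisible by `η` in `L²`. The whole derivative thus carries a factor `η`. -/
theorem isWeakPartial_quotNum (h : IsSobZero Ω η u u₁ u₂) (H : IsDefining Ω η) (i j : Fin d) :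
    IsWeakPartial Ω j (quotNum η u u₁ i) fun x => η x * quotRem η u u₁ u₂ i j x := by
  have h1 := (h.weak₂ i j).mul H.isOpen (h.mem₁ i) (h.mem₂ i j) H.contDiff_one.contDiffOn
  have h2 := (h.weak₁ j).mul H.isOpen h.mem (h.mem₁ j) (H.contDiff_pd i).contDiffOn
  have hη := H.contDiff_one.continuous
  have hi := (H.contDiff_pd i).continuous
  refine (h1.sub h2 (H.memLp_mul (h.mem₁ i) (h.zero₁ i) hη)
    ((H.memLp_mul (h.mem₂ i j) (h.zero₂ i j) hη).add
      (H.memLp_mul (h.mem₁ i) (h.zero₁ i) (H.contDiff_pd j).continuous))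
    (H.memLp_mul h.mem h.zero hi)
    ((H.memLp_mul (h.mem₁ j) (h.zero₁ j) hi).add
      (H.memLp_mul h.mem h.zero (continuous_pd j (H.contDiff_pd i))))).congr
    (fun x _ => rfl) fun x hx => ?_
  have := (H.pos x hx).ne'
  rw [quotRem, tangential]
  field_simp
  ring

theorem memLp_quotNum_div (h : IsSobZero Ω η u u₁ u₂) (H : IsDefining Ω η) (i : Fin d) :
    MemLp (fun x => quotNum η u u₁ i x / η x) 2 := by
  have hz : ∀ x, x ∉ Ω → u x / η x = 0 := fun x hx => by simp [h.zero x hx]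
  refine ((h.mem₁ i).sub (H.memLp_mul h.div hz (H.contDiff_pd i).continuous)).ae_eq
    (ae_of_all _ fun x => ?_)
  by_cases hx : x ∈ Ω
  · have := (H.pos x hx).ne'
    simp only [Pi.sub_apply, quotNum]
    field_simp
  · simp [h.quotNum_zero i x hx, h.zero₁ i x hx, h.zero x hx]

/-- Hardy's inequality with `s = 1`: the quotient by `η` is `u₁ i - (u / η) ∂_i η`, already in `L²`,
and the factor `η` in the derivative gains a second power. -/
theorem memLp_quotNum_div_sq (h : IsSobZero Ω η u u₁ u₂) (H : IsDefining Ω η) (i : Fin d) :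
    MemLp (fun x => quotNum η u u₁ i x / η x ^ 2) 2 := by
  obtain ⟨K, -, hK⟩ := H.exists_hardy 1
  have hG : MemLp (fun x => ∑ k, pd k η x * quotRem η u u₁ u₂ i k x) 2 :=
    memLp_finsetSum _ fun k _ => by
      simpa only [mul_comm] using
        H.memLp_mul (h.memLp_quotRem H i k) (h.quotRem_zero i k) (H.contDiff_pd k).continuous
  have hd := h.memLp_quotNum_div H i
  have hI : Integrable fun x => quotNum η u u₁ i x ^ 2 / η x := by
    refine (hd.integrable_mul (h.memLp_quotNum H i)).congr (ae_of_all _ fun x => ?_)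
    simp only [Pi.mul_apply]
    ring
  exact H.memLp_div_of_bound (h.memLp_quotNum H i) (h.quotNum_zero i) (1 + 1)
    (hK _ _ _ (h.isWeakPartial_quotNum H i) (h.memLp_quotNum H i)
      (h.memLp_mul_quotRem H i) (h.quotNum_zero i) hI (by simpa using hd) hG
      fun x _ => by
        rw [pow_one, Finset.mul_sum]
        exact Finset.sum_congr rfl fun k _ => by ring)

/-- Division by the defining function. -/
theorem isWeightedSob (h : IsSobZero Ω η u u₁ u₂) (H : IsDefining Ω η) :
    IsWeightedSob Ω η (fun x => u x / η x) (fun i x => quotNum η u u₁ i x / η x ^ 2)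
      fun i j x => quotRem η u u₁ u₂ i j x / η x - 2 * quotNum η u u₁ i x * pd j η x / η x ^ 3 where
  mem := h.div
  mem₁ := h.memLp_quotNum_div_sq H
  mem₂ i j := by
    have h1 := H.memLp_mul (h.memLp_quotNum_div_sq H i)
      (fun x hx => by simp [h.quotNum_zero i x hx]) (H.contDiff_pd j).continuous
    refine ((h.memLp_quotRem H i j).sub (h1.const_mul 2)).ae_eq (ae_of_all _ fun x => ?_)
    by_cases hx : x ∈ Ω
    · have := (H.pos x hx).ne'
      simp only [Pi.sub_apply]
      field_simp
    · simp [h.quotRem_zero i j x hx, h.quotNum_zero i x hx]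
  zero x hx := by simp [h.zero x hx]
  weak₁ i := by
    refine ((h.weak₁ i).mul H.isOpen h.mem (h.mem₁ i) (contDiffOn_inv H (0 + 1))).congr
      (fun x _ => by simp [div_eq_mul_inv]) fun x hx => ?_
    rw [(pd_inv H 0 hx i).2, quotNum]
    have := (H.pos x hx).ne'
    push_cast
    field_simp
    ring
  weak₂ i j := by
    refine ((h.isWeakPartial_quotNum H i j).mul H.isOpen (h.memLp_quotNum H i)
      (h.memLp_mul_quotRem H i j) (contDiffOn_inv H (1 + 1))).congr
      (fun x _ => by simp [div_eq_mul_inv]) fun x hx => ?_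
    rw [(pd_inv H 1 hx j).2]
    have := (H.pos x hx).ne'
    push_cast
    field_simp
    ring

/-- Multiplication by a smooth function. -/
theorem mul_smooth (h : IsSobZero Ω η u u₁ u₂) (H : IsDefining Ω η) {ζ : Euc d → ℝ}
    (hζ : ContDiff ℝ (⊤ : ℕ∞) ζ) :
    IsSobZero Ω η (fun x => u x * ζ x) (fun i x => u₁ i x * ζ x + u x * pd i ζ x)
      fun i j x => (u₂ i j x * ζ x + u₁ i x * pd j ζ x) +
        (u₁ j x * pd i ζ x + u x * pd j (pd i ζ) x) := by
  have hζ2 : ContDiff ℝ (1 + 1 : ℕ) ζ := contDiff_nat_of_smooth hζ 2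
  have hζ1 : ContDiff ℝ 1 ζ := contDiff_nat_of_smooth hζ 1
  have hp : ∀ i, ContDiff ℝ 1 (pd i ζ) := fun i => DGM.contDiff_pd (n := 1) i hζ2
  have hc := hζ.continuous
  have m1 := H.memLp_mul h.mem h.zero hc
  have m2 := fun i => H.memLp_mul (h.mem₁ i) (h.zero₁ i) hc
  have m3 := fun i => H.memLp_mul h.mem h.zero (hp i).continuous
  have m4 := fun i j => H.memLp_mul (h.mem₂ i j) (h.zero₂ i j) hc
  have m5 := fun i j => H.memLp_mul (h.mem₁ i) (h.zero₁ i) (hp j).continuous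
  have m6 := fun i j => H.memLp_mul h.mem h.zero (continuous_pd j (hp i))
  refine ⟨m1, fun i => (m2 i).add (m3 i), fun i j => ((m4 i j).add (m5 i j)).add
    ((m5 j i).add (m6 i j)), fun x hx => by simp [h.zero x hx],
    fun i x hx => by simp [h.zero x hx, h.zero₁ i x hx],
    fun i j x hx => by simp [h.zero x hx, h.zero₁ _ x hx, h.zero₂ i j x hx],
    fun i => (h.weak₁ i).mul H.isOpen h.mem (h.mem₁ i) hζ1.contDiffOn, fun i j => ?_, ?_⟩
  · exact ((h.weak₂ i j).mul H.isOpen (h.mem₁ i) (h.mem₂ i j) hζ1.contDiffOn).add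
      ((h.weak₁ j).mul H.isOpen h.mem (h.mem₁ j) (hp i).contDiffOn) (m2 i)
      ((m4 i j).add (m5 i j)) (m3 i) ((m5 j i).add (m6 i j))
  · refine (H.memLp_mul h.div (fun x hx => by simp [h.zero x hx]) hc).ae_eq
      (ae_of_all _ fun x => ?_)
    ring

end IsSobZero

end Quotient

/-! ### Mollification of `u / η` with bounds in `ℋ²`. -/

section Approximation

variable {d : ℕ}

theorem IsComparable.exists_norm_toL2_le {Ω : Set (Euc d)} {μ : Measure (Euc d)}
    (h : IsComparable Ω μ) (hΩ : MeasurableSet Ω) :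
    ∃ K : ℝ, 0 ≤ K ∧ ∀ g G : Euc d → ℝ, MemLp g 2 μ → MemLp G 2 → (∀ x ∈ Ω, |g x| ≤ G x) →
      ‖toL2 μ g‖ ≤ K * ‖toL2 volume G‖ := by
  obtain ⟨C, hC⟩ := h.exists_eLpNorm_le
  refine ⟨C, C.2, fun g G hg hG hgG => ?_⟩
  rw [toL2_of_memLp hg, toL2_of_memLp hG, Lp.norm_toLp, Lp.norm_toLp, ← ENNReal.coe_toReal,
    ← ENNReal.toReal_mul]
  refine ENNReal.toReal_mono (ENNReal.mul_ne_top ENNReal.coe_ne_top hG.2.ne) ?_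
  refine (hC g).2.trans ?_
  gcongr
  refine (eLpNorm_mono_ae ?_).trans (eLpNorm_mono_measure G Measure.restrict_le_self)
  filter_upwards [ae_restrict_mem hΩ] with x hx
  exact (hgG x hx).trans (le_abs_self _)

variable {Ω : Set (Euc d)} {η : Euc d → ℝ}

/-- The kernel `φ` only sees points of `Ω` at which `η` is not much smaller, unless it does not
see the set `S` at all. -/
def IsAdapted (Ω : Set (Euc d)) (η : Euc d → ℝ) (S : Set (Euc d)) (C : ℝ) (φ : Euc d → ℝ) : Prop :=
  ∀ x ∈ Ω, (∀ t, x - t ∈ tsupport φ → t ∈ Ω ∧ η x ≤ C * η t) ∨ ∀ t ∈ S, x - t ∉ tsupport φ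

/-- Either the reflected and translated kernel is a test function in `Ω`, or it does not meet `S`
and both sides vanish. -/
theorem IsAdapted.pd_moll {S : Set (Euc d)} {C : ℝ} {φ : Euc d → ℝ} (ha : IsAdapted Ω η S C φ)
    (hφ : IsKernel φ) {k : Fin d} {f f' : Euc d → ℝ} (hw : IsWeakPartial Ω k f f')
    (hf : MemLp f 2) (hfS : ∀ x, x ∉ S → f x = 0) (hfS' : ∀ x, x ∉ S → f' x = 0) {x : Euc d}
    (hx : x ∈ Ω) : pd k (moll φ f) x = moll φ f' x := by
  refine pd_moll_eq (contDiff_nat_of_smooth hφ.smooth 1) hφ.compact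
    (hf.locallyIntegrable (by norm_num)) k x ?_
  have hts : ∀ t, t ∈ tsupport (fun t => φ (x - t)) → x - t ∈ tsupport φ := fun t ht =>
    tsupport_comp_subset_preimage φ (f := fun t => x - t) (by fun_prop) ht
  rcases ha x hx with h | h
  · exact hw _ (hφ.smooth.comp (contDiff_const.sub contDiff_id))
      (hφ.compact.comp_homeomorph (Homeomorph.subLeft x)) fun t ht => (h t (hts t ht)).1
  · have h1 : ∀ t, f t * pd k (fun t => φ (x - t)) t = 0 := fun t => by
      by_cases ht : t ∈ S
      · rw [pd_eq_zero_of_notMem_tsupport fun h' => h t ht (hts t h'), mul_zero]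
      · rw [hfS t ht, zero_mul]
    have h2 : ∀ t, f' t * φ (x - t) = 0 := fun t => by
      by_cases ht : t ∈ S
      · rw [image_eq_zero_of_notMem_tsupport (h t ht), mul_zero]
      · rw [hfS' t ht, zero_mul]
    simp_rw [h1, h2]
    simp

/-- Wherever the integrand is nonzero, `η x ≤ C η t`, so the weight moves under the convolution. -/
theorem IsAdapted.abs_mul_moll_le {S : Set (Euc d)} {C : ℝ} {φ : Euc d → ℝ}
    (ha : IsAdapted Ω η S C φ) (hC : 0 ≤ C) (hφ : IsKernel φ) {f : Euc d → ℝ}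
    (hf : MemLp (fun x => η x * f x) 2) (hfS : ∀ x, x ∉ S → f x = 0) {x : Euc d} (hx : x ∈ Ω)
    (hpos : 0 < η x) :
    |η x * moll φ f x| ≤ C * moll φ (fun t => |η t * f t|) x := by
  have hm : MemLp (fun t => φ (x - t)) 2 :=
    (hφ.smooth.continuous.comp (by fun_prop : Continuous fun t => x - t)).memLp_of_hasCompactSupport
      (hφ.compact.comp_homeomorph (Homeomorph.subLeft x))
  rw [moll_apply, moll_apply, ← integral_const_mul, ← integral_const_mul, ← Real.norm_eq_abs]
  refine norm_integral_le_of_norm_le ((hf.norm.integrable_mul hm).const_mul C)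
    (ae_of_all _ fun t => ?_)
  have hn := hφ.nonneg (x - t)
  rw [Real.norm_eq_abs, abs_mul, abs_mul, abs_of_pos hpos, abs_of_nonneg hn]
  by_cases hzero : f t * φ (x - t) = 0
  · have h1 : η x * (|f t| * φ (x - t)) = 0 := by
      rcases mul_eq_zero.1 hzero with h | h <;> simp [h]
    have h2 : C * (‖η t * f t‖ * φ (x - t)) = 0 := by
      rcases mul_eq_zero.1 hzero with h | h <;> simp [h]
    rw [h1]
    exact h2.ge
  · have hφt : x - t ∈ tsupport φ := subset_tsupport _ (right_ne_zero_of_mul hzero)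
    have htS : t ∈ S := by
      by_contra h
      exact hzero (by rw [hfS t h, zero_mul])
    rcases ha x hx with h | h
    · have h1 := (h t hφt).2
      calc η x * (|f t| * φ (x - t)) ≤ C * η t * (|f t| * φ (x - t)) := by gcongr
        _ ≤ C * (|η t * f t| * φ (x - t)) := by
          rw [abs_mul]
          have h3 := mul_le_mul_of_nonneg_right (le_abs_self (η t))
            (mul_nonneg (abs_nonneg (f t)) hn)
          nlinarith
    · exact absurd hφt (h t htS)

theorem norm_toL2_abs {f : Euc d → ℝ} (hf : MemLp f 2) :
    ‖toL2 volume fun x => |f x|‖ = ‖toL2 volume f‖ := by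
  rw [toL2_of_memLp hf, toL2_of_memLp (f := fun x => |f x|) hf.norm, Lp.norm_toLp, Lp.norm_toLp]
  exact congrArg _ (eLpNorm_norm f)

theorem norm_toL2_add_le {f g : Euc d → ℝ} (hf : MemLp f 2) (hg : MemLp g 2) :
    ‖toL2 volume fun x => f x + g x‖ ≤ ‖toL2 volume f‖ + ‖toL2 volume g‖ := by
  rw [toL2_add hf hg]
  exact norm_add_le _ _

theorem norm_toL2_const_mul_abs {f : Euc d → ℝ} (hf : MemLp f 2) {c : ℝ} (hc : 0 ≤ c) :
    ‖toL2 volume fun x => c * |f x|‖ = c * ‖toL2 volume f‖ := by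
  rw [toL2_const_mul c (f := fun x => |f x|) hf.norm, norm_smul, norm_toL2_abs hf,
    Real.norm_of_nonneg hc]

theorem pd_pd_mul {f g : Euc d → ℝ} (hf : ContDiff ℝ 2 f) (hg : ContDiff ℝ 2 g) (i j : Fin d)
    (x : Euc d) : pd j (pd i fun x => f x * g x) x =
      f x * pd j (pd i g) x + pd j f x * pd i g x + (pd i f x * pd j g x +
        pd j (pd i f) x * g x) := by
  have hf1 : ContDiff ℝ 1 f := hf.of_le (by norm_num)
  have hg1 : ContDiff ℝ 1 g := hg.of_le (by norm_num)
  have hf' : ContDiff ℝ 1 (pd i f) := contDiff_pd (n := 1) i hf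
  have hg' : ContDiff ℝ 1 (pd i g) := contDiff_pd (n := 1) i hg
  have e : (pd i fun x => f x * g x) = fun x => f x * pd i g x + pd i f x * g x := by
    funext y
    exact pd_mul (hf1.differentiable one_ne_zero y) (hg1.differentiable one_ne_zero y) i
  have h1 := pd_mul (hf1.differentiable one_ne_zero x) (hg'.differentiable one_ne_zero x) j
  have h2 := pd_mul (hf'.differentiable one_ne_zero x) (hg1.differentiable one_ne_zero x) j
  have h3 := fderiv_fun_add ((hf1.mul hg').differentiable one_ne_zero x)
    ((hf'.mul hg1).differentiable one_ne_zero x)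
  rw [e, ← h1, ← h2, pd, h3]
  rfl

/-- By the product rule all terms but one carry a bounded factor and `q` or `∇q`, which are in `L²`.
The exception, `η` times the mollified `D²q`, is bounded after moving `η` inside. No bound depends
on the scale of `φ`. -/
theorem IsWeightedSob.exists_norm_jet_le {Ω : TopologicalSpace.Opens (Euc d)}
    {μ : Measure (Euc d)} (hμ : IsComparable (Ω : Set (Euc d)) μ)
    (H : IsDefining (Ω : Set (Euc d)) η) {q : Euc d → ℝ} {q₁ : Fin d → Euc d → ℝ}
    {q₂ : Fin d → Fin d → Euc d → ℝ} (hq : IsWeightedSob (Ω : Set (Euc d)) η q q₁ q₂)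
    {S : Set (Euc d)} (hS : ∀ x, x ∉ S → q x = 0) (hS₁ : ∀ i x, x ∉ S → q₁ i x = 0)
    (hS₂ : ∀ i j x, x ∉ S → q₂ i j x = 0) {C : ℝ} (hC : 0 ≤ C) :
    ∃ B : ℝ, ∀ φ : Euc d → ℝ, IsKernel φ → IsAdapted (Ω : Set (Euc d)) η S C φ →
      ‖jet μ fun x => η x * moll φ q x‖ ≤ B := by
  have hη2 : ContDiff ℝ 2 η := H.smooth.of_le (by norm_num)
  suffices h : ∀ I : MIdx d, ∃ B : ℝ, ∀ φ : Euc d → ℝ, IsKernel φ →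
      IsAdapted (Ω : Set (Euc d)) η S C φ → ‖toL2 μ (pderiv I.2 fun x => η x * moll φ q x)‖ ≤ B by
    choose B hB using h
    exact ⟨∑ I, B I, fun φ hφ ha => (norm_toLp_le_sum _).trans
      (Finset.sum_le_sum fun I _ => hB I φ hφ ha)⟩
  obtain ⟨K, hK, hKb⟩ := hμ.exists_norm_toL2_le Ω.isOpen.measurableSet
  obtain ⟨D, hD, hDb⟩ := H.exists_bound hη2.continuous
  choose D₁ hD₁ hDb₁ using fun i => H.exists_bound (H.contDiff_pd i).continuous
  choose D₂ hD₂ hDb₂ using fun i j => H.exists_bound (continuous_pd j (H.contDiff_pd i))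
  have hli : ∀ {f : Euc d → ℝ}, MemLp f 2 → LocallyIntegrable f := fun hf =>
    hf.locallyIntegrable (by norm_num)
  have hF : ∀ φ, IsKernel φ → ContDiff ℝ 2 (moll φ q) := fun φ hφ =>
    contDiff_nat_of_smooth (contDiff_moll hφ.smooth hφ.compact (hli hq.mem)) 2
  have hmem : ∀ φ, IsKernel φ → ∀ I : MIdx d,
      MemLp (pderiv I.2 fun x => η x * moll φ q x) 2 μ := fun φ hφ I =>
    hμ.memLp_of_continuousOn H.bounded (continuous_pderiv_midx (hη2.mul (hF φ hφ)) I) 2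
  have hd1 : ∀ φ, IsKernel φ → IsAdapted (Ω : Set (Euc d)) η S C φ → ∀ i, ∀ x ∈ (Ω : Set (Euc d)),
      pd i (moll φ q) x = moll φ (q₁ i) x := fun φ hφ ha i x hx =>
    ha.pd_moll hφ (hq.weak₁ i) hq.mem hS (hS₁ i) hx
  have hd2 : ∀ φ, IsKernel φ → IsAdapted (Ω : Set (Euc d)) η S C φ → ∀ i j,
      ∀ x ∈ (Ω : Set (Euc d)), pd j (pd i (moll φ q)) x = moll φ (q₂ i j) x :=
    fun φ hφ ha i j x hx => by
      rw [← ha.pd_moll hφ (hq.weak₂ i j) (hq.mem₁ i) (hS₁ i) (hS₂ i j) hx, pd, pd]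
      refine congrFun (congrArg _ (Filter.EventuallyEq.fderiv_eq ?_)) _
      filter_upwards [Ω.isOpen.mem_nhds hx] with y hy using hd1 φ hφ ha i y hy
  have hn : ∀ φ, IsKernel φ → ∀ {c : ℝ} {f : Euc d → ℝ}, 0 ≤ c → MemLp f 2 →
      MemLp (fun x => c * |moll φ f x|) 2 ∧
      ‖toL2 volume fun x => c * |moll φ f x|‖ ≤ c * ‖toL2 volume f‖ := fun φ hφ c f hc hf => by
    refine ⟨(memLp_moll hφ hf).norm.const_mul c, ?_⟩
    rw [norm_toL2_const_mul_abs (memLp_moll hφ hf) hc]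
    exact mul_le_mul_of_nonneg_left (norm_toL2_moll_le hφ hf) hc
  rintro ⟨m, I⟩
  fin_cases m
  · refine ⟨K * (D * ‖toL2 volume q‖), fun φ hφ ha => ?_⟩
    obtain ⟨h1, h2⟩ := hn φ hφ hD.le hq.mem
    refine (hKb _ _ (hmem φ hφ ⟨0, I⟩) h1 fun x hx => ?_).trans
      (mul_le_mul_of_nonneg_left h2 hK)
    rw [pderiv_zero_order, abs_mul]
    exact mul_le_mul_of_nonneg_right (hDb x hx) (abs_nonneg _)
  · let i := I 0
    refine ⟨K * (D * ‖toL2 volume (q₁ i)‖ + D₁ i * ‖toL2 volume q‖), fun φ hφ ha => ?_⟩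
    obtain ⟨h1, h2⟩ := hn φ hφ hD.le (hq.mem₁ i)
    obtain ⟨h3, h4⟩ := hn φ hφ (hD₁ i).le hq.mem
    refine (hKb _ _ (hmem φ hφ ⟨1, I⟩) (h1.add h3) fun x hx => ?_).trans
      (mul_le_mul_of_nonneg_left ((norm_toL2_add_le h1 h3).trans (add_le_add h2 h4)) hK)
    have e : pderiv (m := 1) I (fun x => η x * moll φ q x) x =
        η x * moll φ (q₁ i) x + pd i η x * moll φ q x := by
      rw [pderiv_one_order, pd_mul (H.contDiff_one.differentiable one_ne_zero x)
        ((hF φ hφ).differentiable two_ne_zero x), hd1 φ hφ ha _ x hx]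
    change |pderiv (m := 1) I (fun x => η x * moll φ q x) x| ≤ _
    rw [e]
    refine (abs_add_le _ _).trans ?_
    rw [abs_mul, abs_mul]
    have := hDb x hx
    have := hDb₁ i x hx
    simp only [Pi.add_apply]
    gcongr
  · let i := I 0
    let j := I 1
    have hm2 : MemLp (fun x => |η x * q₂ j i x|) 2 := (hq.mem₂ j i).norm
    refine ⟨K * ((C * ‖toL2 volume fun x => |η x * q₂ j i x|‖ + D₁ i * ‖toL2 volume (q₁ j)‖) +
      (D₁ j * ‖toL2 volume (q₁ i)‖ + D₂ j i * ‖toL2 volume q‖)), fun φ hφ ha => ?_⟩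
    obtain ⟨h1, h2⟩ := hn φ hφ hC hm2
    obtain ⟨h3, h4⟩ := hn φ hφ (hD₁ i).le (hq.mem₁ j)
    obtain ⟨h5, h6⟩ := hn φ hφ (hD₁ j).le (hq.mem₁ i)
    obtain ⟨h7, h8⟩ := hn φ hφ (hD₂ j i).le hq.mem
    refine (hKb _ _ (hmem φ hφ ⟨2, I⟩) ((h1.add h3).add (h5.add h7)) fun x hx => ?_).trans
      (mul_le_mul_of_nonneg_left ((norm_toL2_add_le (h1.add h3) (h5.add h7)).trans
        (add_le_add ((norm_toL2_add_le h1 h3).trans (add_le_add h2 h4))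
          ((norm_toL2_add_le h5 h7).trans (add_le_add h6 h8)))) hK)
    have e : pderiv (m := 2) I (fun x => η x * moll φ q x) x =
        η x * moll φ (q₂ j i) x + pd i η x * moll φ (q₁ j) x +
          (pd j η x * moll φ (q₁ i) x + pd i (pd j η) x * moll φ q x) := by
      rw [pderiv_two_order I (hη2.mul (hF φ hφ)), pd_pd_mul hη2 (hF φ hφ), hd1 φ hφ ha _ x hx,
        hd1 φ hφ ha _ x hx, hd2 φ hφ ha _ _ x hx]
    have h9 := (ha.abs_mul_moll_le hC hφ (hq.mem₂ j i) (hS₂ j i) hx (H.pos x hx)).trans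
      (mul_le_mul_of_nonneg_left (le_abs_self _) hC)
    change |pderiv (m := 2) I (fun x => η x * moll φ q x) x| ≤ _
    rw [e]
    refine (abs_add_le _ _).trans (add_le_add ((abs_add_le _ _).trans (add_le_add h9 ?_))
      ((abs_add_le _ _).trans (add_le_add ?_ ?_)))
    all_goals rw [abs_mul]; refine mul_le_mul_of_nonneg_right ?_ (abs_nonneg _)
    · exact hDb₁ i x hx
    · exact hDb₁ j x hx
    · exact hDb₂ j i x hx

end Approximation

/-! ### Approximation by functions `η f`, locally and globally. -/

section LocalApproximation

variable {d : ℕ} {Ω : TopologicalSpace.Opens (Euc d)} {η : Euc d → ℝ} {μ : Measure (Euc d)}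

variable (η μ) in
/-- `u` is the limit in `L²(μ)` of functions `η f` with smooth `f` that are bounded in `H²`. -/
def IsApproximable (u : Euc d → ℝ) : Prop :=
  ∃ (f : ℕ → Euc d → ℝ) (B : ℝ),
    (∀ n, ContDiff ℝ (⊤ : ℕ∞) (f n) ∧ HasCompactSupport (f n) ∧
      ‖jet μ fun x => η x * f n x‖ ≤ B) ∧
    Tendsto (fun n => toL2 μ fun x => η x * f n x) atTop (𝓝 (toL2 μ u))

theorem IsComparable.memLp_of_memLp (hμ : IsComparable (Ω : Set (Euc d)) μ) {f : Euc d → ℝ}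
    (hf : MemLp f 2) : MemLp f 2 μ :=
  hμ.memLp_of_volume (hf.restrict _)

/-- A kernel centred at `-δ y₀` averages `q` near `x + δ y₀`, with `y₀` the inward direction of
`IsDefining.exists_inward`; such kernels are adapted, which bounds the jets, and mollification
converges in `L²`. -/
theorem IsWeightedSob.isApproximable (hμ : IsComparable (Ω : Set (Euc d)) μ)
    (H : IsDefining (Ω : Set (Euc d)) η) {x₀ : Euc d} (hx₀ : x₀ ∈ closure (Ω : Set (Euc d))) :
    ∃ r, 0 < r ∧ ∀ (q : Euc d → ℝ) (q₁ : Fin d → Euc d → ℝ) (q₂ : Fin d → Fin d → Euc d → ℝ),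
      IsWeightedSob (Ω : Set (Euc d)) η q q₁ q₂ → (∀ x, x ∉ Metric.closedBall x₀ r → q x = 0) →
      (∀ i x, x ∉ Metric.closedBall x₀ r → q₁ i x = 0) →
      (∀ i j x, x ∉ Metric.closedBall x₀ r → q₂ i j x = 0) →
      IsApproximable η μ fun x => η x * q x := by
  obtain ⟨y₀, ρ, r, δ₀, C, hρ, hr, hδ₀, hC, hin⟩ := H.exists_inward hx₀
  refine ⟨r / 2, by positivity, fun q q₁ q₂ hq hS hS₁ hS₂ => ?_⟩
  have hη2 : ContDiff ℝ 2 η := H.smooth.of_le (by norm_num)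
  obtain ⟨B, hB⟩ := hq.exists_norm_jet_le hμ H hS hS₁ hS₂ hC.le
  obtain ⟨K, hK, hKb⟩ := hμ.exists_norm_toL2_le Ω.isOpen.measurableSet
  obtain ⟨D, hD, hDb⟩ := H.exists_bound hη2.continuous
  have hL : 0 < ‖y₀‖ + ρ := by positivity
  -- The displacement is at most `r / 4`, so a point from which the kernel sees the closed ball of
  -- radius `r / 2` lies in the ball of radius `r`.
  let δ₁ := min δ₀ (r / (4 * (‖y₀‖ + ρ)))
  have hδ₁ : 0 < δ₁ := lt_min hδ₀ (by positivity)
  let δ : ℕ → ℝ := fun n => δ₁ / (n + 1)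
  have hδ : ∀ n, 0 < δ n := fun n => by positivity
  have hδle : ∀ n, δ n ≤ δ₁ := fun n => div_le_self hδ₁.le (by
    linarith [(Nat.cast_nonneg n : (0 : ℝ) ≤ n)])
  have hδr : ∀ n, δ n * (‖y₀‖ + ρ) ≤ r / 4 := fun n => by
    have h1 : δ n ≤ r / (4 * (‖y₀‖ + ρ)) := (hδle n).trans (min_le_right _ _)
    calc δ n * (‖y₀‖ + ρ) ≤ r / (4 * (‖y₀‖ + ρ)) * (‖y₀‖ + ρ) := by gcongr
      _ = r / 4 := by field_simp
  choose φ hφ hφs using fun n : ℕ =>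
    exists_isKernel (-(δ n • y₀)) (ρ := δ n * (ρ / 2)) (mul_pos (hδ n) (by positivity))
  have hts : ∀ n, ∀ s ∈ tsupport (φ n), ‖s + δ n • y₀‖ ≤ δ n * (ρ / 2) := fun n s hs => by
    rw [tsupport, hφs] at hs
    have := Metric.closure_ball_subset_closedBall hs
    rwa [mem_closedBall_iff_norm, sub_neg_eq_add] at this
  have hts' : ∀ n, ∀ s ∈ tsupport (φ n), ‖s‖ ≤ δ n * (‖y₀‖ + ρ) := fun n s hs => by
    have h1 := hts n s hs
    have h2 := norm_sub_le (s + δ n • y₀) (δ n • y₀)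
    rw [add_sub_cancel_right, norm_smul, Real.norm_of_nonneg (hδ n).le] at h2
    nlinarith [hδ n]
  have hball : ∀ n x t, t ∈ Metric.closedBall x₀ (r / 2) → x - t ∈ tsupport (φ n) →
      x ∈ Metric.ball x₀ r := fun n x t ht hxt => by
    have h1 := (hts' n _ hxt).trans (hδr n)
    rw [mem_closedBall_iff_norm] at ht
    rw [mem_ball_iff_norm, ← sub_add_sub_cancel x t x₀]
    refine (norm_add_le _ _).trans_lt ?_
    linarith
  have ha : ∀ n, IsAdapted (Ω : Set (Euc d)) η (Metric.closedBall x₀ (r / 2)) C (φ n) := by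
    intro n x hx
    by_cases hxr : x ∈ Metric.ball x₀ r
    · refine Or.inl fun t ht => ?_
      have hy : (δ n)⁻¹ • (t - x) ∈ Metric.ball y₀ ρ := by
        have e : (δ n)⁻¹ • (t - x) - y₀ = -((δ n)⁻¹ • (x - t + δ n • y₀)) := by
          rw [smul_add, inv_smul_smul₀ (hδ n).ne', ← neg_sub x t, smul_neg]
          abel
        rw [mem_ball_iff_norm, e, norm_neg, norm_smul, norm_inv, Real.norm_of_nonneg (hδ n).le,
          inv_mul_lt_iff₀ (hδ n)]
        exact (hts n _ ht).trans_lt (mul_lt_mul_of_pos_left (by linarith) (hδ n))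
      have := hin x ⟨hx, hxr⟩ _ hy (δ n) (hδ n) ((hδle n).trans (min_le_left _ _))
      rwa [smul_inv_smul₀ (hδ n).ne', add_sub_cancel] at this
    · exact Or.inr fun t ht h' => hxr (hball n x t ht h')
  have hli : LocallyIntegrable q := hq.mem.locallyIntegrable (by norm_num)
  refine ⟨fun n => moll (φ n) q, B, fun n => ⟨contDiff_moll (hφ n).smooth (hφ n).compact hli,
    HasCompactSupport.intro (isCompact_closedBall x₀ r) fun x hx => moll_eq_zero fun t ht => ?_,
    hB _ (hφ n) (ha n)⟩, ?_⟩
  · refine hS _ fun h => hx (Metric.ball_subset_closedBall (hball n x (x - t) h ?_))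
    rw [sub_sub_cancel]
    exact subset_tsupport _ ht
  · have hr0 : Tendsto (fun n => δ n * (‖y₀‖ + ρ)) atTop (𝓝 0) := by
      have := (tendsto_one_div_add_atTop_nhds_zero_nat (𝕜 := ℝ)).const_mul (δ₁ * (‖y₀‖ + ρ))
      rw [mul_zero] at this
      refine this.congr fun n => ?_
      simp only [δ]
      ring
    have hlim := tendsto_toL2_moll hφ hr0 (fun n t ht => hts' n t (subset_tsupport _ ht)) hq.mem
    rw [tendsto_iff_norm_sub_tendsto_zero] at hlim ⊢
    refine squeeze_zero (fun n => norm_nonneg _) (fun n => ?_)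
      ((hlim.const_mul (K * D)).trans_eq (by rw [mul_zero]))
    have hm := memLp_moll (hφ n) hq.mem
    have hsub : MemLp (fun x => moll (φ n) q x - q x) 2 := hm.sub hq.mem
    have h1 : MemLp (fun x => η x * moll (φ n) q x) 2 μ :=
      hμ.memLp_of_continuousOn H.bounded (hη2.continuous.mul
        (contDiff_moll (hφ n).smooth (hφ n).compact hli).continuous) 2
    have h2 : MemLp (fun x => η x * q x) 2 μ := hμ.memLp_of_memLp (by
      simpa only [mul_comm] using H.memLp_mul hq.mem hq.zero hη2.continuous)
    rw [← toL2_sub h1 h2, ← toL2_sub hm hq.mem, mul_assoc, ← norm_toL2_const_mul_abs hsub hD.le]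
    refine hKb _ _ (h1.sub h2) (hsub.norm.const_mul D) fun x hx => ?_
    rw [← mul_sub, abs_mul]
    exact mul_le_mul_of_nonneg_right (hDb x hx) (abs_nonneg _)

theorem IsApproximable.add (hμ : IsComparable (Ω : Set (Euc d)) μ)
    (H : IsDefining (Ω : Set (Euc d)) η) {u v : Euc d → ℝ} (hu : MemLp u 2) (hv : MemLp v 2)
    (h : IsApproximable η μ u) (h' : IsApproximable η μ v) :
    IsApproximable η μ fun x => u x + v x := by
  obtain ⟨f, B, hf, hlim⟩ := h
  obtain ⟨g, B', hg, hlim'⟩ := h'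
  have hη2 : ContDiff ℝ 2 η := H.smooth.of_le (by norm_num)
  have hf2 : ∀ n, ContDiff ℝ 2 fun x => η x * f n x := fun n =>
    hη2.mul (contDiff_nat_of_smooth (hf n).1 2)
  have hg2 : ∀ n, ContDiff ℝ 2 fun x => η x * g n x := fun n =>
    hη2.mul (contDiff_nat_of_smooth (hg n).1 2)
  have e : ∀ n, (fun x => η x * (f n x + g n x)) = fun x => η x * f n x + η x * g n x :=
    fun n => funext fun x => mul_add _ _ _
  refine ⟨fun n x => f n x + g n x, B + B', fun n => ⟨(hf n).1.add (hg n).1,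
    (hf n).2.1.add (hg n).2.1, ?_⟩, ?_⟩
  · rw [e, jet_add hμ H.bounded (hf2 n) (hg2 n)]
    exact (norm_add_le _ _).trans (add_le_add (hf n).2.2 (hg n).2.2)
  · rw [toL2_add (hμ.memLp_of_memLp hu) (hμ.memLp_of_memLp hv)]
    refine (hlim.add hlim').congr fun n => ?_
    rw [e, toL2_add (hμ.memLp_of_continuousOn H.bounded (hf2 n).continuous 2)
      (hμ.memLp_of_continuousOn H.bounded (hg2 n).continuous 2)]

theorem isApproximable_zero : IsApproximable η μ fun _ => 0 := by
  refine ⟨fun _ _ => 0, ‖jet μ fun _ : Euc d => 0‖, fun n => ⟨contDiff_const,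
    HasCompactSupport.intro isCompact_empty fun _ _ => rfl, ?_⟩, ?_⟩
  · simp
  · simp only [mul_zero]
    exact tendsto_const_nhds

theorem IsApproximable.sum (hμ : IsComparable (Ω : Set (Euc d)) μ)
    (H : IsDefining (Ω : Set (Euc d)) η) {ι : Type*} (s : Finset ι) {u : ι → Euc d → ℝ}
    (hu : ∀ i, MemLp (u i) 2) (h : ∀ i, IsApproximable η μ (u i)) :
    IsApproximable η μ fun x => ∑ i ∈ s, u i x := by
  classical
  induction s using Finset.induction_on with
  | empty => simpa using isApproximable_zero
  | insert i s hi ih =>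
    simp only [Finset.sum_insert hi]
    exact (h i).add hμ H (hu i) (memLp_finsetSum s fun i _ => hu i) ih

open scoped Manifold in
/-- A smooth partition of unity on a compact set, subordinate to a family of balls. -/
theorem exists_partition_of_unity {K : Set (Euc d)} (hK : IsCompact K) {r : Euc d → ℝ}
    (hr : ∀ x ∈ K, 0 < r x) : ∃ (t : Finset (Euc d)) (ζ : t → Euc d → ℝ),
      (∀ i : t, (i : Euc d) ∈ K) ∧ (∀ i, ContDiff ℝ (⊤ : ℕ∞) (ζ i)) ∧
      (∀ i, tsupport (ζ i) ⊆ Metric.ball (i : Euc d) (r i)) ∧ ∀ x ∈ K, ∑ i, ζ i x = 1 := by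
  obtain ⟨t, htK, hcov⟩ := hK.elim_nhds_subcover (fun x => Metric.ball x (r x))
    fun x hx => Metric.ball_mem_nhds x (hr x hx)
  obtain ⟨f, hf⟩ := SmoothPartitionOfUnity.exists_isSubordinate 𝓘(ℝ, Euc d) hK.isClosed
    (fun i : t => Metric.ball (i : Euc d) (r i)) (fun _ => Metric.isOpen_ball) (fun x hx => by
      obtain ⟨i, hi, hxi⟩ := Set.mem_iUnion₂.1 (hcov hx)
      exact Set.mem_iUnion.2 ⟨⟨i, hi⟩, hxi⟩)
  refine ⟨t, fun i => f i, fun i => htK (i : Euc d) i.2, fun i => (f i).contMDiff.contDiff, hf,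
    fun x hx => ?_⟩
  rw [← finsum_eq_sum_of_fintype]
  exact f.sum_eq_one hx

/-- Multiplication by a smooth cutoff preserves the hypotheses on `u`, so a partition of unity
reduces to small balls, where the quotient by `η` can be mollified. -/
theorem IsSobZero.isApproximable (hμ : IsComparable (Ω : Set (Euc d)) μ)
    (H : IsDefining (Ω : Set (Euc d)) η) {u : Euc d → ℝ} {u₁ : Fin d → Euc d → ℝ}
    {u₂ : Fin d → Fin d → Euc d → ℝ} (h : IsSobZero (Ω : Set (Euc d)) η u u₁ u₂) :
    IsApproximable η μ u := by
  classical
  choose! r hr hloc using fun x₀ (hx₀ : x₀ ∈ closure (Ω : Set (Euc d))) =>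
    IsWeightedSob.isApproximable hμ H hx₀
  obtain ⟨t, ζ, htK, hζ, hζs, hζ1⟩ := exists_partition_of_unity H.isCompact_closure hr
  have hsum : (fun x => ∑ i, u x * ζ i x) = u := funext fun x => by
    by_cases hx : x ∈ (Ω : Set (Euc d))
    · rw [← Finset.mul_sum, hζ1 x (subset_closure hx), mul_one]
    · simp [h.zero x hx]
  rw [← hsum]
  refine IsApproximable.sum hμ H Finset.univ (u := fun i x => u x * ζ i x)
    (fun i => (h.mul_smooth H (hζ i)).mem) fun i => ?_
  have hm := h.mul_smooth H (hζ i)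
  have hz : ∀ x, x ∉ Metric.closedBall (i : Euc d) (r i) → x ∉ tsupport (ζ i) := fun x hx hx' =>
    hx (Metric.ball_subset_closedBall (hζs i hx'))
  have z0 : ∀ x, x ∉ Metric.closedBall (i : Euc d) (r i) → ζ i x = 0 := fun x hx =>
    image_eq_zero_of_notMem_tsupport (hz x hx)
  have z1 : ∀ k x, x ∉ Metric.closedBall (i : Euc d) (r i) → pd k (ζ i) x = 0 := fun k x hx =>
    pd_eq_zero_of_notMem_tsupport (hz x hx) k
  have z2 : ∀ k l x, x ∉ Metric.closedBall (i : Euc d) (r i) → pd l (pd k (ζ i)) x = 0 :=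
    fun k l x hx => pd_eq_zero_of_notMem_tsupport
      (fun h' => hz x hx (tsupport_pd_subset k h')) l
  have := hloc i (htK i) _ _ _ (hm.isWeightedSob H) (fun x hx => by simp [z0 x hx])
    (fun k x hx => by simp [IsSobZero.quotNum, z0 x hx, z1 k x hx])
    (fun k l x hx => by
      simp [IsSobZero.quotNum, IsSobZero.quotRem, tangential, z0 x hx, z1 _ x hx, z2 k l x hx])
  refine (congrArg (IsApproximable η μ) (funext fun x => ?_)).mp this
  by_cases hx : x ∈ (Ω : Set (Euc d))
  · have := (H.pos x hx).ne'
    field_simp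
  · simp [h.zero x hx]

end LocalApproximation

/-! ### Functions of `ℋ² ∩ ℋ¹₀` and conclusion. -/

section ZeroExtension

variable {d : ℕ} {Ω : TopologicalSpace.Opens (Euc d)} {η : Euc d → ℝ} {μ : Measure (Euc d)}

theorem setIntegral_mul_eq (f ψ : Euc d → ℝ) : ∫ x in (Ω : Set (Euc d)), f x * ψ x =
    ∫ x, (Ω : Set (Euc d)).indicator f x * ψ x := by
  rw [← integral_indicator Ω.isOpen.measurableSet]
  simp_rw [Set.indicator_mul_left]

theorem HasWeakDeriv.isWeakPartial {I : Fin 1 → Fin d} {f g : Euc d → ℝ}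
    (h : HasWeakDeriv Ω I f g) : IsWeakPartial (Ω : Set (Euc d)) (I 0)
      ((Ω : Set (Euc d)).indicator f) ((Ω : Set (Euc d)).indicator g) := by
  intro φ hφ hφc hφs
  have h1 : ∫ x in (Ω : Set (Euc d)), f x * pderiv I φ x =
      (-1) ^ 1 * ∫ x in (Ω : Set (Euc d)), g x * φ x := h ⟨φ, hφ, hφc, hφs⟩
  rw [setIntegral_mul_eq, setIntegral_mul_eq, pderiv_one_order] at h1
  linarith

/-- The first derivative is tested with `∂φ`, the second with `φ`; both evaluate the same integral
of `f`. -/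
theorem HasWeakDeriv.isWeakPartial_of_two {I : Fin 1 → Fin d} {J : Fin 2 → Fin d}
    {f g k : Euc d → ℝ} (h : HasWeakDeriv Ω I f g) (h' : HasWeakDeriv Ω J f k) (hIJ : J 0 = I 0) :
    IsWeakPartial (Ω : Set (Euc d)) (J 1)
      ((Ω : Set (Euc d)).indicator g) ((Ω : Set (Euc d)).indicator k) := by
  intro φ hφ hφc hφs
  have h2 : ∫ x in (Ω : Set (Euc d)), f x * pderiv J φ x =
      (-1) ^ 2 * ∫ x in (Ω : Set (Euc d)), k x * φ x := h' ⟨φ, hφ, hφc, hφs⟩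
  have hsm : ContDiff ℝ (⊤ : ℕ∞) (pd (J 1) φ) :=
    (hφ.fderiv_right (m := (⊤ : ℕ∞)) (by simp)).clm_apply contDiff_const
  have h1 := h.isWeakPartial (pd (J 1) φ) hsm (hasCompactSupport_pd _ hφc)
    ((tsupport_pd_subset _).trans hφs)
  rw [setIntegral_mul_eq, setIntegral_mul_eq,
    pderiv_two_order J (contDiff_nat_of_smooth hφ 2), hIJ] at h2
  linarith

theorem IsComparable.memLp_indicator (hμ : IsComparable (Ω : Set (Euc d)) μ) {f : Euc d → ℝ}
    (hf : MemLp f 2 μ) : MemLp ((Ω : Set (Euc d)).indicator f) 2 :=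
  (memLp_indicator_iff_restrict Ω.isOpen.measurableSet).2 (hμ.memLp_volume hf)

theorem IsComparable.exists_norm_indicator_le (hμ : IsComparable (Ω : Set (Euc d)) μ) :
    ∃ K : ℝ, 0 ≤ K ∧ ∀ f : Euc d → ℝ, MemLp f 2 μ →
      ‖toL2 volume ((Ω : Set (Euc d)).indicator f)‖ ≤ K * ‖toL2 μ f‖ := by
  obtain ⟨C, hC⟩ := hμ.exists_eLpNorm_le
  refine ⟨C, C.2, fun f hf => ?_⟩
  rw [toL2_of_memLp (hμ.memLp_indicator hf), toL2_of_memLp hf, Lp.norm_toLp, Lp.norm_toLp,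
    ← ENNReal.coe_toReal, ← ENNReal.toReal_mul,
    eLpNorm_indicator_eq_eLpNorm_restrict Ω.isOpen.measurableSet]
  exact ENNReal.toReal_mono (ENNReal.mul_ne_top ENNReal.coe_ne_top hf.2.ne) (hC f).1

theorem TestFunction.contDiff_smooth (φ : TestFunction Ω ℝ ⊤) :
    ContDiff ℝ (⊤ : ℕ∞) (φ : Euc d → ℝ) :=
  φ.contDiff

theorem TestFunction.indicator_eq (φ : TestFunction Ω ℝ ⊤) :
    (Ω : Set (Euc d)).indicator φ = φ :=
  Set.indicator_eq_self.2 ((subset_tsupport _).trans φ.tsupport_subset)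

theorem norm_weakDeriv_le_sobolevNorm {p m : ℕ} (hm : m ≤ p) (I : Fin m → Fin d) (f : L2 μ) :
    ‖weakDeriv Ω μ I f‖ ≤ sobolevNorm Ω μ p f :=
  (Finset.single_le_sum (f := fun I : Fin m → Fin d => ‖weakDeriv Ω μ I f‖)
    (fun _ _ => norm_nonneg _) (Finset.mem_univ I)).trans
    (Finset.single_le_sum (f := fun m => ∑ I : Fin m → Fin d, ‖weakDeriv Ω μ I f‖)
      (fun _ _ => Finset.sum_nonneg fun _ _ => norm_nonneg _)
      (Finset.mem_range.2 (Nat.lt_succ_of_le hm)))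

/-- Functions in `H¹₀` are limits of test functions, in `L²` and with bounded gradients. -/
theorem MemH10.exists_testFunction (hμ : IsComparable (Ω : Set (Euc d)) μ)
    (hb : Bornology.IsBounded (Ω : Set (Euc d))) {u : L2 μ} (hu : MemH10 Ω μ u) {τ : ℝ}
    (hτ : 0 < τ) (hτ1 : τ ≤ 1) : ∃ φ : TestFunction Ω ℝ ⊤, ‖u - toL2 μ φ‖ ≤ τ ∧
      ∀ k, ‖toL2 μ (pd k φ)‖ ≤ ‖weakDeriv Ω μ (fun _ : Fin 1 => k) u‖ + 1 := by
  obtain ⟨φ, hφ⟩ := hu.2 τ hτ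
  have hφ2 : ContDiff ℝ 2 φ := contDiff_nat_of_smooth (TestFunction.contDiff_smooth φ) 2
  refine ⟨φ, ?_, fun k => ?_⟩
  · have := (norm_weakDeriv_le_sobolevNorm (Nat.zero_le 1) Fin.elim0 (u - toL2 μ φ)).trans hφ.le
    rwa [weakDeriv_eq hμ (hasWeakDeriv_zero_order _ _)] at this
  · have h1 : HasWeakDeriv Ω (fun _ : Fin 1 => k) (toL2 μ φ) (toL2 μ (pd k φ)) := by
      have := jet_mem hμ hb hφ2 ⟨1, fun _ : Fin 1 => k⟩
      rw [jet_zero, jet_apply] at this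
      have e : pderiv (m := 1) (fun _ : Fin 1 => k) φ = pd k φ := pderiv_one_order _ _
      rw [← e]
      exact this
    have h2 := hasWeakDeriv_weakDeriv (hu.1 1 le_rfl fun _ : Fin 1 => k)
    have h3 := HasWeakDeriv.add Ω μ hμ h2 (HasWeakDeriv.smul Ω μ hμ (-1) h1)
    have h4 := (norm_weakDeriv_le_sobolevNorm le_rfl (fun _ : Fin 1 => k)
      (u - toL2 μ φ)).trans hφ.le
    rw [neg_smul, one_smul, neg_smul, one_smul, ← sub_eq_add_neg, ← sub_eq_add_neg] at h3
    rw [weakDeriv_eq hμ h3] at h4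
    have h5 := norm_sub_norm_le (toL2 μ (pd k φ)) (weakDeriv Ω μ (fun _ : Fin 1 => k) u)
    rw [norm_sub_rev] at h5
    linarith

/-- Hardy's inequality for test functions. -/
theorem IsDefining.exists_hardy_testFunction (H : IsDefining (Ω : Set (Euc d)) η) :
    ∃ K : ℝ, 0 ≤ K ∧ ∀ φ : TestFunction Ω ℝ ⊤, ∀ ε, 0 < ε →
      ∫ x, (φ x * (η x + ε)⁻¹ ^ 1) ^ 2 ≤ K * ((∫ x, φ x ^ 2) + ∑ k, ∫ x, pd k φ x ^ 2) := by
  obtain ⟨K, hK, hKb⟩ := H.exists_hardy 0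
  choose D hD hDb using fun k => H.exists_bound (H.contDiff_pd k).continuous
  refine ⟨K * (1 + ∑ k, d * D k ^ 2), by positivity, fun φ ε hε => ?_⟩
  have hφ1 : ContDiff ℝ 1 φ := contDiff_nat_of_smooth (TestFunction.contDiff_smooth φ) 1
  have hφc := φ.hasCompactSupport
  have hφs := φ.tsupport_subset
  have hp : ∀ k, MemLp (pd k φ) 2 := fun k =>
    (continuous_pd k hφ1).memLp_of_hasCompactSupport (hasCompactSupport_pd k hφc)
  have hz : ∀ x, x ∉ (Ω : Set (Euc d)) → φ x = 0 := fun x hx =>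
    image_eq_zero_of_notMem_tsupport fun h => hx (hφs h)
  have hz' : ∀ k x, x ∉ (Ω : Set (Euc d)) → pd k φ x = 0 := fun k x hx =>
    pd_eq_zero_of_notMem_tsupport (fun h => hx (hφs h)) k
  have hm : MemLp φ 2 := φ.continuous.memLp_of_hasCompactSupport hφc
  have hG : MemLp (fun x => ∑ k, pd k η x * pd k φ x) 2 := memLp_finsetSum _ fun k _ => by
    simpa only [mul_comm] using H.memLp_mul (hp k) (hz' k) (H.contDiff_pd k).continuous
  have hI : Integrable fun x => φ x ^ 2 / η x := by
    have h1 := (contDiff_mul_of_tsupport H.isOpen (IsSobZero.contDiffOn_inv H 1) hφ1 hφs).continuous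
    have h2 : MemLp (fun x => (η x)⁻¹ ^ 1 * φ x) 2 := h1.memLp_of_hasCompactSupport hφc.mul_left
    refine (hm.integrable_mul h2).congr (ae_of_all _ fun x => ?_)
    simp only [Pi.mul_apply, pow_one]
    ring
  have key := hKb φ (fun x => ∑ k, pd k η x * pd k φ x) (fun k => pd k φ)
    (fun k => isWeakPartial_pd hφ1 _ k) hm hp hz hI (by simpa using hm) hG
    (fun x _ => by simp) ε hε
  rw [zero_add] at key
  refine key.trans ?_
  rw [mul_assoc]
  refine mul_le_mul_of_nonneg_left ?_ hK
  have hsum0 : 0 ≤ ∑ k, ∫ x, pd k φ x ^ 2 :=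
    Finset.sum_nonneg fun k _ => integral_nonneg fun x => sq_nonneg _
  have h0 : 0 ≤ ∫ x, φ x ^ 2 := integral_nonneg fun x => sq_nonneg _
  have hG2 : ∫ x, (∑ k, pd k η x * pd k φ x) ^ 2 ≤
      ∑ k, d * D k ^ 2 * ∫ x, pd k φ x ^ 2 := by
    have h1 : ∀ k, Integrable fun x => d * D k ^ 2 * pd k φ x ^ 2 := fun k =>
      (hp k).integrable_sq.const_mul _
    have e : ∑ k, d * D k ^ 2 * ∫ x, pd k φ x ^ 2 =
        ∫ x, ∑ k, d * D k ^ 2 * pd k φ x ^ 2 := by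
      rw [integral_finsetSum _ fun k _ => h1 k]
      simp_rw [integral_const_mul]
    rw [e]
    refine integral_mono hG.integrable_sq (integrable_finsetSum _ fun k _ => h1 k) fun x => ?_
    by_cases hx : x ∈ (Ω : Set (Euc d))
    · refine (sq_sum_le_card_mul_sum_sq (s := Finset.univ)).trans ?_
      rw [Finset.mul_sum, Finset.card_univ, Fintype.card_fin]
      refine Finset.sum_le_sum fun k _ => ?_
      rw [mul_pow, mul_assoc]
      have h2 : pd k η x ^ 2 ≤ D k ^ 2 := sq_le_sq' (abs_le.1 (hDb k x hx)).1
        (abs_le.1 (hDb k x hx)).2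
      gcongr
    · simp [hz' _ x hx]
  have hG3 : ∑ k, d * D k ^ 2 * ∫ x, pd k φ x ^ 2 ≤
      (∑ k, d * D k ^ 2) * ∑ k, ∫ x, pd k φ x ^ 2 := by
    rw [Finset.sum_mul]
    refine Finset.sum_le_sum fun k _ => mul_le_mul_of_nonneg_left ?_ (by positivity)
    exact Finset.single_le_sum (f := fun k => ∫ x, pd k φ x ^ 2)
      (fun k _ => integral_nonneg fun x => sq_nonneg _) (Finset.mem_univ k)
  have h4 : 0 ≤ (∑ k, d * D k ^ 2) * ∫ x, φ x ^ 2 := by positivity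
  simp only [pow_zero, div_one]
  linarith

/-- For each `ε` a test function `φ` is chosen within `ε` of `u`. Then `(u - φ) / (η + ε)` is
bounded in `L²` because the distance compensates `1 / ε`, and `φ / (η + ε)` is bounded by Hardy's
inequality. The bound is uniform in `ε`. -/
theorem MemH10.memLp_div (hμ : IsComparable (Ω : Set (Euc d)) μ)
    (H : IsDefining (Ω : Set (Euc d)) η) {u : L2 μ} (hu : MemH10 Ω μ u) :
    MemLp (fun x => (Ω : Set (Euc d)).indicator u x / η x) 2 := by
  obtain ⟨K, hK, hKb⟩ := H.exists_hardy_testFunction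
  obtain ⟨L, hL, hLb⟩ := hμ.exists_norm_indicator_le
  set U := (Ω : Set (Euc d)).indicator u with hU
  have hUm : MemLp U 2 := hμ.memLp_indicator (Lp.memLp u)
  have hU0 : ∀ x, x ∉ (Ω : Set (Euc d)) → U x = 0 := fun x hx => Set.indicator_of_notMem hx _
  let b : Fin d → ℝ := fun k => L * (‖weakDeriv Ω μ (fun _ : Fin 1 => k) u‖ + 1)
  let B := K * ((‖toL2 volume U‖ + L) ^ 2 + ∑ k, b k ^ 2)
  have hB : 0 ≤ B := by positivity
  have := H.memLp_div_of_bound hUm hU0 1 (B := (L + Real.sqrt B) ^ 2) fun ε hε => ?_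
  · simpa using this
  have hτ : 0 < min ε 1 := lt_min hε one_pos
  obtain ⟨φ, hφ, hφ'⟩ := hu.exists_testFunction hμ H.bounded hτ (min_le_right _ _)
  have hφm : MemLp φ 2 := φ.continuous.memLp_of_hasCompactSupport φ.hasCompactSupport
  have hφ1 : ContDiff ℝ 1 φ := contDiff_nat_of_smooth (TestFunction.contDiff_smooth φ) 1
  have hφ0 : ∀ x, x ∉ (Ω : Set (Euc d)) → φ x = 0 := fun x hx =>
    image_eq_zero_of_notMem_tsupport fun h => hx (φ.tsupport_subset h)
  have hsub : MemLp (fun x => U x - φ x) 2 := hUm.sub hφm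
  have h1 : ‖toL2 volume fun x => U x - φ x‖ ≤ L * min ε 1 := by
    have h2 : MemLp (fun x => (u : Euc d → ℝ) x - φ x) 2 μ :=
      (Lp.memLp u).sub (hμ.memLp_of_memLp hφm)
    have e : (fun x => U x - φ x) =
        (Ω : Set (Euc d)).indicator fun x => (u : Euc d → ℝ) x - φ x := by
      have h3 := Set.indicator_sub (Ω : Set (Euc d)) (u : Euc d → ℝ) φ
      rw [TestFunction.indicator_eq φ] at h3
      exact h3.symm
    rw [e]
    refine (hLb _ h2).trans (mul_le_mul_of_nonneg_left ?_ hL)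
    rwa [toL2_sub (Lp.memLp u) (hμ.memLp_of_memLp hφm), toL2_coeFn]
  have h2 : ‖toL2 volume (φ : Euc d → ℝ)‖ ≤ ‖toL2 volume U‖ + L := by
    have h3 := norm_sub_norm_le (toL2 volume (φ : Euc d → ℝ)) (toL2 volume U)
    rw [norm_sub_rev, ← toL2_sub hUm hφm] at h3
    have : L * min ε 1 ≤ L := mul_le_of_le_one_right hL (min_le_right _ _)
    linarith
  have hp : ∀ k, MemLp (pd k φ) 2 := fun k =>
    (continuous_pd k hφ1).memLp_of_hasCompactSupport (hasCompactSupport_pd k φ.hasCompactSupport)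
  have h3 : ∀ k, ‖toL2 volume (pd k φ)‖ ≤ b k := fun k => by
    have e : (Ω : Set (Euc d)).indicator (pd k φ) = pd k φ := Set.indicator_eq_self.2
      ((subset_tsupport _).trans ((tsupport_pd_subset k).trans φ.tsupport_subset))
    have := hLb _ (hμ.memLp_of_memLp (hp k))
    rw [e] at this
    exact this.trans (mul_le_mul_of_nonneg_left (hφ' k) hL)
  have h4 : ∫ x, (φ x * (η x + ε)⁻¹ ^ 1) ^ 2 ≤ B := by
    refine (hKb φ ε hε).trans (mul_le_mul_of_nonneg_left (add_le_add ?_ ?_) hK)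
    · rw [← norm_toL2_sq hφm]
      gcongr
    · refine Finset.sum_le_sum fun k _ => ?_
      rw [← norm_toL2_sq (hp k)]
      have := h3 k
      gcongr
  have m1 := H.memLp_mul_inv_pow hφm hφ0 hε 1
  have m2 := H.memLp_mul_inv_pow hsub (fun x hx => by simp [hU0 x hx, hφ0 x hx]) hε 1
  have h5 : ‖toL2 volume fun x => φ x * (η x + ε)⁻¹ ^ 1‖ ≤ Real.sqrt B := by
    refine Real.le_sqrt_of_sq_le ?_
    rwa [norm_toL2_sq m1]
  have h6 : ‖toL2 volume fun x => (U x - φ x) * (η x + ε)⁻¹ ^ 1‖ ≤ L := by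
    have h7 : ‖toL2 volume fun x => (U x - φ x) * (η x + ε)⁻¹ ^ 1‖ ≤
        ε⁻¹ * ‖toL2 volume fun x => U x - φ x‖ := by
      rw [toL2_of_memLp m2, toL2_of_memLp hsub]
      refine Lp.norm_le_mul_norm_of_ae_le_mul ?_
      filter_upwards [m2.coeFn_toLp, hsub.coeFn_toLp] with x h8 h9
      rw [h8, h9, norm_mul, mul_comm]
      by_cases hx : x ∈ (Ω : Set (Euc d))
      · have hp := H.pos x hx
        refine mul_le_mul_of_nonneg_right ?_ (norm_nonneg _)
        rw [pow_one, norm_inv, Real.norm_of_nonneg (by linarith)]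
        exact inv_anti₀ hε (by linarith)
      · simp [hU0 x hx, hφ0 x hx]
    refine h7.trans ((mul_le_mul_of_nonneg_left h1 (by positivity)).trans ?_)
    rw [inv_mul_le_iff₀ hε, mul_comm ε]
    exact mul_le_mul_of_nonneg_left (min_le_left _ _) hL
  have m3 := H.memLp_mul_inv_pow hUm hU0 hε 1
  rw [← norm_toL2_sq m3]
  have e : (fun x => U x * (η x + ε)⁻¹ ^ 1) =
      fun x => (U x - φ x) * (η x + ε)⁻¹ ^ 1 + φ x * (η x + ε)⁻¹ ^ 1 := by
    funext x; ring
  rw [e]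
  have := (norm_toL2_add_le m2 m1).trans (add_le_add h6 h5)
  gcongr

/-- The extension by zero of a function in `H² ∩ H¹₀`. -/
theorem MemH20.exists_isSobZero (hμ : IsComparable (Ω : Set (Euc d)) μ)
    (H : IsDefining (Ω : Set (Euc d)) η) {u : L2 μ} (hu : MemH20 Ω μ u) :
    ∃ u₁ u₂, IsSobZero (Ω : Set (Euc d)) η ((Ω : Set (Euc d)).indicator u) u₁ u₂ := by
  choose g hg using fun i : Fin d => hu.1 1 (by norm_num) fun _ : Fin 1 => i
  choose k hk using fun i j : Fin d => hu.1 2 le_rfl ![i, j]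
  exact ⟨fun i => (Ω : Set (Euc d)).indicator (g i), fun i j => (Ω : Set (Euc d)).indicator (k i j),
    { mem := hμ.memLp_indicator (Lp.memLp u)
      mem₁ := fun i => hμ.memLp_indicator (Lp.memLp _)
      mem₂ := fun i j => hμ.memLp_indicator (Lp.memLp _)
      zero := fun x hx => Set.indicator_of_notMem hx _
      zero₁ := fun i x hx => Set.indicator_of_notMem hx _
      zero₂ := fun i j x hx => Set.indicator_of_notMem hx _
      weak₁ := fun i => (hg i).isWeakPartial
      weak₂ := fun i j => (hg i).isWeakPartial_of_two (hk i j) rfl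
      div := hu.2.memLp_div hμ H }⟩

theorem IsComparable.toL2_indicator (hμ : IsComparable (Ω : Set (Euc d)) μ) (u : L2 μ) :
    toL2 μ ((Ω : Set (Euc d)).indicator u) = u := by
  refine (toL2_congr ?_).trans (toL2_coeFn u)
  filter_upwards [hμ.ae_mem Ω.isOpen.measurableSet] with x hx using Set.indicator_of_mem hx _

/-- A function orthogonal to the images of the ridge functions is orthogonal to the image of
`H² ∩ H¹₀`. -/
theorem inner_applyOp_eq_zero_of_opS_eq_zero (hμ : IsComparable (Ω : Set (Euc d)) μ)
    (H : IsDefining (Ω : Set (Euc d)) η) {σ : ℝ → ℝ} (hσ : CkBounded 4 σ)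
    (hσ' : ¬ ∃ s : ℝ, ∀ x, σ x = s) {ν : Measure (Param d)} (hν : IsInitialLaw ν)
    {A : L2 μ →ₗ.[ℝ] L2 μ} (hA : IsPDEOperator Ω μ A) {h : L2 μ} (hS : opS A η σ ν h = 0)
    {u : L2 μ} (hu : MemH20 Ω μ u) : ⟪h, applyOp A u⟫_ℝ = 0 := by
  obtain ⟨T, hT⟩ := hA.exists_continuousLinearMap hμ
  obtain ⟨C, hC⟩ := hσ.2 0 (by norm_num)
  obtain ⟨u₁, u₂, hsob⟩ := hu.exists_isSobZero hμ H
  obtain ⟨f, B, hf, hlim⟩ := hsob.isApproximable hμ H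
  obtain ⟨F, hF, hF0⟩ := exists_mem_sobH hμ hu.1
  rw [hμ.toL2_indicator] at hlim
  let l : SobE μ →L[ℝ] ℝ := (innerSL ℝ h).comp T
  have hη2 : ContDiff ℝ 2 η := H.smooth.of_le (by norm_num)
  have hl : ∀ n, l (jet μ fun x => η x * f n x) = 0 := fun n =>
    functional_mul_eq_zero hμ H.bounded l H.smooth (hσ.1.of_le (by norm_num))
      (fun x => by simpa using hC x) hσ'
      (fun w b => inner_ridge_eq_zero_of_opS_eq_zero hμ H.bounded H.smooth hσ hν hT hS w b)
      (hf n).1 (hf n).2.1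
  -- The approximants are bounded in `ℋ²` and converge in `L²`, so `l` passes to the limit although
  -- convergence in `ℋ²` is only weak.
  have h1 := tendsto_functional_of_bounded hμ l
    (fun n => jet_mem hμ H.bounded (hη2.mul (contDiff_nat_of_smooth (hf n).1 2)))
    (fun n => (hf n).2.2) hF (by
      rw [hF0]
      refine hlim.congr fun n => ?_
      rw [jet_zero])
  have h2 : l F = 0 := tendsto_nhds_unique h1 (by simp only [hl, tendsto_const_nhds])
  rw [← hF0, ← hT F hF]
  exact h2

end ZeroExtension

end DGM

end

theorem mainTheorem7 {d : ℕ} (Ω : TopologicalSpace.Opens (DGM.Euc d))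
    (hΩ : Bornology.IsBounded (Ω : Set (DGM.Euc d)))
    (a : ℝ≥0) (ha₀ : 0 < a) (ha₁ : a < 1)
    (hbdry : DGM.HasHolderBoundary 3 a (Ω : Set (DGM.Euc d)))
    (μ : Measure (DGM.Euc d)) (hμ : DGM.IsSamplingMeasure (Ω : Set (DGM.Euc d)) μ)
    (η : DGM.Euc d → ℝ) (hη : DGM.IsAuxiliary (Ω : Set (DGM.Euc d)) η)
    (σ : ℝ → ℝ) (hσ : DGM.CkBounded 4 σ) (hσ' : ¬ ∃ s : ℝ, ∀ x, σ x = s)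
    (ν : Measure (DGM.Param d)) (hν : DGM.IsInitialLaw ν)
    (A : DGM.L2 μ →ₗ.[ℝ] DGM.L2 μ) (hA : DGM.IsPDEOperator Ω μ A) :
    (∀ h : DGM.L2 μ, DGM.opS A η σ ν h = 0 →
      ∀ f : DGM.L2 μ, DGM.MemH20 Ω μ f → ⟪h, DGM.applyOp A f⟫_ℝ = 0) ∧
    (∀ g u : DGM.L2 μ, DGM.MemH20 Ω μ u → DGM.applyOp A u = g →
      ∀ Q : ℝ → DGM.L2 μ, DGM.IsLimitSolution A η σ ν Ω g Q →
      ∀ t : ℝ, 0 ≤ t → ∀ h : DGM.L2 μ, DGM.opS A η σ ν h = 0 →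
        ⟪h, DGM.applyOp A (Q t) - g⟫_ℝ = 0) := by
  have hc := hμ.isComparable
  have H := hη.isDefining Ω.isOpen hΩ hbdry
  refine ⟨fun h hS f hf => DGM.inner_applyOp_eq_zero_of_opS_eq_zero hc H hσ hσ' hν hA hS hf,
    fun g u hu hug Q hQ t ht h hS => ?_⟩
  -- Since `g = A u`, the residual is a difference of two images of `ℋ²_(0)`, each orthogonal to `h`
  -- by (i).
  rw [inner_sub_right, ← hug,
    DGM.inner_applyOp_eq_zero_of_opS_eq_zero hc H hσ hσ' hν hA hS (hQ.mem t ht),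
    DGM.inner_applyOp_eq_zero_of_opS_eq_zero hc H hσ hσ' hν hA hS hu, sub_zero]
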